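/- **Setting.** Let $\varepsilon_1,\varepsilon_2,\dots$ be i.i.d. real random variables with mean $0$, variance $1$ and finite fourth moment. For each $n$ let $0=x_{n,0}\le x_{n,1}\le\dots\le x_{n,n}\le x_{n,n+1}=1$ be fixed design points with $\max_{0\le i\le n}(x_{n,i+1}-x_{n,i})=O(1/n)$. One observes $$y_i=g(x_{n,i})+\sqrt{V(x_{n,i})}\,\varepsilon_i,\qquad i=1,\dots,n .$$ Let $d_0,\dots,d_r$ be a difference sequence ($\sum_j d_j=0$, $\sum_j d_j^2=1$), and put $\Delta_i=\sum_{j=0}^r d_j\,y_{j+i-\lfloor r/2\rfloor}$ for $\lfloor r/2\rfloor+1\le i\le n+\lfloor r/2\rfloor-r$. Let $K\ge 0$ be a bounded weight function supported on $[-1,1]$ with $\int K=1$, continuous almost everywhere (i.e. Riemann integrable). For $p\in\mathbb N$ and a bandwidth $h>0$ let $\hat V_h(t)=\hat a_0$, where $(\hat a_0,\dots,\hat a_p)$ minimizes $$\sum_i\Bigl(\Delta_i^2-\sum_{k=0}^p a_k(t-x_{n,i})^k\Bigr)^2K\Bigl(\frac{t-x_{n,i}}h\Bigr);$$ $\hat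 V_h(t)$ is called well defined if, for all values of the observations, all minimizers have the same $\hat a_0$. The risk is $R(V(t),\hat V_h(t))=E[\hat V_h(t)-V(t)]^2$. Fix $C_1,C_2>0$. For $\gamma>0$ let $\lfloor\gamma\rfloor$ be the greatest integer *strictly less* than $\gamma$, and let $\mathcal C_\gamma$ be the class of functions $f$ that are $\lfloor\gamma\rfloor$ times continuously differentiable on $(0,1)$ and satisfy there $$|f^{(\lfloor\gamma\rfloor)}(s)-f^{(\lfloor\gamma\rfloor)}(t)|\le C_1|s-t|^{\gamma-\lfloor\gamma\rfloor}\quad\text{and}\quad |f^{(k)}(s)|\le C_2\ \text{ for } 0\le k\le\max(\lfloor\gamma\rfloor-1,0).$$ Variance functions $V$ are in addition nonnegative on $[0,1]$. Let $x_0\in(0,1)$ and suppose that the design has bounded density at $x_0$: $\#\{1\le i\le n:|x_{n,i}-x_0|\le t\}\le C\,nt$ for all $n\ge1$ and $t\ge 1/n$, with some constant $C$. **Theorem 2.8.** Let $\gamma>0$ and $p>\lfloor\gamma\rfloor$. All constants below are independent of $n$, $h$, $g$, $V$ and of $\beta$; "for $n$ large" means from some $n$ on that may depend on $\beta$ but not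 on $h,g,V$. Write $$\mathcal R_n(h)=\sup\{R(V(x_0),\hat V_h(x_0)):V\in\mathcal C_\gamma,\ V\ge0\text{ on }[0,1],\ g\in\mathcal C_\beta\}.$$ 1. (Exact order of the maximal risk.) For all $0<\underline a\le\bar a<\infty$ there are $\underline B,\bar B>0$ such that for every $\beta>\gamma/(4\gamma+2)$, all $n$ large and all $h$ with $\underline a\le n^{1/(2\gamma+1)}h\le\bar a$, the estimator $\hat V_h(x_0)$ is well defined and $$\underline B\,n^{-2\gamma/(2\gamma+1)}\le\mathcal R_n(h)\le\bar B\,n^{-2\gamma/(2\gamma+1)} .$$ In particular the upper bound holds uniformly for $g\in\mathcal C_\beta$ and $V\in\mathcal C_\gamma$, $V\ge 0$. 2. (Uniform lower bound for nondegenerate variance.) For all $0<\underline a\le\bar a<\infty$ and $\delta>0$ there is $\underline B>0$ such that for every $\beta>\gamma/(4\gamma+2)$, all $n$ large, all $h$ with $\underline a\le n^{1/(2\gamma+1)}h\le\bar a$, all $g\in\mathcal C_\beta$ and all $V\in\mathcal C_\gamma$ with $V\ge0$ on $[0,1]$ and $V(x_0)\ge\delta$, $$R(V(x_0),\hat V_h(x_0))\ge\underline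 B\,n^{-2\gamma/(2\gamma+1)} .$$ 3. (Optimal bandwidth.) For every $A\ge1$ there are $c,C>0$ such that for every $\beta>\gamma/(4\gamma+2)$ and all $n$ large, every $h$ that minimizes $\mathcal R_n$ up to the factor $A$ satisfies $$c\,n^{-1/(2\gamma+1)}\le h\le C\,n^{-1/(2\gamma+1)} .$$ ($A=1$: exact minimizers.) Here the competing bandwidths are all those for which $\hat V_h(x_0)$ is well defined and $0<h\le\min(x_0,1-x_0)$; if $K$ is bounded below by a positive constant on a neighbourhood of $0$, the same holds when all $h>0$ for which $\hat V_h(x_0)$ is well defined compete. -/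

import Mathlib

open MeasureTheory ProbabilityTheory Filter Set
open scoped ENNReal

noncomputable section

namespace DiffVar

/-- The greatest integer strictly less than `γ` (for `γ > 0`). -/
def strictFloor (γ : ℝ) : ℕ := ⌈γ⌉₊ - 1

/-- The Lipschitz ball of order `γ` with constants `C₁`, `C₂`, with `ℓ = strictFloor γ`:
functions that are `ℓ` times continuously differentiable on `(0,1)`, with `ℓ`-th derivative
Hölder of exponent `γ - ℓ` and constant `C₁` there, and with `|f^(k)| ≤ C₂` on `(0,1)` for
`k = 0, …, max (ℓ - 1) 0` (natural-number subtraction: the bound on `|f|` itself is always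
included). Values outside `(0,1)` are not restricted. -/
def holderClass (C₁ C₂ γ : ℝ) : Set (ℝ → ℝ) :=
  {f | ContDiffOn ℝ (strictFloor γ : ℕ) f (Ioo 0 1) ∧
    (∀ s ∈ Ioo (0 : ℝ) 1, ∀ t ∈ Ioo (0 : ℝ) 1,
      |iteratedDeriv (strictFloor γ) f s - iteratedDeriv (strictFloor γ) f t|
        ≤ C₁ * |s - t| ^ (γ - (strictFloor γ : ℝ))) ∧
    (∀ k : ℕ, k ≤ strictFloor γ - 1 → ∀ t ∈ Ioo (0 : ℝ) 1, |iteratedDeriv k f t| ≤ C₂)}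

/-- Variance functions in the Lipschitz ball: those that are nonnegative on `[0,1]`. -/
def varianceClass (C₁ C₂ γ : ℝ) : Set (ℝ → ℝ) :=
  {V | V ∈ holderClass C₁ C₂ γ ∧ ∀ t ∈ Icc (0 : ℝ) 1, 0 ≤ V t}

/-- A difference sequence `d 0, …, d r` of order `r`. -/
def IsDifferenceSequence (r : ℕ) (d : ℕ → ℝ) : Prop :=
  ∑ j ∈ Finset.range (r + 1), d j = 0 ∧ ∑ j ∈ Finset.range (r + 1), d j ^ 2 = 1

/-- A weight function: nonnegative, bounded, supported on `[-1,1]`, with integral one. -/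
def IsWeightFunction (K : ℝ → ℝ) : Prop :=
  (∀ u, 0 ≤ K u) ∧ (∃ M : ℝ, ∀ u, K u ≤ M) ∧ (∀ u, 1 < |u| → K u = 0) ∧ ∫ u, K u = 1

/-- A triangular array of ordered fixed designs `0 = x n 0 ≤ x n 1 ≤ ⋯ ≤ x n n ≤ x n (n+1) = 1`
whose largest gap is `O(1/n)`. The `n`-th design consists of the points `x n 1, …, x n n`. -/
def IsDesign (x : ℕ → ℕ → ℝ) : Prop :=
  (∀ n, x n 0 = 0 ∧ x n (n + 1) = 1 ∧ ∀ i ≤ n, x n i ≤ x n (i + 1)) ∧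
    ∃ C : ℝ, ∀ n : ℕ, 1 ≤ n → ∀ i ≤ n, x n (i + 1) - x n i ≤ C / n

/-- The number of design points within distance `t` of `x₀` is `O(n t)`, uniformly in
`t ≥ 1/n`. -/
def HasBoundedDensityAt (x : ℕ → ℕ → ℝ) (x₀ : ℝ) : Prop :=
  ∃ C : ℝ, ∀ n : ℕ, 1 ≤ n → ∀ t : ℝ, 1 / (n : ℝ) ≤ t →
    (((Finset.Icc 1 n).filter (fun i => |x n i - x₀| ≤ t)).card : ℝ) ≤ C * n * t

/-- Errors that are i.i.d. with mean zero, variance one and finite fourth moment. -/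
def IsErrorSequence {Ω : Type*} [MeasurableSpace Ω] (P : Measure Ω) (ε : ℕ → Ω → ℝ) : Prop :=
  iIndepFun ε P ∧ (∀ i, IdentDistrib (ε i) (ε 0) P P) ∧ MemLp (ε 0) 4 P ∧
    ∫ ω, ε 0 ω ∂P = 0 ∧ ∫ ω, ε 0 ω ^ 2 ∂P = 1

/-- The observations `y i = g (x i) + √(V (x i)) e i`. -/
def observation (x : ℕ → ℝ) (g V : ℝ → ℝ) (e : ℕ → ℝ) (i : ℕ) : ℝ :=
  g (x i) + √(V (x i)) * e i

/-- The data that specify an estimator: order `r`, difference sequence `d`, degree `p` of the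
local polynomial, weight function `K`. -/
structure Spec where
  r : ℕ
  d : ℕ → ℝ
  p : ℕ
  K : ℝ → ℝ

/-- The pseudoresidual `Δ i` of order `r`, used for `i ∈ indices S n` only, where the
subtraction does not truncate. -/
def pseudoresidual (S : Spec) (y : ℕ → ℝ) (i : ℕ) : ℝ :=
  ∑ j ∈ Finset.range (S.r + 1), S.d j * y (j + i - S.r / 2)

/-- The indices `⌊r/2⌋ + 1, …, n + ⌊r/2⌋ - r` of the pseudoresiduals. -/
def indices (S : Spec) (n : ℕ) : Finset ℕ :=
  Finset.Icc (S.r / 2 + 1) (n + S.r / 2 - S.r)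

/-- The locally weighted sum of squares at the point `t` with bandwidth `h`, as a function of
the coefficients `a 0, …, a p`. -/
def localLoss (S : Spec) (n : ℕ) (x y : ℕ → ℝ) (t h : ℝ) (a : Fin (S.p + 1) → ℝ) : ℝ :=
  ∑ i ∈ indices S n,
    (pseudoresidual S y i ^ 2 - ∑ k : Fin (S.p + 1), a k * (t - x i) ^ (k : ℕ)) ^ 2
      * S.K ((t - x i) / h)

/-- `v` is the constant coefficient of a minimizer of the local loss. -/
def IsEstimate (S : Spec) (n : ℕ) (x y : ℕ → ℝ) (t h v : ℝ) : Prop :=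
  ∃ a : Fin (S.p + 1) → ℝ, (∀ b, localLoss S n x y t h a ≤ localLoss S n x y t h b) ∧ a 0 = v

/-- The estimator at `t` with bandwidth `h` is well defined: for all observations the local
loss has a minimizer, and all minimizers have the same constant coefficient. -/
def WellDefined (S : Spec) (n : ℕ) (x : ℕ → ℝ) (t h : ℝ) : Prop :=
  ∀ y : ℕ → ℝ, ∃! v, IsEstimate S n x y t h v

/-- The variance estimator at `t`: the constant coefficient of the local polynomial fit to the
squared pseudoresiduals (meaningful when `WellDefined` holds). -/
def varEstimator (S : Spec) (n : ℕ) (x y : ℕ → ℝ) (t h : ℝ) : ℝ :=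
  Classical.epsilon (fun v => IsEstimate S n x y t h v)

/-- The mean squared error at the point `t`, in `[0,∞]`. -/
def risk {Ω : Type*} [MeasurableSpace Ω] (P : Measure Ω) (ε : ℕ → Ω → ℝ)
    (S : Spec) (n : ℕ) (x : ℕ → ℝ) (g V : ℝ → ℝ) (t h : ℝ) : ℝ≥0∞ :=
  ∫⁻ ω, ENNReal.ofReal
    ((varEstimator S n x (observation x g V (fun i => ε i ω)) t h - V t) ^ 2) ∂P

/-- The maximal mean squared error at `t` over `V` of order `γ` and `g` of order `β`. -/
def maxRisk {Ω : Type*} [MeasurableSpace Ω] (P : Measure Ω) (ε : ℕ → Ω → ℝ)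
    (S : Spec) (C₁ C₂ γ β : ℝ) (n : ℕ) (x : ℕ → ℝ) (t h : ℝ) : ℝ≥0∞ :=
  ⨆ V ∈ varianceClass C₁ C₂ γ, ⨆ g ∈ holderClass C₁ C₂ β, risk P ε S n x g V t h

/-- `h` minimizes the maximal risk at `t`, up to the factor `A`, among the bandwidths in `H`
for which the estimator is well defined. For `A = 1` this says that `h` is an (exactly) optimal
bandwidth in the minimax sense. -/
def IsOptimalBandwidth {Ω : Type*} [MeasurableSpace Ω] (P : Measure Ω) (ε : ℕ → Ω → ℝ)
    (S : Spec) (C₁ C₂ γ β : ℝ) (n : ℕ) (x : ℕ → ℝ) (t : ℝ) (H : Set ℝ) (A h : ℝ) : Prop :=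
  h ∈ H ∧ WellDefined S n x t h ∧ ∀ h' ∈ H, WellDefined S n x t h' →
    maxRisk P ε S C₁ C₂ γ β n x t h ≤ ENNReal.ofReal A * maxRisk P ε S C₁ C₂ γ β n x t h'

end DiffVar

end

noncomputable section

namespace DiffVar

/-! If `WellDefined` holds, evaluation of polynomials of degree at most `p` at the target point is
represented by the weighted design (`WellDefined.exists_represents`). The estimator is then a fixed
linear combination `∑ w i * Δ i ^ 2` whose weights reproduce polynomials
(`WellDefined.varEstimator_eq`), and its risk splits into variance plus squared bias.

Upper bound. Where the weight function is bounded below there are at least a constant times `n h`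
design points, which form many groups of `p + 1` separated nodes. Lagrange interpolation on each
group gives `Controls` with constant of order `1/(n h)` (`controls_of_interval`), hence weights of
order `1/(n h)`, while bounded density leaves only `O(n h)` of them nonzero. Finite-range dependence
yields variance `O(1/(n h))` (`IsErrorSequence.variance_quadEstimate_le`). Taylor expansion and
reproduction of polynomials yield bias of order `h^γ`, plus `n^(-2 min(β,1))` from differencing `g`
and `n^(-min(γ,1))` from shifting the argument of `V` (`abs_quadMean_sub_le`). At `h` of order
`n^(-1/(2γ+1))` variance and squared bias balance, and `β > γ/(4γ+2)` makes the contribution of `g`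
negligible.

Lower bound. Let `a < b` be the first and last positions with nonzero `d`. The products of the
errors numbered `a + i` and `b + i` (up to the common shift) are orthonormal, and each correlates
with `Δ l ^ 2` only for `l = i`. Bessel's inequality bounds the mean squared error about any
constant below by a multiple of `∑ w i ^ 2` when `V` is bounded below
(`IsErrorSequence.le_integral_quadEstimate`). Since the weights sum to one, Cauchy–Schwarz makes
this at least of order `1/(n h)`.

Bandwidth. A small `h` is excluded by this noise bound at constant `V`. A large `h` is excluded by a
bump in `V` of width and height of order `h` and `h^γ`: it holds too few design points for the small
weights to recover more than half its height (`risk_ge_of_bump`). Both bounds are compared with the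
upper bound at `rate γ n` (`exists_bandwidth_bounds`). -/

/-! ### Weighted least squares: normal equations, representers, well-definedness. -/

/-- The value at `s` of the polynomial with coefficients `b 0, …, b p`. -/
def polyVal {p : ℕ} (b : Fin (p + 1) → ℝ) (s : ℝ) : ℝ := ∑ k, b k * s ^ (k : ℕ)

lemma polyVal_add {p : ℕ} (b c : Fin (p + 1) → ℝ) (s : ℝ) :
    polyVal (b + c) s = polyVal b s + polyVal c s := by
  simp [polyVal, add_mul, Finset.sum_add_distrib]

lemma polyVal_smul {p : ℕ} (a : ℝ) (b : Fin (p + 1) → ℝ) (s : ℝ) :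
    polyVal (a • b) s = a * polyVal b s := by
  simp [polyVal, Finset.mul_sum, mul_assoc]

lemma polyVal_zero_right {p : ℕ} (b : Fin (p + 1) → ℝ) : polyVal b 0 = b 0 := by
  simp only [polyVal, Fin.sum_univ_succ]
  simp

/-- The weighted Gram form of the monomials, as a map to the dual. -/
def gramForm (p : ℕ) (I : Finset ℕ) (s k : ℕ → ℝ) :
    (Fin (p + 1) → ℝ) →ₗ[ℝ] Module.Dual ℝ (Fin (p + 1) → ℝ) :=
  LinearMap.mk₂ ℝ (fun c b => ∑ i ∈ I, k i * polyVal c (s i) * polyVal b (s i))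
    (fun a b c => by
      simp only [polyVal_add, ← Finset.sum_add_distrib]; exact Finset.sum_congr rfl fun _ _ => by ring)
    (fun a b c => by
      simp only [polyVal_smul, smul_eq_mul, Finset.mul_sum]
      exact Finset.sum_congr rfl fun _ _ => by ring)
    (fun a b c => by
      simp only [polyVal_add, ← Finset.sum_add_distrib]; exact Finset.sum_congr rfl fun _ _ => by ring)
    (fun a b c => by
      simp only [polyVal_smul, smul_eq_mul, Finset.mul_sum]
      exact Finset.sum_congr rfl fun _ _ => by ring)

lemma gramForm_apply (p : ℕ) (I : Finset ℕ) (s k : ℕ → ℝ) (c b : Fin (p + 1) → ℝ) :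
    gramForm p I s k c b = ∑ i ∈ I, k i * polyVal c (s i) * polyVal b (s i) := rfl

/-- The range of a dual map is the annihilator of the kernel, and a kernel vector makes the
quadratic form vanish. Since the form is symmetric and the space reflexive, this solves the normal
equations even for a singular Gram matrix. -/
lemma exists_gramForm_eq {p : ℕ} {I : Finset ℕ} {s k : ℕ → ℝ}
    (e : Module.Dual ℝ (Fin (p + 1) → ℝ))
    (he : ∀ b, ∑ i ∈ I, k i * polyVal b (s i) ^ 2 = 0 → e b = 0) :
    ∃ c, gramForm p I s k c = e := by
  have h : e ∈ LinearMap.range (gramForm p I s k).dualMap := by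
    rw [LinearMap.range_dualMap_eq_dualAnnihilator_ker, Submodule.mem_dualAnnihilator]
    intro b hb
    apply he
    have := congrArg (fun f => f b) (LinearMap.mem_ker.mp hb)
    simp only [gramForm_apply, LinearMap.zero_apply] at this
    rw [← this]
    exact Finset.sum_congr rfl fun _ _ => by ring
  obtain ⟨ψ, hψ⟩ := h
  obtain ⟨c, rfl⟩ := (Module.evalEquiv ℝ (Fin (p + 1) → ℝ)).surjective ψ
  refine ⟨c, ?_⟩
  refine LinearMap.ext fun b => ?_
  rw [← hψ]
  simp only [LinearMap.dualMap_apply,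
    Module.evalEquiv_apply, Module.Dual.eval_apply, gramForm_apply]
  exact Finset.sum_congr rfl fun _ _ => by ring

lemma localLoss_eq (S : Spec) (n : ℕ) (x y : ℕ → ℝ) (t h : ℝ) (a : Fin (S.p + 1) → ℝ) :
    localLoss S n x y t h a = ∑ i ∈ indices S n,
      (pseudoresidual S y i ^ 2 - polyVal a (t - x i)) ^ 2 * S.K ((t - x i) / h) := rfl

lemma localLoss_add (S : Spec) (n : ℕ) (x y : ℕ → ℝ) (t h : ℝ) (a b : Fin (S.p + 1) → ℝ) :
    localLoss S n x y t h (a + b) = localLoss S n x y t h a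
      - 2 * ∑ i ∈ indices S n, S.K ((t - x i) / h) *
        (pseudoresidual S y i ^ 2 - polyVal a (t - x i)) * polyVal b (t - x i)
      + ∑ i ∈ indices S n, S.K ((t - x i) / h) * polyVal b (t - x i) ^ 2 := by
  simp only [localLoss_eq, Finset.mul_sum, ← Finset.sum_sub_distrib, ← Finset.sum_add_distrib,
    polyVal_add]
  exact Finset.sum_congr rfl fun _ _ => by ring

lemma eq_zero_of_forall_quadratic_nonneg {B D : ℝ} (h : ∀ u : ℝ, 0 ≤ -2 * u * B + u ^ 2 * D) :
    B = 0 := by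
  by_contra hB
  have hB2 : 0 < B ^ 2 := by positivity
  have hD : 0 < |D| + 1 := by positivity
  -- A small step in the direction of `B`: the linear term beats the quadratic one.
  have h1 := h (B / (|D| + 1))
  have h2 : -2 * (B / (|D| + 1)) * B + (B / (|D| + 1)) ^ 2 * D
      = (B ^ 2 / (|D| + 1) ^ 2) * (-2 * (|D| + 1) + D) := by
    field_simp
  rw [h2] at h1
  have h3 : 0 < B ^ 2 / (|D| + 1) ^ 2 := by positivity
  nlinarith [le_abs_self D, abs_nonneg D]

lemma normal_equations {S : Spec} {n : ℕ} {x y : ℕ → ℝ} {t h : ℝ} {a : Fin (S.p + 1) → ℝ}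
    (ha : ∀ b, localLoss S n x y t h a ≤ localLoss S n x y t h b) (b : Fin (S.p + 1) → ℝ) :
    ∑ i ∈ indices S n, S.K ((t - x i) / h) *
        (pseudoresidual S y i ^ 2 - polyVal a (t - x i)) * polyVal b (t - x i) = 0 := by
  apply eq_zero_of_forall_quadratic_nonneg
    (D := ∑ i ∈ indices S n, S.K ((t - x i) / h) * polyVal b (t - x i) ^ 2)
  intro u
  have h1 := ha (a + u • b)
  rw [localLoss_add] at h1
  have e1 : ∑ i ∈ indices S n, S.K ((t - x i) / h) *
        (pseudoresidual S y i ^ 2 - polyVal a (t - x i)) * polyVal (u • b) (t - x i)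
      = u * ∑ i ∈ indices S n, S.K ((t - x i) / h) *
        (pseudoresidual S y i ^ 2 - polyVal a (t - x i)) * polyVal b (t - x i) := by
    rw [Finset.mul_sum]
    exact Finset.sum_congr rfl fun _ _ => by rw [polyVal_smul]; ring
  have e2 : ∑ i ∈ indices S n, S.K ((t - x i) / h) * polyVal (u • b) (t - x i) ^ 2
      = u ^ 2 * ∑ i ∈ indices S n, S.K ((t - x i) / h) * polyVal b (t - x i) ^ 2 := by
    rw [Finset.mul_sum]
    exact Finset.sum_congr rfl fun _ _ => by rw [polyVal_smul]; ring
  rw [e1, e2] at h1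
  linarith

/-- `c` represents evaluation of polynomials at the point `t` in the weighted design. -/
def Represents (S : Spec) (n : ℕ) (x : ℕ → ℝ) (t h : ℝ) (c : Fin (S.p + 1) → ℝ) : Prop :=
  ∀ b : Fin (S.p + 1) → ℝ, ∑ i ∈ indices S n,
    (S.K ((t - x i) / h) * polyVal c (t - x i)) * polyVal b (t - x i) = b 0

/-- Testing the normal equations against the representer `c` isolates the constant coefficient. -/
lemma isEstimate_eq {S : Spec} {n : ℕ} {x y : ℕ → ℝ} {t h v : ℝ} {c : Fin (S.p + 1) → ℝ}
    (hc : Represents S n x t h c) (hv : IsEstimate S n x y t h v) :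
    v = ∑ i ∈ indices S n,
      (S.K ((t - x i) / h) * polyVal c (t - x i)) * pseudoresidual S y i ^ 2 := by
  obtain ⟨a, ha, rfl⟩ := hv
  rw [← hc a, ← sub_eq_zero, ← neg_eq_zero, ← normal_equations ha c, neg_sub,
    ← Finset.sum_sub_distrib]
  exact Finset.sum_congr rfl fun _ _ => by ring

/-- Adding a vector of the null space to a minimizer gives another minimizer, so uniqueness of the
constant coefficient forces evaluation at 0 to vanish on the null space. Definiteness is not needed,
which matters for arbitrary competing bandwidths. -/
lemma WellDefined.exists_represents {S : Spec} {n : ℕ} {x : ℕ → ℝ} {t h : ℝ}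
    (hw : WellDefined S n x t h) : ∃ c, Represents S n x t h c := by
  have key : ∀ b : Fin (S.p + 1) → ℝ, ∑ i ∈ indices S n,
      S.K ((t - x i) / h) * polyVal b (t - x i) ^ 2 = 0 → b 0 = 0 := by
    intro b hb
    obtain ⟨v, ⟨a, ha, rfl⟩, hv⟩ := hw 0
    have h1 : IsEstimate S n x 0 t h ((a + b) 0) := by
      refine ⟨a + b, fun b' => ?_, rfl⟩
      rw [localLoss_add, hb, normal_equations ha b]
      simpa using ha b'
    simpa using hv _ h1
  obtain ⟨c, hc⟩ := exists_gramForm_eq (I := indices S n) (s := fun i => t - x i)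
    (k := fun i => S.K ((t - x i) / h)) (LinearMap.proj (0 : Fin (S.p + 1))) key
  exact ⟨c, fun b => congrArg (fun f => f b) hc⟩

lemma WellDefined.varEstimator_eq {S : Spec} {n : ℕ} {x : ℕ → ℝ} {t h : ℝ}
    (hw : WellDefined S n x t h) {c : Fin (S.p + 1) → ℝ} (hc : Represents S n x t h c)
    (y : ℕ → ℝ) : varEstimator S n x y t h = ∑ i ∈ indices S n,
      (S.K ((t - x i) / h) * polyVal c (t - x i)) * pseudoresidual S y i ^ 2 :=
  isEstimate_eq hc (Classical.epsilon_spec (hw y).exists)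

lemma wellDefined_of_definite {S : Spec} {n : ℕ} {x : ℕ → ℝ} {t h : ℝ}
    (hK : ∀ u, 0 ≤ S.K u)
    (hS : ∀ b : Fin (S.p + 1) → ℝ, ∑ i ∈ indices S n,
      S.K ((t - x i) / h) * polyVal b (t - x i) ^ 2 = 0 → b = 0) :
    WellDefined S n x t h := by
  intro y
  let e : Module.Dual ℝ (Fin (S.p + 1) → ℝ) :=
    { toFun := fun b => ∑ i ∈ indices S n,
        S.K ((t - x i) / h) * pseudoresidual S y i ^ 2 * polyVal b (t - x i)
      map_add' := fun a b => by
        simp only [polyVal_add, ← Finset.sum_add_distrib]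
        exact Finset.sum_congr rfl fun _ _ => by ring
      map_smul' := fun a b => by
        simp only [polyVal_smul, smul_eq_mul, RingHom.id_apply, Finset.mul_sum]
        exact Finset.sum_congr rfl fun _ _ => by ring }
  obtain ⟨a, ha⟩ := exists_gramForm_eq (I := indices S n) (s := fun i => t - x i)
    (k := fun i => S.K ((t - x i) / h)) e (fun b hb => by rw [hS b hb, map_zero])
  have ha' : ∀ b : Fin (S.p + 1) → ℝ, ∑ i ∈ indices S n, S.K ((t - x i) / h) *
        (pseudoresidual S y i ^ 2 - polyVal a (t - x i)) * polyVal b (t - x i) = 0 := by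
    intro b
    have h1 : _ = ∑ i ∈ indices S n,
        S.K ((t - x i) / h) * pseudoresidual S y i ^ 2 * polyVal b (t - x i) :=
      congrArg (fun f => f b) ha
    rw [gramForm_apply] at h1
    rw [← sub_eq_zero, ← Finset.sum_sub_distrib] at h1
    rw [← neg_eq_zero, ← h1, ← Finset.sum_neg_distrib]
    exact Finset.sum_congr rfl fun _ _ => by ring
  have hadd : ∀ b, localLoss S n x y t h (a + b) = localLoss S n x y t h a
      + ∑ i ∈ indices S n, S.K ((t - x i) / h) * polyVal b (t - x i) ^ 2 := by
    intro b; rw [localLoss_add, ha']; ring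
  have hmin : ∀ b, localLoss S n x y t h a ≤ localLoss S n x y t h b := by
    intro b
    have h1 := hadd (b - a)
    rw [add_sub_cancel] at h1
    rw [h1]
    exact le_add_of_nonneg_right (Finset.sum_nonneg fun i _ => mul_nonneg (hK _) (sq_nonneg _))
  refine ⟨a 0, ⟨a, hmin, rfl⟩, ?_⟩
  rintro v ⟨a', ha2, rfl⟩
  have h1 := hadd (a' - a)
  rw [add_sub_cancel] at h1
  have h2 := ha2 a
  have h3 := hmin a'
  have h4 := hS (a' - a) (by linarith)
  rw [sub_eq_zero.mp h4]

/-! ### Lagrange interpolation and control of polynomials by the local design. -/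

lemma polyVal_eq_eval {p : ℕ} (b : Fin (p + 1) → ℝ) (s : ℝ) :
    polyVal b s = (∑ k : Fin (p + 1), Polynomial.C (b k) * Polynomial.X ^ (k : ℕ)).eval s := by
  simp [polyVal, Polynomial.eval_finsetSum]

lemma degree_sum_lt {p : ℕ} (b : Fin (p + 1) → ℝ) :
    (∑ k : Fin (p + 1), Polynomial.C (b k) * Polynomial.X ^ (k : ℕ)).degree
      < ((p + 1 : ℕ) : WithBot ℕ) := by
  refine (Polynomial.degree_sum_le _ _).trans_lt ?_
  rw [Finset.sup_lt_iff (WithBot.bot_lt_coe _)]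
  intro k _
  refine (Polynomial.degree_C_mul_X_pow_le _ _).trans_lt ?_
  exact_mod_cast k.2

/-- Lagrange interpolation bounds a polynomial by its values at separated nodes. -/
lemma polyVal_sq_le_of_separated {p : ℕ} (b : Fin (p + 1) → ℝ) {v : Fin (p + 1) → ℝ} {H δ t : ℝ}
    (hδ : 0 < δ) (hv : ∀ k, |v k| ≤ H) (hsep : ∀ k l, k ≠ l → δ ≤ |v k - v l|) (ht : |t| ≤ H) :
    polyVal b t ^ 2 ≤ (p + 1) * (2 * H / δ) ^ (2 * p) * ∑ k, polyVal b (v k) ^ 2 := by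
  have hinj : Set.InjOn v (Finset.univ : Finset (Fin (p + 1))) := by
    intro k _ l _ hkl
    by_contra h
    have := hsep k l h
    rw [hkl, sub_self, abs_zero] at this
    linarith
  have hH : 0 ≤ H := (abs_nonneg t).trans ht
  have h1 := Lagrange.eq_interpolate (s := Finset.univ) (v := v) hinj
    (f := ∑ k : Fin (p + 1), Polynomial.C (b k) * Polynomial.X ^ (k : ℕ))
    (by simpa using degree_sum_lt b)
  have h2 : polyVal b t = ∑ k, polyVal b (v k) *
      ((Lagrange.basis Finset.univ v k).eval t) := by
    conv_lhs => rw [polyVal_eq_eval, h1]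
    simp [Lagrange.interpolate_apply, Polynomial.eval_finsetSum, polyVal_eq_eval]
  have h3 : ∀ k, |(Lagrange.basis Finset.univ v k).eval t| ≤ (2 * H / δ) ^ p := by
    intro k
    rw [Lagrange.basis, Polynomial.eval_prod, Finset.abs_prod]
    have : (Finset.univ.erase k).card = p := by simp
    conv_rhs => rw [← this, ← Finset.prod_const]
    refine Finset.prod_le_prod (fun _ _ => abs_nonneg _) fun l hl => ?_
    rw [Lagrange.basisDivisor]
    simp only [Polynomial.eval_mul, Polynomial.eval_C, Polynomial.eval_sub, Polynomial.eval_X]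
    rw [abs_mul, abs_inv, inv_mul_eq_div]
    apply div_le_div₀ (by positivity) _ hδ (hsep k l (Finset.ne_of_mem_erase hl).symm)
    calc |t - v l| ≤ |t| + |v l| := abs_sub _ _
      _ ≤ 2 * H := by linarith [hv l]
  rw [h2]
  calc (∑ k, polyVal b (v k) * ((Lagrange.basis Finset.univ v k).eval t)) ^ 2
      ≤ (Finset.univ : Finset (Fin (p + 1))).card *
        ∑ k, (polyVal b (v k) * ((Lagrange.basis Finset.univ v k).eval t)) ^ 2 :=
        sq_sum_le_card_mul_sum_sq
    _ ≤ (p + 1) * ∑ k, (2 * H / δ) ^ (2 * p) * polyVal b (v k) ^ 2 := by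
        simp only [Finset.card_univ, Fintype.card_fin, Nat.cast_add, Nat.cast_one]
        gcongr with k
        rw [mul_pow, mul_comm, pow_mul', ← sq_abs (Polynomial.eval _ _)]
        gcongr
        exact h3 k
    _ = _ := by rw [← Finset.mul_sum]; ring

/-- An ordered design on `[0,1]` with gaps at most `D / n`. -/
def IsGapDesign (n : ℕ) (x : ℕ → ℝ) (D : ℝ) : Prop :=
  x 0 = 0 ∧ x (n + 1) = 1 ∧ (∀ i ≤ n, x i ≤ x (i + 1)) ∧ ∀ i ≤ n, x (i + 1) - x i ≤ D / n

namespace IsGapDesign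

variable {n : ℕ} {x : ℕ → ℝ} {D : ℝ}

lemma mono (hx : IsGapDesign n x D) {i j : ℕ} (hij : i ≤ j) (hj : j ≤ n + 1) : x i ≤ x j := by
  induction j, hij using Nat.le_induction with
  | base => exact le_rfl
  | succ k _ ih => exact (ih (by omega)).trans (hx.2.2.1 k (by omega))

lemma sub_le (hx : IsGapDesign n x D) {i : ℕ} (m : ℕ) (hj : i + m ≤ n + 1) :
    x (i + m) - x i ≤ m * (D / n) := by
  induction m with
  | zero => simp
  | succ k ih =>
    have := ih (by omega)
    have h2 := hx.2.2.2 (i + k) (by omega)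
    push_cast
    rw [← add_assoc]
    linarith

lemma mem_Icc (hx : IsGapDesign n x D) {i : ℕ} (hi : i ≤ n + 1) : x i ∈ Icc (0 : ℝ) 1 := by
  refine ⟨?_, ?_⟩
  · rw [← hx.1]; exact hx.mono (Nat.zero_le _) hi
  · rw [← hx.2.1]; exact hx.mono hi le_rfl

lemma abs_sub_le (hx : IsGapDesign n x D) {i j r : ℕ} (hD : 0 ≤ D) (hi : i ≤ n + 1)
    (hj : j ≤ n + 1) (h1 : i ≤ j + r) (h2 : j ≤ i + r) : |x i - x j| ≤ r * (D / n) := by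
  have key : ∀ a b : ℕ, a ≤ b → b ≤ n + 1 → b ≤ a + r → |x a - x b| ≤ r * (D / n) := by
    intro a b hab hb hr
    obtain ⟨m, rfl⟩ := Nat.exists_eq_add_of_le hab
    rw [abs_sub_comm, abs_of_nonneg (by linarith [hx.mono hab hb])]
    refine (hx.sub_le m hb).trans ?_
    have : m ≤ r := by omega
    gcongr
  rcases le_total i j with h | h
  · exact key i j h hj h2
  · rw [abs_sub_comm]; exact key j i h hi h1

lemma exists_mem (hx : IsGapDesign n x D) {t : ℝ} (ht0 : 0 ≤ t) (ht1 : t ≤ 1) :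
    ∃ i ≤ n, x i ≤ t ∧ t - D / n ≤ x i := by
  classical
  have h0 : x 0 ≤ t := by rw [hx.1]; exact ht0
  have hle := Nat.findGreatest_le (P := fun i => x i ≤ t) n
  -- The last index at or before `t`: index 0 always qualifies, and after index `n` comes the
  -- endpoint 1.
  refine ⟨Nat.findGreatest (fun i => x i ≤ t) n, hle,
    Nat.findGreatest_spec (P := fun i => x i ≤ t) (Nat.zero_le n) h0, ?_⟩
  have hgap := hx.2.2.2 _ hle
  have : t ≤ x (Nat.findGreatest (fun i => x i ≤ t) n + 1) := by
    rcases hle.eq_or_lt with h | h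
    · rw [h, hx.2.1]; exact ht1
    · by_contra hlt
      exact Nat.findGreatest_is_greatest (P := fun i => x i ≤ t) (Nat.lt_succ_self _) h
        (not_le.mp hlt).le
  linarith

/-- A point of the design at distance at least `ℓ / 4` from both ends has an index that is used
by the estimator. -/
lemma mem_indices (hx : IsGapDesign n x D) (S : Spec) (hn : 1 ≤ n) (hD : 0 < D) {i : ℕ}
    (hi : i ≤ n) {ℓ : ℝ} (hℓ : 4 * D * (S.r + 1) ≤ n * ℓ) (h0 : ℓ / 4 ≤ x i)
    (h1 : x i ≤ 1 - ℓ / 4) : i ∈ indices S n := by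
  have hn' : (0 : ℝ) < n := by exact_mod_cast hn
  have a1 := hx.sub_le (i := 0) i (by omega)
  have a2 := hx.sub_le (i := i) (n + 1 - i) (by omega)
  rw [show i + (n + 1 - i) = n + 1 by omega, hx.2.1] at a2
  rw [Nat.zero_add, hx.1] at a1
  -- Gaps are at most `D / n`, so covering the length `ℓ / 4` takes at least `r + 1` of them. This
  -- is applied from both ends of the unit interval.
  have key : ∀ m : ℕ, ℓ / 4 ≤ m * (D / n) → S.r + 1 ≤ m := by
    intro m hm
    have : ((S.r + 1 : ℕ) : ℝ) ≤ m := by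
      have e : (m : ℝ) * (D / n) = m * D / n := by ring
      rw [e, le_div_iff₀ hn'] at hm
      push_cast
      have : D * (S.r + 1) ≤ D * m := by linarith
      exact le_of_mul_le_mul_left this hD
    exact_mod_cast this
  have b1 := key i (by linarith)
  have b2 := key (n + 1 - i) (by linarith)
  rw [indices, Finset.mem_Icc]
  omega

end IsGapDesign

/-- The weighted design controls polynomials on `[-H, H]` with constant `Λ`. -/
def Controls (S : Spec) (n : ℕ) (x : ℕ → ℝ) (t h H Λ : ℝ) : Prop :=
  ∀ (b : Fin (S.p + 1) → ℝ) (s : ℝ), |s| ≤ H → polyVal b s ^ 2 ≤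
    Λ * ∑ i ∈ indices S n, S.K ((t - x i) / h) * polyVal b (t - x i) ^ 2

/-- Many disjoint groups of `p + 1` design points, each group well separated, in an interval. -/
lemma IsGapDesign.exists_nodes {n : ℕ} {x : ℕ → ℝ} {D : ℝ} (hx : IsGapDesign n x D) (S : Spec)
    (hn : 1 ≤ n) (hD : 0 < D) {α ℓ δ : ℝ} {M : ℕ} (hℓ : 4 * D * (S.r + 1) ≤ n * ℓ) (hδ0 : 0 < δ)
    (hδ : (S.p + 1) * δ = ℓ / 4) (hM : 2 * M * (D / n) ≤ δ) (hα0 : 0 ≤ α) (hα1 : α + ℓ ≤ 1) :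
    ∃ f : ℕ → Fin (S.p + 1) → ℕ,
      (∀ m < M, ∀ k, f m k ∈ indices S n ∧ α ≤ x (f m k) ∧ x (f m k) ≤ α + ℓ) ∧
      (∀ m < M, ∀ m' < M, ∀ k l, k < l → δ ≤ x (f m' l) - x (f m k)) ∧
      (∀ m < M, ∀ m' < M, ∀ k, m < m' → x (f m k) < x (f m' k)) := by
  have hn' : (0 : ℝ) < n := by exact_mod_cast hn
  set g := D / n with hg
  have hg0 : 0 < g := by positivity
  set q : ℝ := (S.p : ℝ) + 1 with hq
  have hq0 : 0 < q := by positivity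
  have hℓ0 : 0 < ℓ := by nlinarith
  -- Node `k` of group `m` is sought within one gap `g` after `base m k`. For fixed `k` the nodes of
  -- all groups fit in a cell of length `δ`, cells are `δ` apart, and inside a cell the spacing `2 *
  -- g` keeps the groups disjoint. All cells lie in the middle half of the interval.
  obtain ⟨base, hb⟩ : ∃ base : ℕ → Fin (S.p + 1) → ℝ, ∀ m k,
    base m k = α + ℓ / 4 + k * (2 * δ) + 2 * m * g := ⟨_, fun _ _ => rfl⟩
  have hmg : ∀ m < M, 2 * m * g + g + g ≤ δ := by
    intro m hm
    have : (m : ℝ) + 1 ≤ M := by exact_mod_cast hm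
    have : ((m : ℝ) + 1) * g ≤ M * g := by gcongr
    linarith
  have hbase : ∀ m < M, ∀ k, α + ℓ / 4 ≤ base m k ∧ base m k + g ≤ α + ℓ / 4 + ℓ / 2 := by
    intro m hm k
    have h1 := hmg m hm
    have h2 : (k : ℝ) + 1 ≤ q := by
      have : (k : ℕ) + 1 ≤ S.p + 1 := k.2
      rw [hq]; exact_mod_cast this
    have h3 : ((k : ℝ) + 1) * δ ≤ q * δ := by gcongr
    have : 0 ≤ (k : ℝ) * (2 * δ) := by positivity
    have : 0 ≤ 2 * m * g := by positivity
    rw [hb]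
    exact ⟨by linarith, by linarith⟩
  have hex : ∀ m k, ∃ i, m < M → (i ≤ n ∧ base m k ≤ x i ∧ x i ≤ base m k + g) := by
    intro m k
    by_cases hm : m < M
    · have h1 := hbase m hm k
      obtain ⟨i, hi, h2, h3⟩ := hx.exists_mem (t := base m k + g)
        (by linarith [h1.1]) (by linarith [h1.2])
      exact ⟨i, fun _ => ⟨hi, by linarith, h2⟩⟩
    · exact ⟨0, fun h => absurd h hm⟩
  choose f hf using hex
  refine ⟨f, fun m hm k => ?_, fun m hm m' hm' k l hkl => ?_, fun m hm m' hm' k h => ?_⟩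
  · have h1 := hbase m hm k
    have h2 := hf m k hm
    exact ⟨hx.mem_indices S hn hD h2.1 hℓ (by linarith) (by linarith), by linarith, by linarith⟩
  · have h1 := (hf m k hm).2.2
    have h2 := (hf m' l hm').2.1
    have h3 := hmg m hm
    have h4 : (k : ℝ) + 1 ≤ l := by exact_mod_cast hkl
    have h5 : 0 ≤ 2 * (m' : ℝ) * g := by positivity
    have h6 : ((k : ℝ) + 1) * δ ≤ l * δ := by gcongr
    rw [hb] at h1 h2
    linarith
  · have a1 := (hf m k hm).2.2
    have a2 := (hf m' k hm').2.1
    have h4 : (m : ℝ) + 1 ≤ m' := by exact_mod_cast h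
    have h6 : ((m : ℝ) + 1) * g ≤ m' * g := by gcongr
    rw [hb] at a1 a2
    linarith

/-- The interval where `K` is at least `κ` has length `θ H` and contains of order `n H` disjoint
groups of `p + 1` nodes with separation proportional to `H`. Each group bounds the polynomial on
`[-H, H]` with a constant free of `n` and `H`; adding up the groups gains the factor `1/(n H)`. -/
lemma controls_of_interval (S : Spec) (hK : ∀ u, 0 ≤ S.K u) {D κ θ : ℝ} (hD : 0 < D) (hκ : 0 < κ)
    (hθ : 0 < θ) :
    ∃ Λ N : ℝ, 0 < Λ ∧ 0 < N ∧ ∀ (n : ℕ) (x : ℕ → ℝ) (t h H α : ℝ), 1 ≤ n → IsGapDesign n x D →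
      0 < H → N ≤ n * H → 0 ≤ α → α + θ * H ≤ 1 → t - H ≤ α → α + θ * H ≤ t + H →
      (∀ s ∈ Icc α (α + θ * H), κ ≤ S.K ((t - s) / h)) →
      Controls S n x t h H (Λ / (n * H)) := by
  set q : ℝ := (S.p : ℝ) + 1 with hq
  have hq0 : 0 < q := by positivity
  -- The Lagrange constant for `2 * H / δ = 8 * q / θ`, times `16 * q * D / θ` from counting the
  -- groups, divided by the lower bound `κ` for the weight function. The threshold makes room for
  -- one group and keeps the nodes among the usable indices.
  refine ⟨q * (8 * q / θ) ^ (2 * S.p) * (16 * q * D) / (κ * θ),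
    max (8 * q * D / θ) (4 * D * (S.r + 1) / θ), by positivity,
    lt_max_of_lt_left (by positivity), ?_⟩
  intro n x t h H α hn hx hH hN hα0 hα1 htα hαt hJ b s hs
  have hn' : (0 : ℝ) < n := by exact_mod_cast hn
  set ℓ := θ * H with hℓ
  have hℓ0 : 0 < ℓ := by positivity
  have hN1 : 8 * q * D ≤ n * ℓ := by
    have := (le_max_left _ _).trans hN
    rw [div_le_iff₀ hθ] at this
    calc _ ≤ _ := this
      _ = _ := by rw [hℓ]; ring
  have hN2 : 4 * D * (S.r + 1) ≤ n * ℓ := by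
    have := (le_max_right _ _).trans hN
    rw [div_le_iff₀ hθ] at this
    calc _ ≤ _ := this
      _ = _ := by rw [hℓ]; ring
  set g := D / n with hg
  have hg0 : 0 < g := by positivity
  set M := ⌊n * ℓ / (8 * q * D)⌋₊ with hM
  have hM1 : (M : ℝ) ≤ n * ℓ / (8 * q * D) := Nat.floor_le (by positivity)
  -- The argument of the floor is at least 1, so rounding down loses at most a factor of two.
  have hM2 : n * ℓ / (16 * q * D) ≤ M := by
    have h1 : 1 ≤ n * ℓ / (8 * q * D) := by rw [le_div_iff₀ (by positivity)]; linarith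
    have h2 := Nat.lt_floor_add_one (n * ℓ / (8 * q * D))
    have h3 : (1 : ℝ) ≤ M := by
      have : 1 ≤ M := Nat.le_floor (by simpa using h1)
      exact_mod_cast this
    have h4 : n * ℓ / (16 * q * D) = (n * ℓ / (8 * q * D)) / 2 := by
      field_simp; norm_num
    rw [h4]
    linarith
  have hMg : 2 * M * g ≤ ℓ / (4 * q) := by
    calc 2 * M * g ≤ 2 * (n * ℓ / (8 * q * D)) * g := by gcongr
      _ = ℓ / (4 * q) := by rw [hg]; field_simp; norm_num
  set δ := ℓ / (4 * q) with hδ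
  have hδ0 : 0 < δ := by positivity
  have hδq : (S.p + 1) * δ = ℓ / 4 := by rw [← hq, hδ]; field_simp
  obtain ⟨f, hfJ, hsep, hlt⟩ := hx.exists_nodes S hn hD hN2 hδ0 hδq hMg hα0 hα1
  have hinj : Set.InjOn (fun z : ℕ × Fin (S.p + 1) => f z.1 z.2)
      (Finset.range M ×ˢ Finset.univ : Finset (ℕ × Fin (S.p + 1))) := by
    rintro ⟨m, k⟩ hmk ⟨m', l⟩ hml hfe
    simp only [Finset.coe_product, Set.mem_prod, Finset.mem_coe, Finset.mem_range] at hmk hml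
    simp only at hfe
    have hm := hmk.1
    have hm' := hml.1
    rcases lt_trichotomy k l with h | h | h
    · have := hsep m hm m' hm' k l h
      rw [hfe] at this; linarith
    · subst h
      rcases lt_trichotomy m m' with h | h | h
      · have := hlt m hm m' hm' k h
        rw [hfe] at this; linarith
      · rw [h]
      · have := hlt m' hm' m hm k h
        rw [hfe] at this; linarith
    · have := hsep m' hm' m hm l k h
      rw [hfe] at this; linarith
  have hsub : (Finset.range M ×ˢ (Finset.univ : Finset (Fin (S.p + 1)))).image
      (fun z => f z.1 z.2) ⊆ indices S n := by
    intro i hi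
    simp only [Finset.mem_image, Finset.mem_product, Finset.mem_range, Finset.mem_univ, and_true,
      Prod.exists] at hi
    obtain ⟨m, k, hm, rfl⟩ := hi
    exact (hfJ m hm k).1
  -- All nodes of all groups are distinct, so each index of the full weighted sum is used at most
  -- once.
  have hmain : κ * ∑ m ∈ Finset.range M, ∑ k, polyVal b (t - x (f m k)) ^ 2 ≤
      ∑ i ∈ indices S n, S.K ((t - x i) / h) * polyVal b (t - x i) ^ 2 := by
    calc κ * ∑ m ∈ Finset.range M, ∑ k, polyVal b (t - x (f m k)) ^ 2
        = ∑ z ∈ Finset.range M ×ˢ (Finset.univ : Finset (Fin (S.p + 1))),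
          κ * polyVal b (t - x (f z.1 z.2)) ^ 2 := by
          rw [Finset.sum_product, Finset.mul_sum]
          exact Finset.sum_congr rfl fun _ _ => by rw [Finset.mul_sum]
      _ ≤ ∑ z ∈ Finset.range M ×ˢ (Finset.univ : Finset (Fin (S.p + 1))),
          S.K ((t - x (f z.1 z.2)) / h) * polyVal b (t - x (f z.1 z.2)) ^ 2 := by
          apply Finset.sum_le_sum
          rintro ⟨m, k⟩ hz
          simp only [Finset.mem_product, Finset.mem_range, Finset.mem_univ, and_true] at hz
          have h1 := hfJ m hz k
          have := hJ (x (f m k)) h1.2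
          gcongr
      _ = ∑ i ∈ (Finset.range M ×ˢ (Finset.univ : Finset (Fin (S.p + 1)))).image
          (fun z => f z.1 z.2), S.K ((t - x i) / h) * polyVal b (t - x i) ^ 2 := by
          rw [Finset.sum_image hinj]
      _ ≤ _ := Finset.sum_le_sum_of_subset_of_nonneg hsub
          fun i _ _ => mul_nonneg (hK _) (sq_nonneg _)
  have hlag : ∀ m ∈ Finset.range M, polyVal b s ^ 2 ≤
      q * (8 * q / θ) ^ (2 * S.p) * ∑ k, polyVal b (t - x (f m k)) ^ 2 := by
    intro m hm
    rw [Finset.mem_range] at hm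
    have := polyVal_sq_le_of_separated b (v := fun k => t - x (f m k)) (H := H) (δ := δ) (t := s)
      hδ0 ?_ ?_ hs
    · have e : 2 * H / δ = 8 * q / θ := by rw [hδ, hℓ]; field_simp; norm_num
      rwa [e] at this
    · intro k
      have h1 := (hfJ m hm k).2
      rw [abs_le]
      exact ⟨by linarith, by linarith⟩
    · intro k l hkl
      rcases lt_or_gt_of_ne hkl with h | h
      · have := hsep m hm m hm k l h
        exact le_trans (by linarith) (le_abs_self _)
      · have := hsep m hm m hm l k h
        exact le_trans (by linarith) (neg_le_abs _)
  have hsum := Finset.sum_le_sum hlag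
  rw [Finset.sum_const, Finset.card_range, nsmul_eq_mul, ← Finset.mul_sum] at hsum
  set A := q * (8 * q / θ) ^ (2 * S.p) with hA
  have hA0 : 0 < A := by positivity
  set T := ∑ i ∈ indices S n, S.K ((t - x i) / h) * polyVal b (t - x i) ^ 2
  set U := ∑ m ∈ Finset.range M, ∑ k, polyVal b (t - x (f m k)) ^ 2
  have h1 : n * ℓ / (16 * q * D) * polyVal b s ^ 2 ≤ A * (T / κ) := by
    calc _ ≤ M * polyVal b s ^ 2 := by gcongr
      _ ≤ A * U := hsum
      _ ≤ A * (T / κ) := by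
        gcongr
        rw [le_div_iff₀ hκ]; linarith
  calc polyVal b s ^ 2 = (16 * q * D) / (n * ℓ) * (n * ℓ / (16 * q * D) * polyVal b s ^ 2) := by
        field_simp
    _ ≤ (16 * q * D) / (n * ℓ) * (A * (T / κ)) := by gcongr
    _ = _ := by rw [hℓ]; field_simp

/-! ### Moments of products of independent errors. -/

section Moments

set_option linter.unusedSectionVars false

variable {Ω : Type*} [MeasurableSpace Ω] {P : Measure Ω} [IsProbabilityMeasure P] {ε : ℕ → Ω → ℝ}

lemma memLp_mul_of_memLp_four {f g : Ω → ℝ} (hf : MemLp f 4 P) (hg : MemLp g 4 P) :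
    MemLp (fun ω => f ω * g ω) 2 P := by
  have : ENNReal.HolderTriple 4 4 2 := ⟨by
    rw [← two_mul, show (4 : ℝ≥0∞) = 2 * 2 by norm_num,
      ENNReal.mul_inv (Or.inl (by norm_num)) (Or.inl (by norm_num)), ← mul_assoc,
      ENNReal.mul_inv_cancel (by norm_num) (by norm_num), one_mul]⟩
  exact hg.mul' hf

lemma integrable_mul_of_memLp_two {f g : Ω → ℝ} (hf : MemLp f 2 P) (hg : MemLp g 2 P) :
    Integrable (fun ω => f ω * g ω) P := hf.integrable_mul hg

namespace IsErrorSequence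

lemma aemeasurable (hε : IsErrorSequence P ε) (i : ℕ) : AEMeasurable (ε i) P :=
  (hε.2.1 i).aemeasurable_fst

lemma memLp (hε : IsErrorSequence P ε) (i : ℕ) : MemLp (ε i) 4 P :=
  (hε.2.1 i).memLp_iff.mpr hε.2.2.1

lemma memLp_one (hε : IsErrorSequence P ε) (i : ℕ) : Integrable (ε i) P :=
  memLp_one_iff_integrable.mp ((hε.memLp i).mono_exponent (by norm_num))

lemma integral_eq_zero (hε : IsErrorSequence P ε) (i : ℕ) : ∫ ω, ε i ω ∂P = 0 := by
  rw [(hε.2.1 i).integral_eq]; exact hε.2.2.2.1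

lemma integral_sq (hε : IsErrorSequence P ε) (i : ℕ) : ∫ ω, ε i ω ^ 2 ∂P = 1 := by
  rw [← hε.2.2.2.2]; exact (hε.2.1 i).sq.integral_eq

lemma integral_pow_four (hε : IsErrorSequence P ε) (i : ℕ) :
    ∫ ω, ε i ω ^ 4 ∂P = ∫ ω, ε 0 ω ^ 4 ∂P :=
  ((hε.2.1 i).pow (n := 4)).integral_eq

/-- Functions of disjoint groups of errors are independent. -/
lemma indepFun (hε : IsErrorSequence P ε) {φ ψ : (ℕ → ℝ) → ℝ} (hφ : Measurable φ)
    (hψ : Measurable ψ) (A B : Finset ℕ) (hAB : Disjoint A B)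
    (hA : ∀ y z : ℕ → ℝ, (∀ i ∈ A, y i = z i) → φ y = φ z)
    (hB : ∀ y z : ℕ → ℝ, (∀ i ∈ B, y i = z i) → ψ y = ψ z) :
    IndepFun (fun ω => φ (fun i => ε i ω)) (fun ω => ψ (fun i => ε i ω)) P := by
  classical
  -- Extension by zero turns `φ` and `ψ` into functions of finitely many coordinates, to which
  -- independence of disjoint finite families applies.
  let ext (C : Finset ℕ) (v : C → ℝ) (i : ℕ) : ℝ := if h : i ∈ C then v ⟨i, h⟩ else 0
  have hext : ∀ C, Measurable (ext C) := by
    intro C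
    refine measurable_pi_lambda _ fun i => ?_
    by_cases h : i ∈ C
    · simpa [ext, h] using measurable_pi_apply _
    · simp [ext, h]
  have h := (hε.1.indepFun_finset₀ A B hAB hε.aemeasurable).comp
    (hφ.comp (hext A)) (hψ.comp (hext B))
  convert h using 1
  · funext ω
    exact hA _ _ fun i hi => by simp [ext, hi]
  · funext ω
    exact hB _ _ fun i hi => by simp [ext, hi]

end IsErrorSequence

/-- Observations with mean `m i` and scale `τ i`. -/
def noisy (m τ : ℕ → ℝ) (e : ℕ → ℝ) (i : ℕ) : ℝ := m i + τ i * e i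

variable (m τ : ℕ → ℝ)

@[fun_prop]
lemma measurable_noisy (i : ℕ) : Measurable (fun e => noisy m τ e i) := by
  unfold noisy; fun_prop

lemma IsErrorSequence.memLp_noisy (hε : IsErrorSequence P ε) (i : ℕ) :
    MemLp (fun ω => noisy m τ (fun j => ε j ω) i) 4 P :=
  (memLp_const (m i)).add ((hε.memLp i).const_mul (τ i))

lemma IsErrorSequence.integrable_four (hε : IsErrorSequence P ε) (a b k l : ℕ) :
    Integrable (fun ω => (noisy m τ (fun j => ε j ω) a * noisy m τ (fun j => ε j ω) b) *
      (ε k ω * ε l ω)) P :=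
  integrable_mul_of_memLp_two
    (memLp_mul_of_memLp_four (hε.memLp_noisy m τ a) (hε.memLp_noisy m τ b))
    (memLp_mul_of_memLp_four (hε.memLp k) (hε.memLp l))

/-- The centred error `ε k` is independent of all the other factors. -/
lemma IsErrorSequence.integral_four_eq_zero (hε : IsErrorSequence P ε) {a b k l : ℕ}
    (hkl : k ≠ l) (hka : k ≠ a) (hkb : k ≠ b) :
    ∫ ω, (noisy m τ (fun j => ε j ω) a * noisy m τ (fun j => ε j ω) b) *
      (ε k ω * ε l ω) ∂P = 0 := by
  have hi := hε.indepFun (φ := fun e => e k)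
    (ψ := fun e => noisy m τ e a * noisy m τ e b * e l) (by fun_prop) (by fun_prop)
    {k} {a, b, l} (by simp [hkl, hka, hkb]) (fun y z h => h k (by simp))
    (fun y z h => by simp [noisy, h a, h b, h l])
  have h1 := hi.integral_fun_mul_eq_mul_integral
    (hε.memLp k).aestronglyMeasurable
    (((hε.memLp_noisy m τ a).aestronglyMeasurable.mul
      (hε.memLp_noisy m τ b).aestronglyMeasurable).mul (hε.memLp l).aestronglyMeasurable)
  rw [hε.integral_eq_zero, zero_mul] at h1
  rw [← h1]
  congr 1; funext ω; ring

lemma IsErrorSequence.integral_noisy_mul_self (hε : IsErrorSequence P ε) (a : ℕ) :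
    ∫ ω, noisy m τ (fun j => ε j ω) a * ε a ω ∂P = τ a := by
  have : ∀ ω, noisy m τ (fun j => ε j ω) a * ε a ω = m a * ε a ω + τ a * ε a ω ^ 2 := by
    intro ω; simp only [noisy]; ring
  simp only [this]
  have h2 : Integrable (fun ω => ε a ω ^ 2) P :=
    ((hε.memLp a).mono_exponent (by norm_num : (2 : ℝ≥0∞) ≤ 4)).integrable_sq
  rw [integral_add ((hε.memLp_one a).const_mul _) (h2.const_mul _), integral_const_mul,
    integral_const_mul, hε.integral_eq_zero, hε.integral_sq]
  ring

lemma IsErrorSequence.integral_four_eq (hε : IsErrorSequence P ε) {k l : ℕ} (hkl : k ≠ l) :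
    ∫ ω, (noisy m τ (fun j => ε j ω) k * noisy m τ (fun j => ε j ω) l) *
      (ε k ω * ε l ω) ∂P = τ k * τ l := by
  have hi := hε.indepFun (φ := fun e => noisy m τ e k * e k)
    (ψ := fun e => noisy m τ e l * e l) (by fun_prop) (by fun_prop)
    {k} {l} (by simp [hkl]) (fun y z h => by simp [noisy, h k])
    (fun y z h => by simp [noisy, h l])
  have h1 := hi.integral_fun_mul_eq_mul_integral
    ((hε.memLp_noisy m τ k).aestronglyMeasurable.mul (hε.memLp k).aestronglyMeasurable)
    ((hε.memLp_noisy m τ l).aestronglyMeasurable.mul (hε.memLp l).aestronglyMeasurable)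
  rw [hε.integral_noisy_mul_self, hε.integral_noisy_mul_self] at h1
  rw [← h1]
  congr 1; funext ω; ring

/-- Unless both `k` and `l` occur among `a` and `b`, one error factors out with mean zero. Thus
multiplying by `ε k * ε l` extracts exactly the interaction of the pair `{k, l}`, and since `k ≠ l`
no third or fourth moment enters. -/
lemma IsErrorSequence.integral_four (hε : IsErrorSequence P ε) (a b : ℕ) {k l : ℕ}
    (hkl : k ≠ l) :
    ∫ ω, (noisy m τ (fun j => ε j ω) a * noisy m τ (fun j => ε j ω) b) *
      (ε k ω * ε l ω) ∂P = if (a = k ∧ b = l) ∨ (a = l ∧ b = k) then τ k * τ l else 0 := by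
  by_cases hk : k ≠ a ∧ k ≠ b
  · rw [hε.integral_four_eq_zero m τ hkl hk.1 hk.2, if_neg]
    rintro (h | h)
    · exact hk.1 h.1.symm
    · exact hk.2 h.2.symm
  by_cases hl : l ≠ a ∧ l ≠ b
  · have := hε.integral_four_eq_zero m τ hkl.symm hl.1 hl.2
    simp only [mul_comm (ε l _)] at this
    rw [this, if_neg]
    rintro (h | h)
    · exact hl.2 h.2.symm
    · exact hl.1 h.1.symm
  by_cases h1 : k = a
  · have h2 : l = b := by
      by_contra h
      exact hl ⟨fun h' => hkl (h1.trans h'.symm), h⟩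
    subst h1 h2
    rw [if_pos (by simp), hε.integral_four_eq m τ hkl]
  · have h2 : k = b := by
      by_contra h
      exact hk ⟨h1, h⟩
    have h3 : l = a := by
      by_contra h
      exact hl ⟨h, fun h' => hkl (h2.trans h'.symm)⟩
    subst h2 h3
    rw [if_pos (by simp), ← hε.integral_four_eq m τ hkl]
    congr 1; funext ω; ring

lemma IsErrorSequence.integral_noisy (hε : IsErrorSequence P ε) (a : ℕ) :
    ∫ ω, noisy m τ (fun j => ε j ω) a ∂P = m a := by
  simp only [noisy]
  rw [integral_add (integrable_const _) ((hε.memLp_one a).const_mul _), integral_const_mul,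
    hε.integral_eq_zero]
  simp

lemma IsErrorSequence.integral_two (hε : IsErrorSequence P ε) (a b : ℕ) :
    ∫ ω, noisy m τ (fun j => ε j ω) a * noisy m τ (fun j => ε j ω) b ∂P =
      m a * m b + if a = b then τ a ^ 2 else 0 := by
  by_cases hab : a = b
  · subst hab
    have : ∀ ω, noisy m τ (fun j => ε j ω) a * noisy m τ (fun j => ε j ω) a =
        m a * noisy m τ (fun j => ε j ω) a + τ a * (noisy m τ (fun j => ε j ω) a * ε a ω) := by
      intro ω; simp only [noisy]; ring
    simp only [this]
    rw [integral_add, integral_const_mul, integral_const_mul, hε.integral_noisy,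
      hε.integral_noisy_mul_self]
    · simp only [if_true]; ring
    · exact (memLp_one_iff_integrable.mp
        ((hε.memLp_noisy m τ a).mono_exponent (by norm_num))).const_mul _
    · exact ((memLp_mul_of_memLp_four (hε.memLp_noisy m τ a) (hε.memLp a)).integrable
        (by norm_num)).const_mul _
  · have hi := hε.indepFun (φ := fun e => noisy m τ e a)
      (ψ := fun e => noisy m τ e b) (by fun_prop) (by fun_prop)
      {a} {b} (by simp [hab]) (fun y z h => by simp [noisy, h a])
      (fun y z h => by simp [noisy, h b])
    have h1 := hi.integral_fun_mul_eq_mul_integral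
      (hε.memLp_noisy m τ a).aestronglyMeasurable (hε.memLp_noisy m τ b).aestronglyMeasurable
    rw [h1, hε.integral_noisy, hε.integral_noisy, if_neg hab, add_zero]

lemma IsErrorSequence.integral_noisy_pow_four_le (hε : IsErrorSequence P ε) (a : ℕ) :
    Integrable (fun ω => noisy m τ (fun j => ε j ω) a ^ 4) P ∧
    ∫ ω, noisy m τ (fun j => ε j ω) a ^ 4 ∂P ≤ 8 * (m a ^ 4 + τ a ^ 4 * ∫ ω, ε 0 ω ^ 4 ∂P) := by
  have hint : ∀ {f : Ω → ℝ}, MemLp f 4 P → Integrable (fun ω => f ω ^ 4) P := by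
    intro f hf
    have := (memLp_mul_of_memLp_four hf hf).integrable_sq
    refine this.congr (ae_of_all _ fun ω => ?_)
    ring
  refine ⟨hint (hε.memLp_noisy m τ a), ?_⟩
  rw [← hε.integral_pow_four a]
  have h4 : Integrable (fun ω => τ a ^ 4 * ε a ω ^ 4) P := (hint (hε.memLp a)).const_mul _
  have e : 8 * (m a ^ 4 + τ a ^ 4 * ∫ ω, ε a ω ^ 4 ∂P)
      = ∫ ω, 8 * (m a ^ 4 + τ a ^ 4 * ε a ω ^ 4) ∂P := by
    rw [integral_const_mul, integral_add (integrable_const _) h4, integral_const_mul]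
    simp
  rw [e]
  refine integral_mono (hint (hε.memLp_noisy m τ a))
    (((integrable_const _).add h4).const_mul 8) fun ω => ?_
  simp only [noisy]
  rw [← mul_pow]
  generalize τ a * ε a ω = v
  generalize m a = u
  have h1 : (u + v) ^ 2 ≤ 2 * (u ^ 2 + v ^ 2) := by nlinarith [sq_nonneg (u - v)]
  have h2 : ((u + v) ^ 2) ^ 2 ≤ (2 * (u ^ 2 + v ^ 2)) ^ 2 := by gcongr
  nlinarith [sq_nonneg (u ^ 2 - v ^ 2)]

end Moments

/-! ### Quadratic forms in pseudoresiduals: mean, variance, lower bound from noise. -/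

section Quadratic

variable {Ω : Type*} [MeasurableSpace Ω] {P : Measure Ω} [IsProbabilityMeasure P] {ε : ℕ → Ω → ℝ}
variable (S : Spec) (m τ : ℕ → ℝ)

lemma le_of_mem_indices {S : Spec} {n i : ℕ} (hi : i ∈ indices S n) : S.r / 2 + 1 ≤ i :=
  (Finset.mem_Icc.mp hi).1

lemma add_sub_mem {S : Spec} {n i j : ℕ} (hi : i ∈ indices S n) (hj : j ∈ Finset.range (S.r + 1)) :
    1 ≤ j + i - S.r / 2 ∧ j + i - S.r / 2 ≤ n := by
  rw [indices, Finset.mem_Icc] at hi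
  rw [Finset.mem_range] at hj
  omega

lemma IsErrorSequence.memLp_pseudoresidual (hε : IsErrorSequence P ε) (i : ℕ) :
    MemLp (fun ω => pseudoresidual S (noisy m τ (fun j => ε j ω)) i) 4 P := by
  unfold pseudoresidual
  exact memLp_finsetSum _ fun j _ => (hε.memLp_noisy m τ _).const_mul _

lemma IsErrorSequence.memLp_pseudoresidual_sq (hε : IsErrorSequence P ε) (i : ℕ) :
    MemLp (fun ω => pseudoresidual S (noisy m τ (fun j => ε j ω)) i ^ 2) 2 P := by
  simp only [sq]
  exact memLp_mul_of_memLp_four (hε.memLp_pseudoresidual S m τ i)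
    (hε.memLp_pseudoresidual S m τ i)

lemma pseudoresidual_sq (y : ℕ → ℝ) (i : ℕ) :
    pseudoresidual S y i ^ 2 = ∑ j ∈ Finset.range (S.r + 1), ∑ k ∈ Finset.range (S.r + 1),
      S.d j * S.d k * (y (j + i - S.r / 2) * y (k + i - S.r / 2)) := by
  rw [sq, pseudoresidual, Finset.sum_mul_sum]
  exact Finset.sum_congr rfl fun _ _ => Finset.sum_congr rfl fun _ _ => by ring

/-- Only diagonal noise terms survive. The bound on `i` prevents truncation, so distinct `j` and `k`
stay distinct after the shift. -/
lemma IsErrorSequence.integral_pseudoresidual_sq (hε : IsErrorSequence P ε) {i : ℕ}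
    (hi : S.r / 2 + 1 ≤ i) :
    ∫ ω, pseudoresidual S (noisy m τ (fun j => ε j ω)) i ^ 2 ∂P =
      pseudoresidual S m i ^ 2 +
        ∑ j ∈ Finset.range (S.r + 1), S.d j ^ 2 * τ (j + i - S.r / 2) ^ 2 := by
  simp only [pseudoresidual_sq]
  have hint : ∀ a b, Integrable (fun ω => noisy m τ (fun j => ε j ω) a *
      noisy m τ (fun j => ε j ω) b) P := fun a b =>
    (memLp_mul_of_memLp_four (hε.memLp_noisy m τ a) (hε.memLp_noisy m τ b)).integrable
      (by norm_num)
  rw [integral_finsetSum _ fun j _ => integrable_finsetSum _ fun k _ => (hint _ _).const_mul _,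
    ← Finset.sum_add_distrib]
  refine Finset.sum_congr rfl fun j hj => ?_
  rw [integral_finsetSum _ fun k _ => (hint _ _).const_mul _]
  have : ∀ k ∈ Finset.range (S.r + 1), ∫ ω, S.d j * S.d k *
      (noisy m τ (fun j => ε j ω) (j + i - S.r / 2) *
        noisy m τ (fun j => ε j ω) (k + i - S.r / 2)) ∂P =
      S.d j * S.d k * (m (j + i - S.r / 2) * m (k + i - S.r / 2)) +
        if j = k then S.d j ^ 2 * τ (j + i - S.r / 2) ^ 2 else 0 := by
    intro k _
    rw [integral_const_mul, hε.integral_two]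
    by_cases h : j = k
    · subst h; simp; ring
    · rw [if_neg h, if_neg (by omega)]; ring
  rw [Finset.sum_congr rfl this, Finset.sum_add_distrib, Finset.sum_ite_eq, if_pos hj]

/-- Cauchy–Schwarz with `∑ d j ^ 2 = 1` bounds the squared pseudoresidual by a sum of squared
observations. Squaring that sum costs a factor `r + 1`, and its `r + 1` terms give the other. -/
lemma IsErrorSequence.integral_pseudoresidual_pow_four_le (hε : IsErrorSequence P ε)
    (hd : IsDifferenceSequence S.r S.d) {B : ℝ} {i : ℕ}
    (hB : ∀ j ∈ Finset.range (S.r + 1), 8 * (m (j + i - S.r / 2) ^ 4 +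
      τ (j + i - S.r / 2) ^ 4 * ∫ ω, ε 0 ω ^ 4 ∂P) ≤ B) :
    ∫ ω, (pseudoresidual S (noisy m τ (fun j => ε j ω)) i ^ 2) ^ 2 ∂P ≤ (S.r + 1) ^ 2 * B := by
  have hpt : ∀ y : ℕ → ℝ, (pseudoresidual S y i ^ 2) ^ 2 ≤
      (S.r + 1) * ∑ j ∈ Finset.range (S.r + 1), y (j + i - S.r / 2) ^ 4 := by
    intro y
    have h1 : pseudoresidual S y i ^ 2 ≤ ∑ j ∈ Finset.range (S.r + 1), y (j + i - S.r / 2) ^ 2 := by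
      have := Finset.sum_mul_sq_le_sq_mul_sq (Finset.range (S.r + 1)) S.d
        (fun j => y (j + i - S.r / 2))
      rwa [hd.2, one_mul] at this
    calc (pseudoresidual S y i ^ 2) ^ 2
        ≤ (∑ j ∈ Finset.range (S.r + 1), y (j + i - S.r / 2) ^ 2) ^ 2 := by gcongr
      _ ≤ _ := sq_sum_le_card_mul_sum_sq
      _ = _ := by
        rw [Finset.card_range]; push_cast
        congr 1
        exact Finset.sum_congr rfl fun _ _ => by ring
  have hint : ∀ j ∈ Finset.range (S.r + 1), Integrable
      (fun ω => noisy m τ (fun j => ε j ω) (j + i - S.r / 2) ^ 4) P :=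
    fun j _ => (hε.integral_noisy_pow_four_le m τ _).1
  calc _ ≤ ∫ ω, (S.r + 1) * ∑ j ∈ Finset.range (S.r + 1),
        noisy m τ (fun j => ε j ω) (j + i - S.r / 2) ^ 4 ∂P :=
        integral_mono (hε.memLp_pseudoresidual_sq S m τ i).integrable_sq
          ((integrable_finsetSum _ hint).const_mul _) fun ω => hpt _
    _ = (S.r + 1) * ∑ j ∈ Finset.range (S.r + 1),
        ∫ ω, noisy m τ (fun j => ε j ω) (j + i - S.r / 2) ^ 4 ∂P := by
        rw [integral_const_mul, integral_finsetSum _ hint]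
    _ ≤ (S.r + 1) * ∑ j ∈ Finset.range (S.r + 1), B := by
        gcongr with j hj
        exact (hε.integral_noisy_pow_four_le m τ _).2.trans (hB j hj)
    _ = _ := by simp; ring

/-- A linear combination of squared pseudoresiduals. -/
def quadEstimate (I : Finset ℕ) (w y : ℕ → ℝ) : ℝ := ∑ i ∈ I, w i * pseudoresidual S y i ^ 2

lemma IsErrorSequence.memLp_quadEstimate (hε : IsErrorSequence P ε) (I : Finset ℕ) (w : ℕ → ℝ) :
    MemLp (fun ω => quadEstimate S I w (noisy m τ (fun j => ε j ω))) 2 P := by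
  unfold quadEstimate
  exact memLp_finsetSum _ fun i _ => (hε.memLp_pseudoresidual_sq S m τ i).const_mul _

/-- The expectation of a linear combination of squared pseudoresiduals. -/
def quadMean (I : Finset ℕ) (w : ℕ → ℝ) : ℝ :=
  ∑ i ∈ I, w i * (pseudoresidual S m i ^ 2 +
        ∑ j ∈ Finset.range (S.r + 1), S.d j ^ 2 * τ (j + i - S.r / 2) ^ 2)

lemma IsErrorSequence.integral_quadEstimate (hε : IsErrorSequence P ε) {I : Finset ℕ}
    (hI : ∀ i ∈ I, S.r / 2 + 1 ≤ i) (w : ℕ → ℝ) :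
    ∫ ω, quadEstimate S I w (noisy m τ (fun j => ε j ω)) ∂P = quadMean S m τ I w := by
  unfold quadEstimate quadMean
  rw [integral_finsetSum _ fun i _ =>
    ((hε.memLp_pseudoresidual_sq S m τ i).integrable (by norm_num)).const_mul _]
  refine Finset.sum_congr rfl fun i hi => ?_
  rw [integral_const_mul, hε.integral_pseudoresidual_sq S m τ (hI i hi)]

lemma integral_sub_const_sq {X : Ω → ℝ} (hX : MemLp X 2 P) (v : ℝ) :
    ∫ ω, (X ω - v) ^ 2 ∂P = Var[X; P] + (∫ ω, X ω ∂P - v) ^ 2 := by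
  have h1 : ∀ ω, (X ω - v) ^ 2 = X ω ^ 2 - (2 * v * X ω - v ^ 2) := fun ω => by ring
  have hi : Integrable X P := hX.integrable (by norm_num)
  have hi2 : Integrable (fun ω => 2 * v * X ω - v ^ 2) P :=
    (hi.const_mul _).sub (integrable_const _)
  simp only [h1]
  rw [variance_eq_sub hX, integral_sub hX.integrable_sq hi2,
    integral_sub (hi.const_mul _) (integrable_const _), integral_const_mul]
  simp
  ring

/-- Pseudoresiduals more than `r` indices apart use disjoint errors and are uncorrelated. Each of
the at most `2 * r + 1` remaining covariances is bounded by the average of the two variances. -/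
lemma IsErrorSequence.variance_quadEstimate_le (hε : IsErrorSequence P ε)
    {I : Finset ℕ} (hI : ∀ i ∈ I, S.r / 2 + 1 ≤ i) (w : ℕ → ℝ) {B : ℝ}
    (hB : ∀ i ∈ I, ∫ ω, (pseudoresidual S (noisy m τ (fun j => ε j ω)) i ^ 2) ^ 2 ∂P ≤ B) :
    Var[fun ω => quadEstimate S I w (noisy m τ (fun j => ε j ω)); P] ≤
      (2 * S.r + 1) * (B * ∑ i ∈ I, w i ^ 2) := by
  set Z : ℕ → Ω → ℝ := fun i ω => w i * pseudoresidual S (noisy m τ (fun j => ε j ω)) i ^ 2 with hZ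
  have hZm : ∀ i, MemLp (Z i) 2 P := fun i =>
    (hε.memLp_pseudoresidual_sq S m τ i).const_mul _
  have hvar : ∀ i ∈ I, Var[Z i; P] ≤ w i ^ 2 * B := by
    intro i hi
    rw [hZ, variance_const_mul]
    refine mul_le_mul_of_nonneg_left ?_ (sq_nonneg _)
    exact (variance_le_expectation_sq
      (hε.memLp_pseudoresidual_sq S m τ i).aestronglyMeasurable).trans (hB i hi)
  have hcov : ∀ i ∈ I, ∀ k ∈ I, cov[Z i, Z k; P] ≤
      if k ∈ Finset.Icc (i - S.r) (i + S.r) then (Var[Z i; P] + Var[Z k; P]) / 2 else 0 := by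
    intro i hi k hk
    split_ifs with h
    · have h1 := variance_nonneg (Z i - Z k) P
      rw [variance_sub (hZm i) (hZm k)] at h1
      linarith
    · have hi' := hI i hi
      have hk' := hI k hk
      rw [Finset.mem_Icc] at h
      have hp : ∀ l, Measurable (fun e : ℕ → ℝ => w l * pseudoresidual S (noisy m τ e) l ^ 2) := by
        intro l; unfold pseudoresidual; fun_prop
      have hdep : ∀ l, ∀ y z : ℕ → ℝ, (∀ j ∈ (Finset.range (S.r + 1)).image
          (fun j => j + l - S.r / 2), y j = z j) →
          w l * pseudoresidual S (noisy m τ y) l ^ 2 =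
            w l * pseudoresidual S (noisy m τ z) l ^ 2 := by
        intro l y z hyz
        congr 2
        unfold pseudoresidual noisy
        refine Finset.sum_congr rfl fun j hj => ?_
        rw [hyz _ (Finset.mem_image_of_mem _ hj)]
      have hind : IndepFun (Z i) (Z k) P := hε.indepFun (hp i) (hp k)
        ((Finset.range (S.r + 1)).image (fun j => j + i - S.r / 2))
        ((Finset.range (S.r + 1)).image (fun j => j + k - S.r / 2))
        (by
          rw [Finset.disjoint_left]
          intro a ha hb
          simp only [Finset.mem_image, Finset.mem_range] at ha hb
          obtain ⟨j, hj, rfl⟩ := ha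
          obtain ⟨j', hj', hjj⟩ := hb
          omega) (hdep i) (hdep k)
      exact (hind.covariance_eq_zero (hZm i) (hZm k)).le
  have hcard : ∀ i, (((Finset.Icc (i - S.r) (i + S.r)).card : ℕ) : ℝ) ≤ 2 * S.r + 1 := by
    intro i
    rw [Nat.card_Icc]
    have : i + S.r + 1 - (i - S.r) ≤ 2 * S.r + 1 := by omega
    exact_mod_cast this
  have hhalf : ∀ i ∈ I, ∑ k ∈ I, (if k ∈ Finset.Icc (i - S.r) (i + S.r) then
      Var[Z i; P] / 2 else 0) ≤ (2 * S.r + 1) * (Var[Z i; P] / 2) := by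
    intro i _
    rw [← Finset.sum_filter, Finset.sum_const, nsmul_eq_mul]
    refine mul_le_mul_of_nonneg_right ?_ (by have := variance_nonneg (Z i) P; positivity)
    refine le_trans ?_ (hcard i)
    exact_mod_cast Finset.card_le_card fun k hk => (Finset.mem_filter.mp hk).2
  have hsymm : ∀ i k : ℕ, k ∈ Finset.Icc (i - S.r) (i + S.r) ↔
      i ∈ Finset.Icc (k - S.r) (k + S.r) := by
    intro i k; simp only [Finset.mem_Icc]; omega
  have hsum : Var[fun ω => quadEstimate S I w (noisy m τ (fun j => ε j ω)); P] =
      ∑ i ∈ I, ∑ k ∈ I, cov[Z i, Z k; P] := by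
    rw [← variance_fun_sum' fun i _ => hZm i]
    rfl
  rw [hsum]
  calc ∑ i ∈ I, ∑ k ∈ I, cov[Z i, Z k; P]
      ≤ ∑ i ∈ I, ∑ k ∈ I, ((if k ∈ Finset.Icc (i - S.r) (i + S.r) then Var[Z i; P] / 2 else 0) +
        (if i ∈ Finset.Icc (k - S.r) (k + S.r) then Var[Z k; P] / 2 else 0)) := by
        refine Finset.sum_le_sum fun i hi => Finset.sum_le_sum fun k hk => ?_
        refine (hcov i hi k hk).trans (le_of_eq ?_)
        simp only [← hsymm i k]
        split_ifs <;> ring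
    _ = 2 * ∑ i ∈ I, ∑ k ∈ I,
        (if k ∈ Finset.Icc (i - S.r) (i + S.r) then Var[Z i; P] / 2 else 0) := by
        simp only [Finset.sum_add_distrib]
        rw [two_mul]
        congr 1
        exact Finset.sum_comm
    _ ≤ 2 * ∑ i ∈ I, (2 * S.r + 1) * (Var[Z i; P] / 2) := by
        gcongr with i hi
        exact hhalf i hi
    _ ≤ 2 * ∑ i ∈ I, (2 * S.r + 1) * (w i ^ 2 * B / 2) := by
        gcongr with i hi
        exact hvar i hi
    _ = _ := by
        rw [← Finset.mul_sum, ← Finset.sum_div, ← Finset.sum_mul]; ring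

/-- The first and last nonzero entries of a difference sequence. -/
lemma IsDifferenceSequence.exists_extreme {r : ℕ} {d : ℕ → ℝ} (hd : IsDifferenceSequence r d) :
    ∃ a b, a < b ∧ b ≤ r ∧ d a ≠ 0 ∧ d b ≠ 0 ∧ ∀ j ≤ r, d j ≠ 0 → a ≤ j ∧ j ≤ b := by
  classical
  set F := (Finset.range (r + 1)).filter (fun j => d j ≠ 0) with hF
  have hne : F.Nonempty := by
    rw [Finset.nonempty_iff_ne_empty]
    intro h
    have h0 : ∀ j ∈ Finset.range (r + 1), d j ^ 2 = 0 := by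
      intro j hj
      by_contra hj2
      have : j ∈ F := Finset.mem_filter.mpr ⟨hj, fun h => hj2 (by rw [h]; ring)⟩
      rw [h] at this
      simp at this
    have := hd.2
    rw [Finset.sum_eq_zero h0] at this
    norm_num at this
  have ha := Finset.mem_filter.mp (F.min'_mem hne)
  have hb := Finset.mem_filter.mp (F.max'_mem hne)
  have hrange : ∀ j ≤ r, d j ≠ 0 → F.min' hne ≤ j ∧ j ≤ F.max' hne := by
    intro j hj hdj
    have : j ∈ F := Finset.mem_filter.mpr ⟨Finset.mem_range.mpr (by omega), hdj⟩
    exact ⟨F.min'_le j this, F.le_max' j this⟩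
  have hbr := Finset.mem_range.mp hb.1
  refine ⟨F.min' hne, F.max' hne, ?_, by omega, ha.2, hb.2, hrange⟩
  by_contra hlt
  push Not at hlt
  -- A single nonzero entry would equal the sum of the sequence, which is zero.
  have : ∑ j ∈ Finset.range (r + 1), d j = d (F.min' hne) := by
    refine Finset.sum_eq_single_of_mem _ ha.1 fun j hj hjne => ?_
    by_contra hdj
    have h1 := Finset.mem_range.mp hj
    have := hrange j (by omega) hdj
    omega
  exact ha.2 (this.symm.trans hd.1)

/-- The mixed moments of squared pseudoresiduals with products of two errors at the maximal
lag. -/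
lemma IsErrorSequence.integral_pseudoresidual_sq_mul (hε : IsErrorSequence P ε) {a b : ℕ}
    (hab : a < b) (hb : b ≤ S.r) (hext : ∀ j ≤ S.r, S.d j ≠ 0 → a ≤ j ∧ j ≤ b) {i l : ℕ}
    (hi : S.r / 2 + 1 ≤ i) (hl : S.r / 2 + 1 ≤ l) :
    ∫ ω, pseudoresidual S (noisy m τ (fun j => ε j ω)) l ^ 2 *
        (ε (a + i - S.r / 2) ω * ε (b + i - S.r / 2) ω) ∂P =
      if l = i then 2 * (S.d a * S.d b) * (τ (a + i - S.r / 2) * τ (b + i - S.r / 2)) else 0 := by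
  simp only [pseudoresidual_sq, Finset.sum_mul]
  simp only [mul_assoc (S.d _ * S.d _)]
  have hne : a + i - S.r / 2 ≠ b + i - S.r / 2 := by omega
  rw [integral_finsetSum _ fun j _ => integrable_finsetSum _ fun k _ =>
    (hε.integrable_four m τ _ _ _ _).const_mul _]
  have h1 : ∀ j ∈ Finset.range (S.r + 1), ∫ ω, ∑ k ∈ Finset.range (S.r + 1),
      S.d j * S.d k * (noisy m τ (fun j => ε j ω) (j + l - S.r / 2) *
        noisy m τ (fun j => ε j ω) (k + l - S.r / 2) *
        (ε (a + i - S.r / 2) ω * ε (b + i - S.r / 2) ω)) ∂P =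
      ∑ k ∈ Finset.range (S.r + 1), if l = i ∧ ((j = a ∧ k = b) ∨ (j = b ∧ k = a)) then
        S.d a * S.d b * (τ (a + i - S.r / 2) * τ (b + i - S.r / 2)) else 0 := by
    intro j hj
    rw [integral_finsetSum _ fun k _ => (hε.integrable_four m τ _ _ _ _).const_mul _]
    refine Finset.sum_congr rfl fun k hk => ?_
    rw [integral_const_mul, hε.integral_four m τ _ _ hne]
    rw [Finset.mem_range] at hj hk
    by_cases hdj : S.d j = 0
    · rw [hdj]
      split_ifs with h1 h2
      · obtain ⟨-, ⟨rfl, rfl⟩ | ⟨rfl, rfl⟩⟩ := h2 <;> simp [hdj]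
      · ring
      · obtain ⟨-, ⟨rfl, rfl⟩ | ⟨rfl, rfl⟩⟩ := ‹l = i ∧ _› <;> (rw [hdj]; ring)
      · ring
    by_cases hdk : S.d k = 0
    · rw [hdk]
      split_ifs with h1 h2
      · obtain ⟨-, ⟨rfl, rfl⟩ | ⟨rfl, rfl⟩⟩ := h2 <;> simp [hdk]
      · ring
      · obtain ⟨-, ⟨rfl, rfl⟩ | ⟨rfl, rfl⟩⟩ := ‹l = i ∧ _› <;> (rw [hdk]; ring)
      · ring
    -- Between nonzero coefficients the lag `b - a` is attained only by the extreme pair. Hence the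
    -- pair of errors at `a + i` and `b + i` occurs in no pseudoresidual but the `i`-th, in two
    -- orders.
    have hj' := hext j (by omega) hdj
    have hk' := hext k (by omega) hdk
    by_cases hc : l = i ∧ ((j = a ∧ k = b) ∨ (j = b ∧ k = a))
    · rw [if_pos hc, if_pos (by omega)]
      obtain ⟨-, ⟨rfl, rfl⟩ | ⟨rfl, rfl⟩⟩ := hc
      · rfl
      · ring
    · rw [if_neg hc, if_neg (by omega), mul_zero]
  rw [Finset.sum_congr rfl h1]
  by_cases hli : l = i
  · simp only [hli, true_and, if_true]
    have h2 : ∀ j k : ℕ, (if (j = a ∧ k = b) ∨ (j = b ∧ k = a) then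
        S.d a * S.d b * (τ (a + i - S.r / 2) * τ (b + i - S.r / 2)) else 0) =
        (if j = a then (if k = b then
          S.d a * S.d b * (τ (a + i - S.r / 2) * τ (b + i - S.r / 2)) else 0) else 0) +
        (if j = b then (if k = a then
          S.d a * S.d b * (τ (a + i - S.r / 2) * τ (b + i - S.r / 2)) else 0) else 0) := by
      intro j k
      by_cases h1 : j = a
      · have : j ≠ b := by omega
        simp [h1, hab.ne]
      · simp [h1, ← ite_and]
    have ha' : a ∈ Finset.range (S.r + 1) := Finset.mem_range.mpr (by omega)
    have hb' : b ∈ Finset.range (S.r + 1) := Finset.mem_range.mpr (by omega)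
    simp only [h2, Finset.sum_add_distrib, Finset.sum_ite_irrel, Finset.sum_const_zero,
      Finset.sum_ite_eq', ha', hb', if_true]
    ring
  · simp [hli]

/-- The fourth-moment formula for mean zero and unit scale makes the products at a fixed positive
lag an orthonormal family. -/
lemma IsErrorSequence.integral_error_products (hε : IsErrorSequence P ε) {a b s : ℕ}
    (hab : a < b) {i l : ℕ} (hi : s + 1 ≤ i) (hl : s + 1 ≤ l) :
    ∫ ω, (ε (a + l - s) ω * ε (b + l - s) ω) * (ε (a + i - s) ω * ε (b + i - s) ω) ∂P =
      if l = i then 1 else 0 := by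
  have h := hε.integral_four (fun _ => 0) (fun _ => 1) (a + l - s) (b + l - s)
    (k := a + i - s) (l := b + i - s) (by omega)
  simp only [noisy, zero_add, one_mul] at h
  rw [h]
  by_cases hli : l = i
  · subst hli; simp
  · rw [if_neg hli, if_neg (by omega)]

/-- Lower bound on the mean squared error of a linear combination of squared pseudoresiduals that
comes from the errors alone. -/
lemma IsErrorSequence.le_integral_quadEstimate (hε : IsErrorSequence P ε) {a b : ℕ}
    (hab : a < b) (hb : b ≤ S.r) (hext : ∀ j ≤ S.r, S.d j ≠ 0 → a ≤ j ∧ j ≤ b)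
    {I : Finset ℕ} (hI : ∀ i ∈ I, S.r / 2 + 1 ≤ i) (w : ℕ → ℝ) (v : ℝ) :
    (2 * (S.d a * S.d b)) ^ 2 *
        ∑ i ∈ I, w i ^ 2 * (τ (a + i - S.r / 2) * τ (b + i - S.r / 2)) ^ 2 ≤
      ∫ ω, (quadEstimate S I w (noisy m τ (fun j => ε j ω)) - v) ^ 2 ∂P := by
  set c := 2 * (S.d a * S.d b) with hc
  set φ : ℕ → Ω → ℝ := fun i ω => ε (a + i - S.r / 2) ω * ε (b + i - S.r / 2) ω with hφ
  set T : ℕ → ℝ := fun i => τ (a + i - S.r / 2) * τ (b + i - S.r / 2) with hT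
  have hφm : ∀ i, MemLp (φ i) 2 P := fun i => memLp_mul_of_memLp_four (hε.memLp _) (hε.memLp _)
  have hφ0 : ∀ i ∈ I, ∫ ω, φ i ω ∂P = 0 := by
    intro i hi
    have h1 := hε.integral_two (fun _ => 0) (fun _ => 1) (a + i - S.r / 2) (b + i - S.r / 2)
    have := hI i hi
    rw [if_neg (by omega)] at h1
    simpa [noisy] using h1
  set X : Ω → ℝ := fun ω => quadEstimate S I w (noisy m τ (fun j => ε j ω)) with hX
  have hXm : MemLp X 2 P := hε.memLp_quadEstimate S m τ I w
  have hXφ : ∀ i ∈ I, ∫ ω, X ω * φ i ω ∂P = c * (w i * T i) := by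
    intro i hi
    simp only [hX, quadEstimate, Finset.sum_mul, mul_assoc]
    rw [integral_finsetSum _ fun l _ => (integrable_mul_of_memLp_two
      (hε.memLp_pseudoresidual_sq S m τ l) (hφm i)).const_mul _]
    have : ∀ l ∈ I, ∫ ω, w l * (pseudoresidual S (noisy m τ (fun j => ε j ω)) l ^ 2 * φ i ω) ∂P =
        if l = i then w i * (c * T i) else 0 := by
      intro l hl
      rw [integral_const_mul,
        hε.integral_pseudoresidual_sq_mul S m τ hab hb hext (hI i hi) (hI l hl)]
      split_ifs with h
      · rw [h]
      · ring
    rw [Finset.sum_congr rfl this, Finset.sum_ite_eq', if_pos hi]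
    ring
  set U : Ω → ℝ := fun ω => ∑ i ∈ I, w i * T i * φ i ω with hU
  have hUm : MemLp U 2 P := memLp_finsetSum _ fun i _ => (hφm i).const_mul _
  have hXvm : MemLp (fun ω => X ω - v) 2 P := hXm.sub (memLp_const v)
  set Q := ∑ i ∈ I, w i ^ 2 * T i ^ 2 with hQ
  have hXU : ∫ ω, (X ω - v) * U ω ∂P = c * Q := by
    have e : ∀ ω, (X ω - v) * U ω = ∑ i ∈ I, w i * T i * (X ω * φ i ω - v * φ i ω) := by
      intro ω
      rw [hU, Finset.mul_sum]
      exact Finset.sum_congr rfl fun _ _ => by ring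
    have hi1 : ∀ i, Integrable (fun ω => X ω * φ i ω) P :=
      fun i => integrable_mul_of_memLp_two hXm (hφm i)
    have hi2 : ∀ i, Integrable (fun ω => v * φ i ω) P :=
      fun i => ((hφm i).integrable (by norm_num)).const_mul v
    have hi3 : ∀ i, Integrable (fun ω => X ω * φ i ω - v * φ i ω) P :=
      fun i => (hi1 i).sub (hi2 i)
    simp only [e]
    rw [integral_finsetSum _ fun i _ => (hi3 i).const_mul _, hQ, Finset.mul_sum]
    refine Finset.sum_congr rfl fun i hi => ?_
    rw [integral_const_mul, integral_sub (hi1 i) (hi2 i), integral_const_mul, hφ0 i hi,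
      hXφ i hi]
    ring
  have hUU : ∫ ω, U ω ^ 2 ∂P = Q := by
    have e : ∀ ω, U ω ^ 2 = ∑ l ∈ I, ∑ i ∈ I, w l * T l * (w i * T i) * (φ l ω * φ i ω) := by
      intro ω
      rw [hU, sq, Finset.sum_mul_sum]
      exact Finset.sum_congr rfl fun _ _ => Finset.sum_congr rfl fun _ _ => by ring
    simp only [e]
    have hi1 : ∀ l i, Integrable (fun ω => φ l ω * φ i ω) P :=
      fun l i => integrable_mul_of_memLp_two (hφm l) (hφm i)
    rw [integral_finsetSum _ fun l _ => integrable_finsetSum _ fun i _ =>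
      (hi1 l i).const_mul _, hQ]
    refine Finset.sum_congr rfl fun l hl => ?_
    rw [integral_finsetSum _ fun i _ => (hi1 l i).const_mul _]
    have : ∀ i ∈ I, ∫ ω, w l * T l * (w i * T i) * (φ l ω * φ i ω) ∂P =
        if l = i then w l ^ 2 * T l ^ 2 else 0 := by
      intro i hi
      rw [integral_const_mul, hε.integral_error_products hab (hI i hi) (hI l hl)]
      split_ifs with h
      · rw [h]; ring
      · ring
    rw [Finset.sum_congr rfl this, Finset.sum_ite_eq, if_pos hl]
  -- Bessel's inequality: `c * U` is the projection of `X` onto the orthonormal `φ i`. The constant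
  -- `v` drops out because every `φ i` has mean zero.
  have hnn : 0 ≤ ∫ ω, ((X ω - v) - c * U ω) ^ 2 ∂P := integral_nonneg fun ω => sq_nonneg _
  have hexp : ∫ ω, ((X ω - v) - c * U ω) ^ 2 ∂P =
      ∫ ω, (X ω - v) ^ 2 ∂P - (2 * c * (c * Q) - c ^ 2 * Q) := by
    have e : ∀ ω, ((X ω - v) - c * U ω) ^ 2 =
        (X ω - v) ^ 2 - (2 * c * ((X ω - v) * U ω) - c ^ 2 * U ω ^ 2) := fun ω => by ring
    have hi1 := integrable_mul_of_memLp_two hXvm hUm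
    have hi2 : Integrable (fun ω => 2 * c * ((X ω - v) * U ω) - c ^ 2 * U ω ^ 2) P :=
      (hi1.const_mul _).sub (hUm.integrable_sq.const_mul _)
    simp only [e]
    rw [integral_sub hXvm.integrable_sq hi2,
      integral_sub (hi1.const_mul _) (hUm.integrable_sq.const_mul _), integral_const_mul,
      integral_const_mul, hXU, hUU]
  rw [hexp] at hnn
  linarith

end Quadratic

/-! ### Hölder classes: modulus of continuity, Taylor expansion, test functions. -/

lemma strictFloor_lt {γ : ℝ} (hγ : 0 < γ) : (strictFloor γ : ℝ) < γ := by
  have h1 : 0 < ⌈γ⌉₊ := Nat.ceil_pos.mpr hγ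
  have h2 := Nat.ceil_lt_add_one hγ.le
  have : (strictFloor γ : ℝ) + 1 = ⌈γ⌉₊ := by
    unfold strictFloor; exact_mod_cast (by omega : ⌈γ⌉₊ - 1 + 1 = ⌈γ⌉₊)
  linarith

lemma le_strictFloor_add_one (γ : ℝ) : γ ≤ strictFloor γ + 1 := by
  have h2 := Nat.le_ceil γ
  have : (⌈γ⌉₊ : ℝ) ≤ (strictFloor γ : ℝ) + 1 := by
    unfold strictFloor; exact_mod_cast (by omega : ⌈γ⌉₊ ≤ ⌈γ⌉₊ - 1 + 1)
  linarith

lemma abs_le_of_mem_holderClass {C₁ C₂ γ : ℝ} {f : ℝ → ℝ} (hf : f ∈ holderClass C₁ C₂ γ) {t : ℝ}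
    (ht : t ∈ Ioo (0 : ℝ) 1) : |f t| ≤ C₂ := by
  simpa using hf.2.2 0 (Nat.zero_le _) t ht

/-- All functions in a Lipschitz ball have a common modulus of continuity. -/
lemma abs_sub_le_of_mem_holderClass {C₁ C₂ γ : ℝ} (hC₁ : 0 < C₁) (hC₂ : 0 < C₂) (hγ : 0 < γ)
    {f : ℝ → ℝ} (hf : f ∈ holderClass C₁ C₂ γ) {s t : ℝ} (hs : s ∈ Ioo (0 : ℝ) 1)
    (ht : t ∈ Ioo (0 : ℝ) 1) : |f s - f t| ≤ (C₁ + 4 * C₂) * |s - t| ^ min γ 1 := by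
  have hγ1 := strictFloor_lt hγ
  have hγ2 := le_strictFloor_add_one γ
  obtain ⟨h1, h2, h3⟩ := hf
  generalize strictFloor γ = l at *
  rcases Nat.eq_zero_or_pos l with rfl | hl
  · have h4 := h2 s hs t ht
    simp only [iteratedDeriv_zero, Nat.cast_zero, sub_zero, zero_add] at h4 hγ2
    rw [min_eq_left hγ2]
    refine h4.trans ?_
    gcongr
    linarith
  · have hl1 : (1 : ℝ) ≤ l := by exact_mod_cast hl
    rw [min_eq_right (by linarith), Real.rpow_one]
    have hdiff : ∀ u ∈ Ioo (0 : ℝ) 1, DifferentiableAt ℝ f u := fun u hu =>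
      ((h1.differentiableOn (by exact_mod_cast hl.ne')) u hu).differentiableAt
        (isOpen_Ioo.mem_nhds hu)
    have hbd : ∀ u ∈ Ioo (0 : ℝ) 1, ‖deriv f u‖ ≤ C₁ + 4 * C₂ := by
      intro u hu
      rw [Real.norm_eq_abs]
      -- For `l = 1` the class bounds only `f`, not its derivative. The mean value theorem on `[1/4,
      -- 3/4]` supplies a point where the derivative is at most `4 * C₂`, and its Hölder condition
      -- carries the bound to all of `(0,1)`.
      by_cases hl2 : l = 1
      · subst hl2
        have hsub : ∀ v ∈ Icc (1 / 4 : ℝ) (3 / 4), v ∈ Ioo (0 : ℝ) 1 := by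
          intro v hv
          exact ⟨by linarith [hv.1], by linarith [hv.2]⟩
        obtain ⟨c, hc, hc'⟩ := exists_deriv_eq_slope f (a := 1 / 4) (b := 3 / 4) (by norm_num)
          (fun v hv => (hdiff v (hsub v hv)).continuousAt.continuousWithinAt)
          (fun v hv => (hdiff v (hsub v (Ioo_subset_Icc_self hv))).differentiableWithinAt)
        have hc1 := hsub c (Ioo_subset_Icc_self hc)
        have a1 := h3 0 (Nat.zero_le _) (3 / 4) (by norm_num)
        have a2 := h3 0 (Nat.zero_le _) (1 / 4) (by norm_num)
        simp only [iteratedDeriv_zero] at a1 a2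
        have hdc : |deriv f c| ≤ 4 * C₂ := by
          rw [hc', div_eq_mul_inv, show ((3 : ℝ) / 4 - 1 / 4)⁻¹ = 2 by norm_num]
          rw [abs_le] at a1 a2 ⊢
          constructor <;> linarith [a1.1, a1.2, a2.1, a2.2]
        have h4 := h2 u hu c hc1
        rw [iteratedDeriv_one] at h4
        have h5 : |u - c| ^ (γ - ((1 : ℕ) : ℝ)) ≤ 1 := by
          refine Real.rpow_le_one (abs_nonneg _) ?_ (by push_cast; linarith)
          rw [abs_le]
          constructor <;> linarith [hu.1, hu.2, hc1.1, hc1.2]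
        have h6 : C₁ * |u - c| ^ (γ - ((1 : ℕ) : ℝ)) ≤ C₁ * 1 := by gcongr
        have h7 := abs_sub_abs_le_abs_sub (deriv f u) (deriv f c)
        linarith
      · have := h3 1 (by omega) u hu
        rw [iteratedDeriv_one] at this
        linarith
    have := (convex_Ioo (0 : ℝ) 1).norm_image_sub_le_of_norm_deriv_le hdiff hbd ht hs
    simpa only [Real.norm_eq_abs] using this

/-- Taylor expansion with a Hölder remainder. -/
lemma exists_taylor {C α x₀ : ℝ} (hC : 0 ≤ C) (hα : 0 < α) (hx₀ : x₀ ∈ Ioo (0 : ℝ) 1) (l : ℕ) :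
    ∀ (N : ℕ) (f : ℝ → ℝ), l ≤ N → ContDiffOn ℝ (l : ℕ) f (Ioo 0 1) →
      (∀ s ∈ Ioo (0 : ℝ) 1,
        |iteratedDeriv l f s - iteratedDeriv l f x₀| ≤ C * |s - x₀| ^ α) →
      ∃ b : ℕ → ℝ, b 0 = f x₀ ∧ ∀ t ∈ Ioo (0 : ℝ) 1,
        |f t - ∑ k ∈ Finset.range (N + 1), b k * (x₀ - t) ^ k| ≤ C * |t - x₀| ^ (α + l) := by
  induction l with
  | zero =>
    intro N f _ _ hf
    refine ⟨fun k => if k = 0 then f x₀ else 0, if_pos rfl, fun t ht => ?_⟩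
    simpa [Finset.sum_ite_eq'] using hf t ht
  | succ l ih =>
    intro N f hN hfc hf
    obtain ⟨N, rfl⟩ := Nat.exists_eq_add_of_le' (Nat.one_le_of_lt hN)
    have hsucc := (contDiffOn_succ_iff_deriv_of_isOpen (n := (l : WithTop ℕ∞)) isOpen_Ioo).mp
      (by exact_mod_cast hfc)
    obtain ⟨b, hb0, hb⟩ := ih N (deriv f) (by omega) hsucc.2.2 (by
      intro s hs
      simpa only [iteratedDeriv_succ'] using hf s hs)
    -- Integrating the expansion of the derivative term by term; the sign comes from expanding in
    -- powers of `x₀ - t`.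
    refine ⟨fun k => if k = 0 then f x₀ else -(b (k - 1) / k), if_pos rfl, fun t ht => ?_⟩
    set F : ℝ → ℝ := fun t => f t - ∑ k ∈ Finset.range (N + 1 + 1),
      (if k = 0 then f x₀ else -(b (k - 1) / k)) * (x₀ - t) ^ k with hF
    have hF0 : F x₀ = 0 := by
      simp [hF, Finset.sum_range_succ']
    have hFd : ∀ s ∈ Ioo (0 : ℝ) 1, HasDerivAt F
        (deriv f s - ∑ k ∈ Finset.range (N + 1), b k * (x₀ - s) ^ k) s := by
      intro s hs
      have h1 : HasDerivAt f (deriv f s) s :=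
        ((hsucc.1 s hs).differentiableAt (isOpen_Ioo.mem_nhds hs)).hasDerivAt
      refine h1.sub ?_
      simp only [Finset.sum_range_succ' _ (N + 1)]
      have h2 : HasDerivAt (fun t => ∑ k ∈ Finset.range (N + 1),
          (if k + 1 = 0 then f x₀ else -(b (k + 1 - 1) / ((k + 1 : ℕ) : ℝ))) * (x₀ - t) ^ (k + 1))
          (∑ k ∈ Finset.range (N + 1), b k * (x₀ - s) ^ k) s := by
        refine HasDerivAt.fun_sum fun k _ => ?_
        simp only [Nat.succ_ne_zero, if_false, Nat.add_sub_cancel]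
        refine ((((hasDerivAt_id s).const_sub x₀).pow (k + 1)).const_mul _).congr_deriv ?_
        simp only [id_eq, Nat.add_sub_cancel]
        have : ((k + 1 : ℕ) : ℝ) ≠ 0 := by positivity
        field_simp
      simpa using h2.add_const (f x₀)
    have hseg : uIcc x₀ t ⊆ Ioo (0 : ℝ) 1 := (ordConnected_Ioo).uIcc_subset hx₀ ht
    have hmv := (convex_uIcc x₀ t).norm_image_sub_le_of_norm_hasDerivWithin_le
      (f := F) (C := C * |t - x₀| ^ (α + l))
      (fun s hs => (hFd s (hseg hs)).hasDerivWithinAt)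
      (fun s hs => by
        rw [Real.norm_eq_abs]
        refine (hb s (hseg hs)).trans ?_
        gcongr 1
        exact Real.rpow_le_rpow (abs_nonneg _) (abs_sub_left_of_mem_uIcc hs) (by positivity))
      left_mem_uIcc right_mem_uIcc
    rw [hF0, sub_zero, Real.norm_eq_abs, Real.norm_eq_abs, mul_assoc,
      ← Real.rpow_add_one' (abs_nonneg _) (by positivity)] at hmv
    push_cast
    rw [← add_assoc]
    exact hmv

lemma exists_polyVal_approx {C₁ C₂ γ x₀ : ℝ} (hC₁ : 0 < C₁) (hγ : 0 < γ)
    (hx₀ : x₀ ∈ Ioo (0 : ℝ) 1) {p : ℕ} (hp : strictFloor γ ≤ p) {f : ℝ → ℝ}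
    (hf : f ∈ holderClass C₁ C₂ γ) :
    ∃ b : Fin (p + 1) → ℝ, b 0 = f x₀ ∧ ∀ t ∈ Ioo (0 : ℝ) 1,
      |f t - polyVal b (x₀ - t)| ≤ C₁ * |t - x₀| ^ γ := by
  obtain ⟨b, hb0, hb⟩ := exists_taylor (α := γ - strictFloor γ) hC₁.le
    (sub_pos.mpr (strictFloor_lt hγ)) hx₀ (strictFloor γ) p f hp hf.1
    (fun s hs => hf.2.1 s hs x₀ hx₀)
  refine ⟨fun k => b k, by simpa using hb0, fun t ht => ?_⟩
  have := hb t ht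
  rw [sub_add_cancel, Finset.sum_range] at this
  exact this

lemma const_mem_varianceClass {C₁ C₂ γ : ℝ} (hC₁ : 0 < C₁) (hC₂ : 0 < C₂) :
    (fun _ => C₂) ∈ varianceClass C₁ C₂ γ := by
  refine ⟨⟨contDiffOn_const, fun s _ t _ => ?_, fun k _ t _ => ?_⟩, fun _ _ => hC₂.le⟩
  · rw [iteratedDeriv_const, iteratedDeriv_const, sub_self, abs_zero]
    positivity
  · rw [iteratedDeriv_const]
    split_ifs
    · rw [abs_of_pos hC₂]
    · rw [abs_zero]; exact hC₂.le

lemma zero_mem_holderClass {C₁ C₂ β : ℝ} (hC₁ : 0 < C₁) (hC₂ : 0 < C₂) :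
    (fun _ => 0) ∈ holderClass C₁ C₂ β := by
  refine ⟨contDiffOn_const, fun s _ t _ => ?_, fun k _ t _ => ?_⟩
  · rw [iteratedDeriv_const, iteratedDeriv_const, sub_self, abs_zero]
    positivity
  · rw [iteratedDeriv_const, ite_self, abs_zero]; exact hC₂.le

lemma iteratedDeriv_scaled {φ : ℝ → ℝ} (hφ : ContDiff ℝ (⊤ : ℕ∞) φ) (A x₀ η : ℝ) (k : ℕ) :
    iteratedDeriv k (fun t => A * φ ((t - x₀) / η)) =
      fun t => A / η ^ k * iteratedDeriv k φ ((t - x₀) / η) := by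
  induction k with
  | zero => simp
  | succ k ih =>
    rw [iteratedDeriv_succ, ih]
    funext t
    have h1 : DifferentiableAt ℝ (iteratedDeriv k φ) ((t - x₀) / η) :=
      (hφ.differentiable_iteratedDeriv k (by exact_mod_cast WithTop.coe_lt_top k)) _
    have h2 : HasDerivAt (fun t : ℝ => (t - x₀) / η) (1 / η) t :=
      ((hasDerivAt_id t).sub_const x₀).div_const η
    have h3 := (h1.hasDerivAt.comp t h2).const_mul (A / η ^ k)
    have h4 := h3.deriv
    simp only [Function.comp_def] at h4
    rw [h4, iteratedDeriv_succ, pow_succ, ← div_div]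
    ring

/-- Bounds for the derivatives of a test function. -/
lemma exists_derivative_bounds {φ : ℝ → ℝ} (hφ : ContDiff ℝ (⊤ : ℕ∞) φ) (hc : HasCompactSupport φ)
    (l : ℕ) : ∃ B : ℝ, 0 < B ∧ ∀ k ≤ l, ∀ u, |iteratedDeriv k φ u| ≤ B := by
  have hck : ∀ k, HasCompactSupport (iteratedDeriv k φ) := by
    intro k
    induction k with
    | zero => simpa using hc
    | succ k ih => rw [iteratedDeriv_succ]; exact ih.deriv
  have hex : ∀ k, ∃ B : ℝ, ∀ u, ‖iteratedDeriv k φ u‖ ≤ B := fun k =>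
    (hck k).exists_bound_of_continuous
      (hφ.continuous_iteratedDeriv k (by exact_mod_cast le_top))
  choose B hB using hex
  refine ⟨∑ k ∈ Finset.range (l + 1), |B k| + 1, by positivity, fun k hk u => ?_⟩
  have h1 : |B k| ≤ ∑ k ∈ Finset.range (l + 1), |B k| :=
    Finset.single_le_sum (f := fun k => |B k|) (fun _ _ => abs_nonneg _)
      (Finset.mem_range.mpr (by omega))
  have h2 := hB k u
  rw [Real.norm_eq_abs] at h2
  linarith [le_abs_self (B k)]

/-- Bumps of width `η` and height of order `η ^ γ` in the class of variance functions. -/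
lemma exists_bumps {C₁ C₂ γ : ℝ} (hC₁ : 0 < C₁) (hC₂ : 0 < C₂) (hγ : 0 < γ) (x₀ : ℝ) :
    ∃ c : ℝ, 0 < c ∧ ∀ η : ℝ, 0 < η → η ≤ 1 → ∃ V ∈ varianceClass C₁ C₂ γ,
      V x₀ = c * η ^ γ ∧ (∀ t, 0 ≤ V t) ∧ (∀ t, V t ≤ c * η ^ γ) ∧ ∀ t, η < |t - x₀| → V t = 0 := by
  let φ : ContDiffBump (0 : ℝ) := ⟨1 / 2, 1, by norm_num, by norm_num⟩
  have hφ : ContDiff ℝ (⊤ : ℕ∞) φ := φ.contDiff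
  obtain ⟨B, hB0, hB⟩ := exists_derivative_bounds hφ φ.hasCompactSupport (strictFloor γ + 1)
  have hl := strictFloor_lt hγ
  have hl2 := le_strictFloor_add_one γ
  set l := strictFloor γ with hldef
  -- Nearby points use the Lipschitz bound for the `l`-th derivative, with `γ - l ≤ 1`; distant
  -- points use only its boundedness.
  have hHol : ∀ u v : ℝ, |iteratedDeriv l φ u - iteratedDeriv l φ v| ≤
      2 * B * |u - v| ^ (γ - (l : ℝ)) := by
    intro u v
    rcases le_total |u - v| 1 with h | h
    · have h1 := (convex_univ (𝕜 := ℝ)).norm_image_sub_le_of_norm_deriv_le (f := iteratedDeriv l φ)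
        (C := B) (x := v) (y := u)
        (fun w _ => (hφ.differentiable_iteratedDeriv l (by exact_mod_cast WithTop.coe_lt_top l)) w)
        (fun w _ => by
          rw [Real.norm_eq_abs, ← iteratedDeriv_succ]; exact hB (l + 1) le_rfl w)
        (mem_univ _) (mem_univ _)
      rw [Real.norm_eq_abs, Real.norm_eq_abs] at h1
      have h2 : |u - v| ≤ |u - v| ^ (γ - (l : ℝ)) := by
        rcases (abs_nonneg (u - v)).eq_or_lt with h0 | h0
        · rw [← h0]; positivity
        · conv_lhs => rw [← Real.rpow_one |u - v|]
          exact Real.rpow_le_rpow_of_exponent_ge h0 h (by linarith)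
      calc _ ≤ B * |u - v| := h1
        _ ≤ B * |u - v| ^ (γ - (l : ℝ)) := by gcongr
        _ ≤ _ := by
          have : 0 ≤ B * |u - v| ^ (γ - (l : ℝ)) := by positivity
          linarith
    · have h1 := hB l (Nat.le_succ l) u
      have h2 := hB l (Nat.le_succ l) v
      have h3 : 1 ≤ |u - v| ^ (γ - (l : ℝ)) := Real.one_le_rpow h (by linarith)
      calc _ ≤ |iteratedDeriv l φ u| + |iteratedDeriv l φ v| := abs_sub _ _
        _ ≤ 2 * B * 1 := by linarith
        _ ≤ _ := by gcongr
  refine ⟨min C₁ C₂ / (2 * B), by positivity, fun η hη0 hη1 => ?_⟩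
  set c := min C₁ C₂ / (2 * B) with hc
  have hc0 : 0 < c := by positivity
  have hcB : c * (2 * B) = min C₁ C₂ := by rw [hc]; field_simp
  -- The `k`-th derivative scales like `η ^ (γ - k)`, so the Hölder constant of order `γ` is the
  -- same at every width `η`.
  have hit := fun k => iteratedDeriv_scaled hφ (c * η ^ γ) x₀ η k
  have hpow : ∀ k : ℕ, c * η ^ γ / η ^ k = c * η ^ (γ - (k : ℝ)) := by
    intro k
    rw [Real.rpow_sub hη0, Real.rpow_natCast]; ring
  refine ⟨fun t => c * η ^ γ * φ ((t - x₀) / η), ⟨⟨?_, ?_, ?_⟩, ?_⟩, ?_, ?_, ?_, ?_⟩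
  · have : ContDiff ℝ (⊤ : ℕ∞) (fun t => c * η ^ γ * φ ((t - x₀) / η)) :=
      contDiff_const.mul (hφ.comp ((contDiff_id.sub contDiff_const).div_const η))
    exact (this.of_le (by exact_mod_cast le_top)).contDiffOn
  · intro s _ t _
    rw [hit]
    simp only []
    rw [hpow, ← mul_sub, abs_mul, abs_of_pos (by positivity : 0 < c * η ^ (γ - (l : ℝ)))]
    have h1 := hHol ((s - x₀) / η) ((t - x₀) / η)
    rw [← sub_div, sub_sub_sub_cancel_right, abs_div, abs_of_pos hη0,
      Real.div_rpow (abs_nonneg _) hη0.le] at h1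
    calc _ ≤ c * η ^ (γ - (l : ℝ)) * (2 * B * (|s - t| ^ (γ - (l : ℝ)) / η ^ (γ - (l : ℝ)))) := by
          gcongr
      _ = c * (2 * B) * |s - t| ^ (γ - (l : ℝ)) := by
          have : 0 < η ^ (γ - (l : ℝ)) := by positivity
          field_simp
      _ ≤ _ := by rw [hcB]; gcongr; exact min_le_left _ _
  · intro k hk t _
    rw [hit]
    simp only []
    have hkl : k ≤ l := hk.trans (Nat.sub_le _ _)
    have hkγ : (k : ℝ) ≤ l := by exact_mod_cast hkl
    rw [hpow, abs_mul, abs_of_pos (by positivity : 0 < c * η ^ (γ - (k : ℝ)))]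
    have h1 := hB k (by omega) ((t - x₀) / η)
    have h2 : η ^ (γ - (k : ℝ)) ≤ 1 := Real.rpow_le_one hη0.le hη1 (by linarith)
    calc _ ≤ c * 1 * B := by gcongr
      _ ≤ c * (2 * B) := by nlinarith
      _ ≤ C₂ := by rw [hcB]; exact min_le_right _ _
  · intro t _
    have := φ.nonneg (x := (t - x₀) / η)
    positivity
  · have : φ 0 = 1 := φ.one_of_mem_closedBall (by simp [φ])
    simp [this]
  · intro t
    have := φ.nonneg (x := (t - x₀) / η)
    positivity
  · intro t
    have := φ.le_one (x := (t - x₀) / η)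
    exact mul_le_of_le_one_right (by positivity) this
  · intro t ht
    have : φ ((t - x₀) / η) = 0 := by
      apply φ.zero_of_le_dist
      rw [Real.dist_eq, sub_zero, abs_div, abs_of_pos hη0, le_div_iff₀ hη0]
      simpa [φ] using ht.le
    simp [this]

/-! ### Size of the local polynomial weights. -/

section Weights

variable {S : Spec} {n : ℕ} {x : ℕ → ℝ} {t h H Λ : ℝ} {c : Fin (S.p + 1) → ℝ}

/-- The weight of the `i`-th squared pseudoresidual in the local polynomial estimator. -/
def lpWeight (S : Spec) (x : ℕ → ℝ) (t h : ℝ) (c : Fin (S.p + 1) → ℝ) (i : ℕ) : ℝ :=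
  S.K ((t - x i) / h) * polyVal c (t - x i)

lemma Controls.definite (hC : Controls S n x t h H Λ) (hH : 0 < H) (b : Fin (S.p + 1) → ℝ)
    (hb : ∑ i ∈ indices S n, S.K ((t - x i) / h) * polyVal b (t - x i) ^ 2 = 0) : b = 0 := by
  have h0 : ∀ s ∈ Icc (-H) H, polyVal b s = 0 := by
    intro s hs
    have := hC b s (abs_le.mpr hs)
    rw [hb, mul_zero] at this
    exact pow_eq_zero_iff (two_ne_zero) |>.mp (le_antisymm this (sq_nonneg _))
  have hQ : (∑ k : Fin (S.p + 1), Polynomial.C (b k) * Polynomial.X ^ (k : ℕ)) = 0 := by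
    refine Polynomial.eq_zero_of_infinite_isRoot _ ?_
    refine (Icc_infinite (by linarith : -H < H)).mono fun s hs => ?_
    rw [mem_ofPred_eq, Polynomial.IsRoot, ← polyVal_eq_eval]
    exact h0 s hs
  funext k
  have := congrArg (fun q => Polynomial.coeff q (k : ℕ)) hQ
  simpa [Polynomial.finsetSum_coeff, Polynomial.coeff_C_mul, Polynomial.coeff_X_pow,
    Fin.val_inj, Finset.sum_ite_eq] using this

lemma Controls.wellDefined (hC : Controls S n x t h H Λ) (hH : 0 < H) (hK : ∀ u, 0 ≤ S.K u) :
    WellDefined S n x t h := wellDefined_of_definite hK (hC.definite hH)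

lemma Represents.sum_mul (hc : Represents S n x t h c) (b : Fin (S.p + 1) → ℝ) :
    ∑ i ∈ indices S n, lpWeight S x t h c i * polyVal b (t - x i) = b 0 := hc b

lemma Represents.sum_eq_one (hc : Represents S n x t h c) :
    ∑ i ∈ indices S n, lpWeight S x t h c i = 1 := by
  have h1 := hc.sum_mul (Pi.single 0 1)
  rw [Pi.single_eq_same] at h1
  rw [← h1]
  refine Finset.sum_congr rfl fun i _ => ?_
  have : polyVal (Pi.single (0 : Fin (S.p + 1)) (1 : ℝ)) (t - x i) = 1 := by
    simp [polyVal, Pi.single_apply]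
  rw [this, mul_one]

lemma lpWeight_eq_zero (hK : IsWeightFunction S.K) (hh : 0 < h) {i : ℕ} (hi : h < |x i - t|) :
    lpWeight S x t h c i = 0 := by
  have : S.K ((t - x i) / h) = 0 := by
    apply hK.2.2.1
    rw [abs_div, abs_of_pos hh, lt_div_iff₀ hh, one_mul, abs_sub_comm]
    exact hi
  rw [lpWeight, this, zero_mul]

/-- The Gram form of `c` with itself equals `c 0`. Control at 0 gives `c 0 ^ 2 ≤ Λ * c 0`, hence `c
0 ≤ Λ`; control at `s` then gives the square at most `Λ ^ 2`. -/
lemma abs_polyVal_le (hK : ∀ u, 0 ≤ S.K u) (hC : Controls S n x t h H Λ) (hH : 0 ≤ H)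
    (hΛ : 0 ≤ Λ) (hc : Represents S n x t h c) {s : ℝ} (hs : |s| ≤ H) : |polyVal c s| ≤ Λ := by
  have h1 : ∑ i ∈ indices S n, S.K ((t - x i) / h) * polyVal c (t - x i) ^ 2 = c 0 := by
    rw [← hc c]
    exact Finset.sum_congr rfl fun _ _ => by ring
  have h2 : 0 ≤ c 0 := by
    rw [← h1]; exact Finset.sum_nonneg fun i _ => mul_nonneg (hK _) (sq_nonneg _)
  have h3 := hC c 0 (by simpa using hH)
  have h4 := hC c s hs
  rw [h1] at h3 h4
  rw [polyVal_zero_right] at h3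
  have h5 : c 0 ≤ Λ := by
    by_contra hlt
    push Not at hlt
    nlinarith
  refine abs_le_of_sq_le_sq ?_ hΛ
  nlinarith

/-- The hypothesis `hHi` admits a control radius shorter than `h`: for large bandwidths radius 1
already covers the whole design. -/
lemma abs_lpWeight_le (hK : IsWeightFunction S.K) {M : ℝ} (hM : ∀ u, S.K u ≤ M)
    (hC : Controls S n x t h H Λ) (hH : 0 ≤ H) (hΛ : 0 ≤ Λ) (hh : 0 < h)
    (hc : Represents S n x t h c) {i : ℕ} (hHi : |x i - t| ≤ h → |x i - t| ≤ H) :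
    |lpWeight S x t h c i| ≤ M * Λ := by
  have hM0 : 0 ≤ M := (hK.1 0).trans (hM 0)
  by_cases hi : |x i - t| ≤ h
  · rw [lpWeight, abs_mul, abs_of_nonneg (hK.1 _)]
    have := abs_polyVal_le hK.1 hC hH hΛ hc (s := t - x i) (by rw [abs_sub_comm]; exact hHi hi)
    gcongr
    exact hM _
  · rw [lpWeight_eq_zero hK hh (not_le.mp hi), abs_zero]
    positivity

/-- The indices of the design points within distance `s` of `t`. -/
def window (n : ℕ) (x : ℕ → ℝ) (t s : ℝ) : Finset ℕ :=
  (Finset.Icc 1 n).filter (fun i => |x i - t| ≤ s)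

lemma mem_window_of_mem_indices {i : ℕ} {s : ℝ} (hi : i ∈ indices S n) (hs : |x i - t| ≤ s) :
    i ∈ window n x t s := by
  rw [indices, Finset.mem_Icc] at hi
  refine Finset.mem_filter.mpr ⟨Finset.mem_Icc.mpr ⟨by omega, by omega⟩, hs⟩

lemma card_active_le (s : ℝ) : ((indices S n).filter (fun i => |x i - t| ≤ s)).card ≤
    (window n x t s).card := by
  refine Finset.card_le_card fun i hi => ?_
  rw [Finset.mem_filter] at hi
  exact mem_window_of_mem_indices hi.1 hi.2

/-- A sum over all indices of terms with the weights as factors is a sum over the window. -/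
lemma sum_lpWeight_eq (hK : IsWeightFunction S.K) (hh : 0 < h) (F : ℕ → ℝ → ℝ)
    (hF : ∀ i, F i 0 = 0) :
    ∑ i ∈ indices S n, F i (lpWeight S x t h c i) =
      ∑ i ∈ (indices S n).filter (fun i => |x i - t| ≤ h), F i (lpWeight S x t h c i) := by
  rw [Finset.sum_filter]
  refine Finset.sum_congr rfl fun i _ => ?_
  split_ifs with hi
  · rfl
  · rw [lpWeight_eq_zero hK hh (not_le.mp hi), hF]

/-- Cauchy–Schwarz for weights that sum to one and vanish off the window. -/
lemma Represents.one_le_card_mul_sum_sq (hK : IsWeightFunction S.K) (hh : 0 < h)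
    (hc : Represents S n x t h c) {N : ℝ} (hN : ((window n x t h).card : ℝ) ≤ N) :
    1 ≤ N * ∑ i ∈ indices S n, lpWeight S x t h c i ^ 2 := by
  have h1 := hc.sum_eq_one
  rw [sum_lpWeight_eq hK hh (fun _ w => w) (fun _ => rfl)] at h1
  rw [sum_lpWeight_eq hK hh (fun _ w => w ^ 2) (fun _ => by norm_num)]
  have h2 := sq_sum_le_card_mul_sum_sq (s := (indices S n).filter (fun i => |x i - t| ≤ h))
    (f := fun i => lpWeight S x t h c i)
  rw [h1, one_pow] at h2
  refine h2.trans ?_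
  have : (((indices S n).filter (fun i => |x i - t| ≤ h)).card : ℝ) ≤ N :=
    le_trans (by exact_mod_cast card_active_le h) hN
  exact mul_le_mul_of_nonneg_right this (Finset.sum_nonneg fun _ _ => sq_nonneg _)

end Weights

/-! ### Risk bounds for a fixed sample size. -/

section Risk

variable {Ω : Type*} [MeasurableSpace Ω] {P : Measure Ω} [IsProbabilityMeasure P] {ε : ℕ → Ω → ℝ}
variable {S : Spec} {n : ℕ} {x : ℕ → ℝ} {t h : ℝ} {c : Fin (S.p + 1) → ℝ}

lemma risk_eq (hε : IsErrorSequence P ε) (hw : WellDefined S n x t h)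
    (hc : Represents S n x t h c) (g V : ℝ → ℝ) :
    risk P ε S n x g V t h = ENNReal.ofReal (∫ ω, (quadEstimate S (indices S n)
      (lpWeight S x t h c) (noisy (fun i => g (x i)) (fun i => √(V (x i))) (fun j => ε j ω))
        - V t) ^ 2 ∂P) := by
  have hm : MemLp (fun ω => quadEstimate S (indices S n)
      (lpWeight S x t h c) (noisy (fun i => g (x i)) (fun i => √(V (x i))) (fun j => ε j ω))
        - V t) 2 P :=
    (hε.memLp_quadEstimate S _ _ (indices S n) _).sub (memLp_const (V t))
  rw [ofReal_integral_eq_lintegral_ofReal hm.integrable_sq (ae_of_all _ fun ω => sq_nonneg _)]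
  unfold risk
  refine lintegral_congr fun ω => ?_
  rw [hw.varEstimator_eq hc]
  rfl

/-- The errors alone force a risk of the order of the inverse of the number of points in the
window, if the variance function is at least `δ` near the window. -/
lemma exists_risk_ge_of_le_variance (hε : IsErrorSequence P ε) (hd : IsDifferenceSequence S.r S.d)
    (hK : IsWeightFunction S.K) :
    ∃ κ : ℝ, 0 < κ ∧ ∀ (n : ℕ) (x : ℕ → ℝ) (t h N δ : ℝ) (g V : ℝ → ℝ), 0 < h → 0 < N → 0 < δ →
      WellDefined S n x t h → ((window n x t h).card : ℝ) ≤ N →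
      (∀ i ∈ indices S n, |x i - t| ≤ h → ∀ j ∈ Finset.range (S.r + 1),
        δ ≤ V (x (j + i - S.r / 2))) →
      ENNReal.ofReal (κ * δ ^ 2 / N) ≤ risk P ε S n x g V t h := by
  obtain ⟨a, b, hab, hb, hda, hdb, hext⟩ := hd.exists_extreme
  refine ⟨(2 * (S.d a * S.d b)) ^ 2, by positivity, ?_⟩
  intro n x t h N δ g V hh hN hδ hw hcard hV
  obtain ⟨c, hc⟩ := hw.exists_represents
  rw [risk_eq hε hw hc]
  refine ENNReal.ofReal_le_ofReal (le_trans ?_ (hε.le_integral_quadEstimate S _ _ hab hb hext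
    (fun i hi => le_of_mem_indices hi) _ _))
  rw [mul_div_assoc]
  refine mul_le_mul_of_nonneg_left ?_ (sq_nonneg _)
  have h1 := hc.one_le_card_mul_sum_sq hK hh hcard
  calc δ ^ 2 / N ≤ δ ^ 2 * ∑ i ∈ indices S n, lpWeight S x t h c i ^ 2 := by
        rw [div_eq_mul_inv]
        gcongr
        rw [inv_le_iff_one_le_mul₀ hN, mul_comm]
        exact h1
    _ ≤ _ := by
        rw [Finset.mul_sum]
        refine Finset.sum_le_sum fun i hi => ?_
        by_cases hit : |x i - t| ≤ h
        · have h2 := hV i hi hit a (Finset.mem_range.mpr (by omega))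
          have h3 := hV i hi hit b (Finset.mem_range.mpr (by omega))
          have h4 : 0 ≤ V (x (a + i - S.r / 2)) := hδ.le.trans h2
          rw [mul_comm, mul_pow, Real.sq_sqrt (hδ.le.trans h2), Real.sq_sqrt (hδ.le.trans h3), sq δ]
          gcongr
        · rw [lpWeight_eq_zero hK hh (not_le.mp hit)]
          simp

/-- The squared bias is a lower bound for the risk. -/
lemma sq_bias_le_risk (hε : IsErrorSequence P ε) (hw : WellDefined S n x t h)
    (hc : Represents S n x t h c) (g V : ℝ → ℝ) :
    ENNReal.ofReal ((quadMean S (fun i => g (x i)) (fun i => √(V (x i))) (indices S n)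
      (lpWeight S x t h c) - V t) ^ 2) ≤ risk P ε S n x g V t h := by
  rw [risk_eq hε hw hc]
  refine ENNReal.ofReal_le_ofReal ?_
  rw [integral_sub_const_sq (hε.memLp_quadEstimate S _ _ _ _),
    hε.integral_quadEstimate S _ _ (fun i hi => le_of_mem_indices hi)]
  exact le_add_of_nonneg_left (variance_nonneg _ _)

/-- A narrow bump in the variance function is missed by the estimator. -/
lemma risk_ge_of_bump (hε : IsErrorSequence P ε) (hd : IsDifferenceSequence S.r S.d)
    (hw : WellDefined S n x t h) (hc : Represents S n x t h c) {V : ℝ → ℝ} {η w N : ℝ}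
    (hV0 : ∀ s, 0 ≤ V s) (hVt : ∀ s, V s ≤ V t) (hVη : ∀ s, η < |s - t| → V s = 0)
    (hcw : ∀ i ∈ indices S n, |lpWeight S x t h c i| ≤ w)
    (hN : ((window n x t η).card : ℝ) ≤ N) (hwN : w * N ≤ 1 / 2) (hw0 : 0 ≤ w) :
    ENNReal.ofReal (V t ^ 2 / 4) ≤ risk P ε S n x (fun _ => 0) V t h := by
  refine le_trans (ENNReal.ofReal_le_ofReal ?_) (sq_bias_le_risk hε hw hc (fun _ => 0) V)
  -- With `g = 0` the mean is an average over the lags, with weights `d j ^ 2`, of weighted sums of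
  -- shifted values of `V`. In each such sum at most `N` terms meet the bump, so at most half of its
  -- height is recovered.
  have hmean : quadMean S (fun i => (fun _ => (0 : ℝ)) (x i)) (fun i => √(V (x i))) (indices S n)
      (lpWeight S x t h c) ≤ V t / 2 := by
    have e : quadMean S (fun i => (fun _ => (0 : ℝ)) (x i)) (fun i => √(V (x i))) (indices S n)
      (lpWeight S x t h c) = ∑ j ∈ Finset.range (S.r + 1), S.d j ^ 2 *
        ∑ i ∈ indices S n, lpWeight S x t h c i * V (x (j + i - S.r / 2)) := by
      simp only [quadMean, pseudoresidual, mul_zero, Finset.sum_const_zero,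
        Real.sq_sqrt (hV0 _), Finset.mul_sum]
      simp only [ne_eq, OfNat.ofNat_ne_zero, not_false_eq_true, zero_pow, zero_add, Finset.mul_sum]
      rw [Finset.sum_comm]
      exact Finset.sum_congr rfl fun _ _ => Finset.sum_congr rfl fun _ _ => by ring
    have hinner : ∀ j ∈ Finset.range (S.r + 1),
        ∑ i ∈ indices S n, lpWeight S x t h c i * V (x (j + i - S.r / 2)) ≤ V t / 2 := by
      intro j hj
      have h1 : ∀ i ∈ indices S n, lpWeight S x t h c i * V (x (j + i - S.r / 2)) ≤
          if |x (j + i - S.r / 2) - t| ≤ η then w * V t else 0 := by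
        intro i hi
        split_ifs with hη
        · calc _ ≤ |lpWeight S x t h c i| * V (x (j + i - S.r / 2)) := by
                gcongr
                · exact hV0 _
                · exact le_abs_self _
            _ ≤ w * V t := by
                gcongr
                · exact hV0 _
                · exact hcw i hi
                · exact hVt _
        · rw [hVη _ (not_le.mp hη), mul_zero]
      have h2 : (((indices S n).filter (fun i => |x (j + i - S.r / 2) - t| ≤ η)).card : ℝ) ≤ N := by
        refine le_trans ?_ hN
        have hinj : Set.InjOn (fun i => j + i - S.r / 2)
            ((indices S n).filter (fun i => |x (j + i - S.r / 2) - t| ≤ η) : Set ℕ) := by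
          intro i hi k hk hik
          have h1 := le_of_mem_indices (Finset.mem_filter.mp hi).1
          have h2 := le_of_mem_indices (Finset.mem_filter.mp hk).1
          simp only at hik
          omega
        exact_mod_cast Finset.card_le_card_of_injOn _ (fun i hi => by
          have h1 := Finset.mem_filter.mp hi
          exact Finset.mem_filter.mpr ⟨Finset.mem_Icc.mpr (add_sub_mem h1.1 hj), h1.2⟩) hinj
      calc _ ≤ _ := Finset.sum_le_sum h1
        _ = ((indices S n).filter (fun i => |x (j + i - S.r / 2) - t| ≤ η)).card * (w * V t) := by
            rw [← Finset.sum_filter, Finset.sum_const, nsmul_eq_mul]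
        _ ≤ N * (w * V t) := by
            have := hV0 t
            gcongr
        _ = (w * N) * V t := by ring
        _ ≤ 1 / 2 * V t := by
            have := hV0 t
            gcongr
        _ = V t / 2 := by ring
    rw [e]
    calc _ ≤ ∑ j ∈ Finset.range (S.r + 1), S.d j ^ 2 * (V t / 2) :=
          Finset.sum_le_sum fun j hj => mul_le_mul_of_nonneg_left (hinner j hj) (sq_nonneg _)
      _ = V t / 2 := by rw [← Finset.sum_mul, hd.2, one_mul]
  have := hV0 t
  nlinarith

/-- As the `d j` sum to zero, the value at `i` may be subtracted throughout. -/
lemma abs_pseudoresidual_le (hd : IsDifferenceSequence S.r S.d) {m : ℕ → ℝ} {i : ℕ} {E : ℝ}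
    (hE : ∀ j ∈ Finset.range (S.r + 1), |m (j + i - S.r / 2) - m i| ≤ E) :
    |pseudoresidual S m i| ≤ (∑ j ∈ Finset.range (S.r + 1), |S.d j|) * E := by
  have e : pseudoresidual S m i =
      ∑ j ∈ Finset.range (S.r + 1), S.d j * (m (j + i - S.r / 2) - m i) := by
    simp only [mul_sub, Finset.sum_sub_distrib, ← Finset.sum_mul, hd.1, zero_mul, sub_zero]
    rfl
  rw [e, Finset.sum_mul]
  refine (Finset.abs_sum_le_sum_abs _ _).trans (Finset.sum_le_sum fun j hj => ?_)
  rw [abs_mul]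
  exact mul_le_mul_of_nonneg_left (hE j hj) (abs_nonneg _)

/-- Bias bound for local polynomial weights. -/
lemma abs_quadMean_sub_le (hd : IsDifferenceSequence S.r S.d) (hK : IsWeightFunction S.K)
    (hh : 0 < h) (hc : Represents S n x t h c) {m : ℕ → ℝ} {V : ℝ → ℝ} {b : Fin (S.p + 1) → ℝ}
    (hb0 : b 0 = V t) {w N E₁ E₂ E₃ : ℝ} (hw0 : 0 ≤ w) (hE : 0 ≤ E₁ + E₂ + E₃)
    (hcw : ∀ i ∈ indices S n, |lpWeight S x t h c i| ≤ w)
    (hN : ((window n x t h).card : ℝ) ≤ N)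
    (hE₁ : ∀ i ∈ indices S n, |x i - t| ≤ h → pseudoresidual S m i ^ 2 ≤ E₁)
    (hV0 : ∀ i ∈ indices S n, |x i - t| ≤ h → ∀ j ∈ Finset.range (S.r + 1),
      0 ≤ V (x (j + i - S.r / 2)))
    (hE₂ : ∀ i ∈ indices S n, |x i - t| ≤ h → ∀ j ∈ Finset.range (S.r + 1),
      |V (x (j + i - S.r / 2)) - V (x i)| ≤ E₂)
    (hE₃ : ∀ i ∈ indices S n, |x i - t| ≤ h → |V (x i) - polyVal b (t - x i)| ≤ E₃) :
    |quadMean S m (fun i => √(V (x i))) (indices S n) (lpWeight S x t h c) - V t| ≤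
      N * (w * (E₁ + E₂ + E₃)) := by
  -- Polynomial reproduction writes `V t` as the weighted sum of the Taylor polynomial, so the bias
  -- is a weighted sum of local errors.
  have e : quadMean S m (fun i => √(V (x i))) (indices S n) (lpWeight S x t h c) - V t =
      ∑ i ∈ indices S n, (lpWeight S x t h c i * (pseudoresidual S m i ^ 2 +
        ∑ j ∈ Finset.range (S.r + 1), S.d j ^ 2 * √(V (x (j + i - S.r / 2))) ^ 2 -
          polyVal b (t - x i))) := by
    rw [← hb0, ← hc.sum_mul b, quadMean, ← Finset.sum_sub_distrib]
    exact Finset.sum_congr rfl fun _ _ => by ring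
  rw [e, sum_lpWeight_eq hK hh (fun i u => u * (pseudoresidual S m i ^ 2 +
        ∑ j ∈ Finset.range (S.r + 1), S.d j ^ 2 * √(V (x (j + i - S.r / 2))) ^ 2 -
          polyVal b (t - x i))) (fun _ => zero_mul _)]
  refine (Finset.abs_sum_le_sum_abs _ _).trans ?_
  have hterm : ∀ i ∈ (indices S n).filter (fun i => |x i - t| ≤ h),
      |lpWeight S x t h c i * (pseudoresidual S m i ^ 2 +
        ∑ j ∈ Finset.range (S.r + 1), S.d j ^ 2 * √(V (x (j + i - S.r / 2))) ^ 2 -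
          polyVal b (t - x i))| ≤ w * (E₁ + E₂ + E₃) := by
    intro i hi
    obtain ⟨hi, hit⟩ := Finset.mem_filter.mp hi
    rw [abs_mul]
    refine mul_le_mul (hcw i hi) ?_ (abs_nonneg _) hw0
    have h1 : pseudoresidual S m i ^ 2 + ∑ j ∈ Finset.range (S.r + 1),
        S.d j ^ 2 * √(V (x (j + i - S.r / 2))) ^ 2 - polyVal b (t - x i) =
        pseudoresidual S m i ^ 2 + ∑ j ∈ Finset.range (S.r + 1),
          S.d j ^ 2 * (V (x (j + i - S.r / 2)) - V (x i)) + (V (x i) - polyVal b (t - x i)) := by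
      have : ∑ j ∈ Finset.range (S.r + 1), S.d j ^ 2 * √(V (x (j + i - S.r / 2))) ^ 2 =
          ∑ j ∈ Finset.range (S.r + 1), S.d j ^ 2 * (V (x (j + i - S.r / 2)) - V (x i)) +
            V (x i) := by
        simp only [mul_sub, Finset.sum_sub_distrib, ← Finset.sum_mul, hd.2, one_mul]
        rw [sub_add_cancel]
        exact Finset.sum_congr rfl fun j hj => by rw [Real.sq_sqrt (hV0 i hi hit j hj)]
      rw [this]; ring
    rw [h1]
    refine (abs_add_three _ _ _).trans ?_
    have h2 : |∑ j ∈ Finset.range (S.r + 1), S.d j ^ 2 * (V (x (j + i - S.r / 2)) - V (x i))| ≤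
        E₂ := by
      refine (Finset.abs_sum_le_sum_abs _ _).trans ?_
      calc _ ≤ ∑ j ∈ Finset.range (S.r + 1), S.d j ^ 2 * E₂ := by
            refine Finset.sum_le_sum fun j hj => ?_
            rw [abs_mul, abs_of_nonneg (sq_nonneg _)]
            exact mul_le_mul_of_nonneg_left (hE₂ i hi hit j hj) (sq_nonneg _)
        _ = E₂ := by rw [← Finset.sum_mul, hd.2, one_mul]
    have h3 := hE₁ i hi hit
    have h4 := hE₃ i hi hit
    rw [abs_of_nonneg (sq_nonneg (pseudoresidual S m i))]
    linarith
  refine (Finset.sum_le_sum hterm).trans ?_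
  rw [Finset.sum_const, nsmul_eq_mul]
  have : (((indices S n).filter (fun i => |x i - t| ≤ h)).card : ℝ) ≤ N :=
    le_trans (by exact_mod_cast card_active_le h) hN
  gcongr

/-- Upper bound for the risk in terms of the size of the weights and of the window. -/
lemma risk_le (hε : IsErrorSequence P ε) (hd : IsDifferenceSequence S.r S.d)
    (hK : IsWeightFunction S.K) {D C₁ C₂ γ β : ℝ} (hC₁ : 0 < C₁) (hC₂ : 0 < C₂) (hγ : 0 < γ)
    (hβ : 0 < β) (hp : strictFloor γ ≤ S.p) (hn : 1 ≤ n) (hD : 0 < D) (hx : IsGapDesign n x D)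
    (hh : 0 < h) (ht0 : h + S.r * (D / n) < t) (ht1 : h + S.r * (D / n) < 1 - t)
    (hw : WellDefined S n x t h) (hc : Represents S n x t h c) {w N : ℝ} (hw0 : 0 ≤ w)
    (hcw : ∀ i ∈ indices S n, |lpWeight S x t h c i| ≤ w)
    (hN : ((window n x t h).card : ℝ) ≤ N) {V g : ℝ → ℝ} (hV : V ∈ varianceClass C₁ C₂ γ)
    (hg : g ∈ holderClass C₁ C₂ β) :
    risk P ε S n x g V t h ≤ ENNReal.ofReal (
      (2 * S.r + 1) * ((S.r + 1) ^ 2 * (8 * (C₂ ^ 4 + C₂ ^ 2 * ∫ ω, ε 0 ω ^ 4 ∂P)) *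
        (N * w ^ 2)) +
      (N * (w * (((∑ j ∈ Finset.range (S.r + 1), |S.d j|) *
          ((C₁ + 4 * C₂) * (S.r * (D / n)) ^ min β 1)) ^ 2 +
        (C₁ + 4 * C₂) * (S.r * (D / n)) ^ min γ 1 + C₁ * h ^ γ))) ^ 2) := by
  have hn' : (0 : ℝ) < n := by exact_mod_cast hn
  have hrD : 0 ≤ S.r * (D / n) := by positivity
  have hclose : ∀ i ∈ indices S n, ∀ j ∈ Finset.range (S.r + 1),
      |x (j + i - S.r / 2) - x i| ≤ S.r * (D / n) := by
    intro i hi j hj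
    have h1 := add_sub_mem hi hj
    rw [indices, Finset.mem_Icc] at hi
    rw [Finset.mem_range] at hj
    exact hx.abs_sub_le hD.le (by omega) (by omega) (by omega) (by omega)
  have hmem : ∀ i ∈ indices S n, |x i - t| ≤ h → ∀ j ∈ Finset.range (S.r + 1),
      x (j + i - S.r / 2) ∈ Ioo (0 : ℝ) 1 := by
    intro i hi hit j hj
    have h1 := abs_le.mp (hclose i hi j hj)
    have h2 := abs_le.mp hit
    exact ⟨by linarith, by linarith⟩
  have hmem' : ∀ i, |x i - t| ≤ h → x i ∈ Ioo (0 : ℝ) 1 := by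
    intro i hit
    have h2 := abs_le.mp hit
    exact ⟨by linarith, by linarith⟩
  have ht : t ∈ Ioo (0 : ℝ) 1 := ⟨by linarith, by linarith⟩
  have hμ4 : 0 ≤ ∫ ω, ε 0 ω ^ 4 ∂P := integral_nonneg fun ω => by positivity
  have hfour : ∀ u : ℝ, |u| ≤ C₂ → u ^ 4 ≤ C₂ ^ 4 := by
    intro u hu
    rw [← (by decide : Even 4).pow_abs]
    gcongr
  rw [risk_eq hε hw hc]
  refine ENNReal.ofReal_le_ofReal ?_
  rw [integral_sub_const_sq (hε.memLp_quadEstimate S _ _ _ _),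
    hε.integral_quadEstimate S _ _ (fun i hi => le_of_mem_indices hi)]
  have hV0 : ∀ i ∈ indices S n, |x i - t| ≤ h → ∀ j ∈ Finset.range (S.r + 1),
      0 ≤ V (x (j + i - S.r / 2)) := fun i hi hit j hj =>
    hV.2 _ (Ioo_subset_Icc_self (hmem i hi hit j hj))
  refine add_le_add ?_ ?_
  -- The sum is restricted to the window first: only there are all points used by a pseudoresidual
  -- known to lie in `(0,1)`, where the classes give bounds.
  · have hvar := hε.variance_quadEstimate_le S (fun i => g (x i)) (fun i => √(V (x i)))
      (I := (indices S n).filter (fun i => |x i - t| ≤ h))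
      (fun i hi => le_of_mem_indices (Finset.mem_filter.mp hi).1) (lpWeight S x t h c)
      (B := (S.r + 1) ^ 2 * (8 * (C₂ ^ 4 + C₂ ^ 2 * ∫ ω, ε 0 ω ^ 4 ∂P))) (by
        intro i hi
        obtain ⟨hi, hit⟩ := Finset.mem_filter.mp hi
        refine hε.integral_pseudoresidual_pow_four_le S _ _ hd fun j hj => ?_
        have h1 := hmem i hi hit j hj
        have h2 := hV0 i hi hit j hj
        have h3 : √(V (x (j + i - S.r / 2))) ^ 4 ≤ C₂ ^ 2 := by
          have : √(V (x (j + i - S.r / 2))) ^ 4 = (√(V (x (j + i - S.r / 2))) ^ 2) ^ 2 := by ring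
          rw [this, Real.sq_sqrt h2]
          have := (le_abs_self _).trans (abs_le_of_mem_holderClass hV.1 h1)
          gcongr
        have h4 := hfour _ (abs_le_of_mem_holderClass hg h1)
        gcongr)
    have hq : ∀ y, quadEstimate S (indices S n) (lpWeight S x t h c) y =
        quadEstimate S ((indices S n).filter (fun i => |x i - t| ≤ h)) (lpWeight S x t h c) y :=
      fun y => sum_lpWeight_eq hK hh (fun i u => u * pseudoresidual S y i ^ 2)
        (fun _ => zero_mul _)
    simp only [← hq] at hvar
    refine hvar.trans ?_
    gcongr
    calc _ ≤ ∑ i ∈ (indices S n).filter (fun i => |x i - t| ≤ h), w ^ 2 := by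
          refine Finset.sum_le_sum fun i hi => ?_
          rw [← sq_abs]
          have := hcw i (Finset.mem_filter.mp hi).1
          gcongr
      _ = ((indices S n).filter (fun i => |x i - t| ≤ h)).card * w ^ 2 := by
          rw [Finset.sum_const, nsmul_eq_mul]
      _ ≤ N * w ^ 2 := by
          have : (((indices S n).filter (fun i => |x i - t| ≤ h)).card : ℝ) ≤ N :=
            le_trans (by exact_mod_cast card_active_le h) hN
          gcongr
  · rw [← sq_abs]
    obtain ⟨b, hb0, hb⟩ := exists_polyVal_approx hC₁ hγ ht hp hV.1
    have hmod : ∀ {f : ℝ → ℝ} {α : ℝ}, 0 < α → f ∈ holderClass C₁ C₂ α → ∀ i ∈ indices S n,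
        |x i - t| ≤ h → ∀ j ∈ Finset.range (S.r + 1),
        |f (x (j + i - S.r / 2)) - f (x i)| ≤ (C₁ + 4 * C₂) * (S.r * (D / n)) ^ min α 1 := by
      intro f α hα hf i hi hit j hj
      refine (abs_sub_le_of_mem_holderClass hC₁ hC₂ hα hf (hmem i hi hit j hj)
        (hmem' i hit)).trans ?_
      have := Real.rpow_le_rpow (abs_nonneg _) (hclose i hi j hj) (by positivity : 0 ≤ min α 1)
      gcongr
    gcongr
    refine abs_quadMean_sub_le hd hK hh hc hb0 hw0 (by positivity) hcw hN ?_ hV0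
      (hmod hγ hV.1) ?_
    · intro i hi hit
      rw [← sq_abs]
      have := abs_pseudoresidual_le hd (m := fun i => g (x i)) (hmod hβ hg i hi hit)
      gcongr
    · intro i hi hit
      refine (hb _ (hmem' i hit)).trans ?_
      gcongr

end Risk

/-! ### Uniform constants from the design and the weight function. -/

lemma IsDesign.exists_gap {x : ℕ → ℕ → ℝ} (hx : IsDesign x) :
    ∃ D : ℝ, 0 < D ∧ ∀ n : ℕ, 1 ≤ n → IsGapDesign n (x n) D := by
  obtain ⟨h1, C, hC⟩ := hx
  refine ⟨max C 1, by positivity, fun n hn => ⟨(h1 n).1, (h1 n).2.1, (h1 n).2.2, fun i hi => ?_⟩⟩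
  refine (hC n hn i hi).trans ?_
  gcongr
  exact le_max_left _ _

lemma HasBoundedDensityAt.exists_card_window_le {x : ℕ → ℕ → ℝ} {x₀ : ℝ}
    (hx : HasBoundedDensityAt x x₀) :
    ∃ C : ℝ, 0 < C ∧ ∀ n : ℕ, 1 ≤ n → ∀ t : ℝ, 1 / (n : ℝ) ≤ t →
      ((window n (x n) x₀ t).card : ℝ) ≤ C * n * t := by
  obtain ⟨C, hC⟩ := hx
  refine ⟨max C 1, by positivity, fun n hn t ht => (hC n hn t ht).trans ?_⟩
  have : 0 ≤ t := le_trans (by positivity) ht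
  gcongr
  exact le_max_left _ _

/-- A function with integral one cannot vanish at almost every continuity point. Positivity persists
around a continuity point, and the support condition keeps that interval inside `[-1,1]`. -/
lemma IsWeightFunction.exists_interval {K : ℝ → ℝ} (hK : IsWeightFunction K)
    (hKc : ∀ᵐ u : ℝ, ContinuousAt K u) :
    ∃ κ u₁ u₂ : ℝ, 0 < κ ∧ -1 ≤ u₁ ∧ u₁ < u₂ ∧ u₂ ≤ 1 ∧ ∀ u ∈ Icc u₁ u₂, κ ≤ K u := by
  have h1 : ∃ u, ContinuousAt K u ∧ K u ≠ 0 := by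
    by_contra hcon
    push Not at hcon
    have h2 : K =ᵐ[volume] 0 := hKc.mono fun u hu => hcon u hu
    have := hK.2.2.2
    rw [integral_congr_ae h2] at this
    simp at this
  obtain ⟨u, hu, hu0⟩ := h1
  have hpos : 0 < K u := lt_of_le_of_ne (hK.1 u) hu0.symm
  have h2 : ∀ᶠ v in nhds u, K u / 2 < K v := hu.eventually (lt_mem_nhds (by linarith))
  obtain ⟨ρ, hρ, hball⟩ := Metric.eventually_nhds_iff.mp h2
  have hin : ∀ v ∈ Icc (u - ρ / 2) (u + ρ / 2), K u / 2 ≤ K v := by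
    intro v hv
    refine (hball ?_).le
    rw [Real.dist_eq, abs_lt]
    constructor <;> linarith [hv.1, hv.2]
  have hsupp : ∀ v ∈ Icc (u - ρ / 2) (u + ρ / 2), |v| ≤ 1 := by
    intro v hv
    by_contra hlt
    have := hin v hv
    rw [hK.2.2.1 v (not_le.mp hlt)] at this
    linarith
  exact ⟨K u / 2, u - ρ / 2, u + ρ / 2, by linarith,
    (abs_le.mp (hsupp _ ⟨le_rfl, by linarith⟩)).1, by linarith,
    (abs_le.mp (hsupp _ ⟨by linarith, le_rfl⟩)).2, hin⟩

/-- The local designs with bandwidths in `B` control polynomials on the windows, truncated at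
length one. -/
def WindowControl (S : Spec) (x : ℕ → ℕ → ℝ) (t : ℝ) (B : Set ℝ) (Λ N : ℝ) : Prop :=
  ∀ n : ℕ, 1 ≤ n → ∀ h ∈ B, N ≤ n * min h 1 →
    Controls S n (x n) t h (min h 1) (Λ / (n * min h 1))

/-- For such `h` the image of `[u₁, u₂]` under `u ↦ x₀ - h * u` stays in the unit interval, wherever
the weight function is positive. -/
lemma exists_windowControl_inside {S : Spec} (hK : IsWeightFunction S.K)
    (hKc : ∀ᵐ u : ℝ, ContinuousAt S.K u) {x₀ : ℝ} {x : ℕ → ℕ → ℝ} {D : ℝ} (hD : 0 < D)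
    (hx : ∀ n : ℕ, 1 ≤ n → IsGapDesign n (x n) D) :
    ∃ Λ N : ℝ, 0 < Λ ∧ 0 < N ∧ WindowControl S x x₀ (Ioc 0 (min x₀ (1 - x₀))) Λ N := by
  obtain ⟨κ, u₁, u₂, hκ, h1, h12, h2, hKκ⟩ := hK.exists_interval hKc
  obtain ⟨Λ, N, hΛ, hN, hmain⟩ := controls_of_interval S hK.1 hD hκ (sub_pos.mpr h12)
  refine ⟨Λ, N, hΛ, hN, fun n hn h hh hNh => ?_⟩
  have ha := hh.2.trans (min_le_left _ _)
  have hb := hh.2.trans (min_le_right _ _)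
  have hh0 := hh.1
  have hmin : min h 1 = h := min_eq_left (by linarith)
  rw [hmin] at hNh ⊢
  have e : x₀ - h * u₂ + (u₂ - u₁) * h = x₀ - h * u₁ := by ring
  refine hmain n (x n) x₀ h h (x₀ - h * u₂) hn (hx n hn) hh0 hNh ?_ ?_ ?_ ?_ ?_
  · nlinarith
  · rw [e]; nlinarith
  · nlinarith
  · rw [e]; nlinarith
  · rw [e]
    intro s hs
    apply hKκ
    refine ⟨?_, ?_⟩
    · rw [le_div_iff₀ hh0]; linarith [hs.2]
    · rw [div_le_iff₀ hh0]; linarith [hs.1]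

/-- For large `h` a positivity interval away from 0 could correspond to points outside the unit
interval. Positivity near 0 provides an interval starting at `x₀` that fits for every `h`. -/
lemma exists_windowControl_of_pos {S : Spec} (hK : IsWeightFunction S.K) {κ ρ : ℝ} (hκ : 0 < κ)
    (hρ : 0 < ρ) (hKκ : ∀ u : ℝ, |u| ≤ ρ → κ ≤ S.K u) {x₀ : ℝ} (hx₀ : x₀ ∈ Ioo (0 : ℝ) 1)
    {x : ℕ → ℕ → ℝ} {D : ℝ} (hD : 0 < D) (hx : ∀ n : ℕ, 1 ≤ n → IsGapDesign n (x n) D) :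
    ∃ Λ N : ℝ, 0 < Λ ∧ 0 < N ∧ WindowControl S x x₀ (Ioi 0) Λ N := by
  have hx1 : 0 < 1 - x₀ := by linarith [hx₀.2]
  have hθ : 0 < min ρ (1 - x₀) := lt_min hρ hx1
  obtain ⟨Λ, N, hΛ, hN, hmain⟩ := controls_of_interval S hK.1 hD hκ hθ
  refine ⟨Λ, N, hΛ, hN, fun n hn h hh hNh => ?_⟩
  have hh0 : 0 < h := hh
  set H := min h 1 with hH
  have hH0 : 0 < H := lt_min hh0 one_pos
  have hHh : H ≤ h := min_le_left _ _
  have hH1 : H ≤ 1 := min_le_right _ _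
  have ha := min_le_left ρ (1 - x₀)
  have hb := min_le_right ρ (1 - x₀)
  refine hmain n (x n) x₀ h H x₀ hn (hx n hn) hH0 hNh hx₀.1.le ?_ ?_ ?_ ?_
  · nlinarith
  · linarith
  · have := hx₀.1
    nlinarith
  · intro s hs
    apply hKκ
    rw [abs_div, abs_of_pos hh0, div_le_iff₀ hh0, abs_sub_comm, abs_of_nonneg (by linarith [hs.1])]
    have : min ρ (1 - x₀) * H ≤ ρ * h := by gcongr
    linarith [hs.2]

/-! ### Arithmetic of the optimal rate. -/

/-- The order `n ^ (-1 / (2 γ + 1))` of the optimal bandwidth. -/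
def rate (γ : ℝ) (n : ℕ) : ℝ := (n : ℝ) ^ (-(1 / (2 * γ + 1)))

section Rate

variable {γ : ℝ} {n : ℕ}

lemma rate_pos (hn : 1 ≤ n) : 0 < rate γ n := by
  have : (0 : ℝ) < n := by exact_mod_cast hn
  unfold rate; positivity

lemma rate_le_one (hγ : 0 < γ) (hn : 1 ≤ n) : rate γ n ≤ 1 := by
  have : (1 : ℝ) ≤ n := by exact_mod_cast hn
  refine Real.rpow_le_one_of_one_le_of_nonpos this ?_
  have : 0 < 1 / (2 * γ + 1) := by positivity
  linarith

lemma rpow_mul_eq_div_rate (h : ℝ) :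
    (n : ℝ) ^ (1 / (2 * γ + 1)) * h = h / rate γ n := by
  unfold rate
  rw [Real.rpow_neg (Nat.cast_nonneg n), div_inv_eq_mul, mul_comm]

lemma rpow_eq_rate_rpow :
    (n : ℝ) ^ (-(2 * γ / (2 * γ + 1))) = rate γ n ^ (2 * γ) := by
  unfold rate
  rw [← Real.rpow_mul (Nat.cast_nonneg n)]
  congr 1
  ring

lemma one_div_eq_rate_rpow (hγ : 0 < γ) : 1 / (n : ℝ) = rate γ n ^ (2 * γ + 1) := by
  unfold rate
  rw [← Real.rpow_mul (Nat.cast_nonneg n), neg_mul, one_div_mul_cancel (by positivity),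
    Real.rpow_neg_one, one_div]

/-- The balance that defines the rate: the variance order `1/(n h)` equals the squared bias order `h
^ (2 * γ)`. -/
lemma one_div_mul_rate (hγ : 0 < γ) (hn : 1 ≤ n) :
    1 / (n * rate γ n) = rate γ n ^ (2 * γ) := by
  have := rate_pos (γ := γ) hn
  rw [← one_div_mul_one_div, one_div_eq_rate_rpow hγ, Real.rpow_add_one this.ne']
  field_simp

lemma tendsto_rate (hγ : 0 < γ) : Tendsto (rate γ) atTop (nhds 0) :=
  (tendsto_rpow_neg_atTop (by positivity)).comp tendsto_natCast_atTop_atTop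

lemma tendsto_mul_rate (hγ : 0 < γ) : Tendsto (fun n : ℕ => n * rate γ n) atTop atTop := by
  have h1 : Tendsto (fun n : ℕ => (n : ℝ) ^ (2 * γ / (2 * γ + 1))) atTop atTop :=
    (tendsto_rpow_atTop (by positivity)).comp tendsto_natCast_atTop_atTop
  refine h1.congr' ?_
  filter_upwards [eventually_ge_atTop 1] with n hn
  have : (0 : ℝ) < n := by exact_mod_cast hn
  unfold rate
  rw [← Real.rpow_one_add' this.le]
  · congr 1
    field_simp
    ring
  · have : 1 / (2 * γ + 1) < 1 := by rw [div_lt_one (by positivity)]; linarith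
    linarith

lemma eventually_rate (hγ : 0 < γ) {a s : ℝ} (b R N : ℝ) (ha : 0 < a) (hs : 0 < s) :
    ∀ᶠ n : ℕ in atTop, 1 ≤ n ∧ b * rate γ n + R / n < s ∧ N ≤ n * (a * rate γ n) := by
  have h1 : Tendsto (fun n : ℕ => b * rate γ n + R / n) atTop (nhds (b * 0 + 0)) :=
    ((tendsto_rate hγ).const_mul b).add (tendsto_const_div_atTop_nhds_zero_nat R)
  rw [mul_zero, add_zero] at h1
  have h2 := (tendsto_mul_rate hγ).const_mul_atTop ha
  filter_upwards [eventually_ge_atTop 1, h1.eventually_lt_const hs,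
    h2.eventually_ge_atTop N] with n hn h3 h4
  exact ⟨hn, h3, by linarith⟩

end Rate

/-! ### Asymptotic risk bounds and the order of good bandwidths. -/

section Main

set_option linter.unusedSectionVars false

variable {Ω : Type*} [MeasurableSpace Ω] {P : Measure Ω} [IsProbabilityMeasure P] {ε : ℕ → Ω → ℝ}
variable {S : Spec} {x₀ : ℝ} {x : ℕ → ℕ → ℝ} {C₁ C₂ γ D Cd Λ N : ℝ}

/-- Lower bound for the risk at every variance function that is bounded away from zero at the
point. -/
lemma exists_risk_ge (hε : IsErrorSequence P ε) (hd : IsDifferenceSequence S.r S.d)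
    (hK : IsWeightFunction S.K) (hx₀ : x₀ ∈ Ioo (0 : ℝ) 1) (hD : 0 < D)
    (hx : ∀ n : ℕ, 1 ≤ n → IsGapDesign n (x n) D) (hCd : 0 < Cd)
    (hxd : ∀ n : ℕ, 1 ≤ n → ∀ t : ℝ, 1 / (n : ℝ) ≤ t →
      ((window n (x n) x₀ t).card : ℝ) ≤ Cd * n * t)
    (hctrl : WindowControl S x x₀ (Ioc 0 (min x₀ (1 - x₀))) Λ N)
    (hC₁ : 0 < C₁) (hC₂ : 0 < C₂) (hγ : 0 < γ) {a b δ : ℝ} (ha : 0 < a) (hab : a ≤ b)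
    (hδ : 0 < δ) :
    ∃ Bl : ℝ, 0 < Bl ∧ ∀ᶠ n : ℕ in atTop, ∀ h : ℝ, a * rate γ n ≤ h → h ≤ b * rate γ n →
      ∀ V ∈ varianceClass C₁ C₂ γ, δ ≤ V x₀ → ∀ g : ℝ → ℝ,
        ENNReal.ofReal (Bl * rate γ n ^ (2 * γ)) ≤ risk P ε S n (x n) g V x₀ h := by
  obtain ⟨κ, hκ, hrisk⟩ := exists_risk_ge_of_le_variance hε hd hK
  have hb : 0 < b := ha.trans_le hab
  have hm : 0 < min γ 1 := lt_min hγ one_pos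
  set L := C₁ + 4 * C₂ with hL
  have hL0 : 0 < L := by positivity
  have hx1 : 0 < 1 - x₀ := by linarith [hx₀.2]
  -- Within distance `s` of `x₀` points stay in `(0,1)`, and the common modulus of continuity lets
  -- `V` drop by at most `δ / 2`.
  set s := min (min x₀ (1 - x₀)) ((δ / 2 / L) ^ (1 / min γ 1)) with hs
  have hs0 : 0 < s := lt_min (lt_min hx₀.1 hx1) (by positivity)
  refine ⟨κ * (δ / 2) ^ 2 / (Cd * b), by positivity, ?_⟩
  -- The term `S.r * D / n` allows for index shifts in a pseudoresidual. In `max N 1`, `N` is the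
  -- threshold for control and 1 ensures `h ≥ 1 / n` for the density bound.
  filter_upwards [eventually_rate hγ b (S.r * D) (max N 1) ha hs0] with n hn h hh1 hh2 V hV hVδ g
  obtain ⟨hn1, hsn, hNn⟩ := hn
  have hn' : (0 : ℝ) < n := by exact_mod_cast hn1
  have hν := rate_pos (γ := γ) hn1
  have hh0 : 0 < h := lt_of_lt_of_le (by positivity) hh1
  have hrD : 0 ≤ S.r * D / n := by positivity
  have hhs : h + S.r * D / n < s := by linarith
  have hs1 : s ≤ x₀ := (min_le_left _ _).trans (min_le_left _ _)
  have hs2 : s ≤ 1 - x₀ := (min_le_left _ _).trans (min_le_right _ _)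
  have hhmem : h ∈ Ioc 0 (min x₀ (1 - x₀)) :=
    ⟨hh0, by linarith [min_le_left (min x₀ (1 - x₀)) ((δ / 2 / L) ^ (1 / min γ 1))]⟩
  have hmin : min h 1 = h := min_eq_left (by linarith [hx₀.2])
  have hnh : max N 1 ≤ n * h := hNn.trans (by gcongr)
  have hw : WellDefined S n (x n) x₀ h := by
    refine (hctrl n hn1 h hhmem ?_).wellDefined (by rw [hmin]; exact hh0) hK.1
    rw [hmin]; exact (le_max_left _ _).trans hnh
  have hcard : ((window n (x n) x₀ h).card : ℝ) ≤ Cd * n * h := by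
    refine hxd n hn1 h ?_
    rw [div_le_iff₀ hn', mul_comm]
    exact (le_max_right _ _).trans hnh
  refine le_trans (ENNReal.ofReal_le_ofReal ?_) (hrisk n (x n) x₀ h (Cd * n * h) (δ / 2) g V hh0
    (by positivity) (by positivity) hw hcard ?_)
  · rw [← one_div_mul_rate hγ hn1]
    calc κ * (δ / 2) ^ 2 / (Cd * b) * (1 / (n * rate γ n))
        = κ * (δ / 2) ^ 2 / (Cd * n * (b * rate γ n)) := by field_simp
      _ ≤ _ := by gcongr
  · intro i hi hit j hj
    have hj' := Finset.mem_range.mp hj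
    have hi' := hi
    rw [indices, Finset.mem_Icc] at hi'
    have h1 := add_sub_mem hi hj
    have hclose : |x n (j + i - S.r / 2) - x n i| ≤ S.r * (D / n) :=
      (hx n hn1).abs_sub_le hD.le (by omega) (by omega) (by omega) (by omega)
    rw [← mul_div_assoc] at hclose
    have hdist : |x n (j + i - S.r / 2) - x₀| < s := by
      have := abs_sub_le (x n (j + i - S.r / 2)) (x n i) x₀
      linarith
    have hdist' := abs_lt.mp hdist
    have h2 := abs_sub_le_of_mem_holderClass hC₁ hC₂ hγ hV.1 (s := x n (j + i - S.r / 2)) (t := x₀)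
      ⟨by linarith, by linarith⟩ hx₀
    have h3 : |x n (j + i - S.r / 2) - x₀| ^ min γ 1 ≤ δ / 2 / L := by
      calc _ ≤ ((δ / 2 / L) ^ (1 / min γ 1)) ^ min γ 1 := by
            refine Real.rpow_le_rpow (abs_nonneg _) ?_ hm.le
            exact hdist.le.trans (min_le_right _ _)
        _ = δ / 2 / L := by
            rw [← Real.rpow_mul (by positivity), one_div_mul_cancel hm.ne', Real.rpow_one]
    have h4 : L * |x n (j + i - S.r / 2) - x₀| ^ min γ 1 ≤ δ / 2 := by
      calc _ ≤ L * (δ / 2 / L) := by gcongr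
        _ = δ / 2 := by field_simp
    have h5 := (abs_le.mp (h2.trans h4)).1
    linarith

/-- Differencing `g` contributes a bias of order `n ^ (-2 * min β 1)`. This inequality of exponents
says that it is of smaller order than `rate γ n ^ γ`, and it is here that the bound on `β` enters.
-/
lemma le_mul_min {β : ℝ} (hγ : 0 < γ) (hβ : γ / (4 * γ + 2) < β) :
    γ < (2 * γ + 1) * (2 * min β 1) := by
  rw [div_lt_iff₀ (by positivity)] at hβ
  rcases min_choice β 1 with h | h <;> rw [h] <;> linarith

lemma le_mul_min_self (hγ : 0 < γ) : γ ≤ (2 * γ + 1) * min γ 1 := by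
  rcases min_choice γ 1 with h | h <;> rw [h] <;> nlinarith

set_option maxHeartbeats 400000 in
/-- Upper bound for the risk, uniformly over the function classes. -/
lemma exists_risk_le (hε : IsErrorSequence P ε) (hd : IsDifferenceSequence S.r S.d)
    (hK : IsWeightFunction S.K) (hx₀ : x₀ ∈ Ioo (0 : ℝ) 1) (hD : 0 < D)
    (hx : ∀ n : ℕ, 1 ≤ n → IsGapDesign n (x n) D) (hCd : 0 < Cd)
    (hxd : ∀ n : ℕ, 1 ≤ n → ∀ t : ℝ, 1 / (n : ℝ) ≤ t →
      ((window n (x n) x₀ t).card : ℝ) ≤ Cd * n * t) (hΛ : 0 < Λ)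
    (hctrl : WindowControl S x x₀ (Ioc 0 (min x₀ (1 - x₀))) Λ N)
    (hC₁ : 0 < C₁) (hC₂ : 0 < C₂) (hγ : 0 < γ) (hp : strictFloor γ ≤ S.p) {a b : ℝ} (ha : 0 < a)
    (hab : a ≤ b) :
    ∃ Bu : ℝ, 0 < Bu ∧ ∀ β : ℝ, γ / (4 * γ + 2) < β → ∀ᶠ n : ℕ in atTop, ∀ h : ℝ,
      a * rate γ n ≤ h → h ≤ b * rate γ n → WellDefined S n (x n) x₀ h ∧
        ∀ V ∈ varianceClass C₁ C₂ γ, ∀ g ∈ holderClass C₁ C₂ β,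
          risk P ε S n (x n) g V x₀ h ≤ ENNReal.ofReal (Bu * rate γ n ^ (2 * γ)) := by
  obtain ⟨M, hM⟩ := hK.2.1
  have hM0 : 0 ≤ M := (hK.1 0).trans (hM 0)
  have hb : 0 < b := ha.trans_le hab
  have hμ4 : 0 ≤ ∫ ω, ε 0 ω ^ 4 ∂P := integral_nonneg fun ω => by positivity
  set L := C₁ + 4 * C₂ with hL
  have hL0 : 0 < L := by positivity
  set Q := (S.r + 1 : ℝ) ^ 2 * (8 * (C₂ ^ 4 + C₂ ^ 2 * ∫ ω, ε 0 ω ^ 4 ∂P)) with hQ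
  set W := M * Λ * Cd with hW
  set B₀ := 1 + L * (S.r * D) ^ min γ 1 + C₁ * b ^ γ with hB₀
  have hx1 : 0 < 1 - x₀ := by linarith [hx₀.2]
  refine ⟨(2 * S.r + 1) * (Q * (W * (M * Λ) / a)) + (W * B₀) ^ 2 + 1, by positivity, ?_⟩
  intro β hβ
  have hβ0 : 0 < β := lt_trans (by positivity) hβ
  set A := ((∑ j ∈ Finset.range (S.r + 1), |S.d j|) * (L * (S.r * D) ^ min β 1)) ^ 2 with hA
  set e := (2 * γ + 1) * (2 * min β 1) - γ with he
  have he0 : 0 < e := sub_pos.mpr (le_mul_min hγ hβ)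
  -- `A` depends on `β`, but the strict gain `e > 0` absorbs it for large `n`. The contribution of
  -- `g` is then the summand 1 in `B₀`, so `Bu` is free of `β`.
  have hsmall : ∀ᶠ n : ℕ in atTop, A * rate γ n ^ e ≤ 1 := by
    have h1 : Tendsto (fun n : ℕ => A * rate γ n ^ e) atTop (nhds (A * 0 ^ e)) :=
      ((tendsto_rate hγ).rpow_const (Or.inr he0.le)).const_mul A
    rw [Real.zero_rpow he0.ne', mul_zero] at h1
    exact (h1.eventually_lt_const one_pos).mono fun _ h => h.le
  filter_upwards [eventually_rate hγ b (S.r * D) (max N 1) ha (lt_min hx₀.1 hx1), hsmall]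
    with n hn hAn h hh1 hh2
  obtain ⟨hn1, hsn, hNn⟩ := hn
  have hn' : (0 : ℝ) < n := by exact_mod_cast hn1
  have hν := rate_pos (γ := γ) hn1
  have hν1 := rate_le_one hγ hn1
  set ν := rate γ n with hνdef
  have hh0 : 0 < h := lt_of_lt_of_le (by positivity) hh1
  have hrD : 0 ≤ S.r * D / n := by positivity
  have hs1 := min_le_left x₀ (1 - x₀)
  have hs2 := min_le_right x₀ (1 - x₀)
  have hhs : h + S.r * (D / n) < min x₀ (1 - x₀) := by rw [← mul_div_assoc]; linarith
  have hhmem : h ∈ Ioc 0 (min x₀ (1 - x₀)) := ⟨hh0, by linarith⟩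
  have hmin : min h 1 = h := min_eq_left (by linarith [hx₀.2])
  have hnh : max N 1 ≤ n * h := hNn.trans (by gcongr)
  have hcon := hctrl n hn1 h hhmem (by rw [hmin]; exact (le_max_left _ _).trans hnh)
  rw [hmin] at hcon
  have hw : WellDefined S n (x n) x₀ h := hcon.wellDefined hh0 hK.1
  have hcard : ((window n (x n) x₀ h).card : ℝ) ≤ Cd * n * h := by
    refine hxd n hn1 h ?_
    rw [div_le_iff₀ hn', mul_comm]
    exact (le_max_right _ _).trans hnh
  refine ⟨hw, fun V hV g hg => ?_⟩
  obtain ⟨c, hc⟩ := hw.exists_represents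
  have hle := risk_le hε hd hK hC₁ hC₂ hγ hβ0 hp hn1 hD (hx n hn1) hh0
    (by linarith) (by linarith) hw hc (w := M * (Λ / (n * h))) (by positivity)
    (fun i _ => abs_lpWeight_le hK hM hcon hh0.le (by positivity) hh0 hc (fun h => h)) hcard hV hg
  refine hle.trans (ENNReal.ofReal_le_ofReal ?_)
  rw [← hQ]
  have hpow : ∀ u : ℝ, 0 ≤ u → (S.r * (D / n)) ^ u = (S.r * D) ^ u * ν ^ ((2 * γ + 1) * u) := by
    intro u hu
    rw [← mul_div_assoc, div_eq_mul_one_div, one_div_eq_rate_rpow hγ,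
      Real.mul_rpow (by positivity) (by positivity), ← Real.rpow_mul hν.le]
  have hE1 : ((∑ j ∈ Finset.range (S.r + 1), |S.d j|) * (L * (S.r * (D / n)) ^ min β 1)) ^ 2 ≤
      ν ^ γ := by
    have hmβ : 0 < min β 1 := lt_min hβ0 one_pos
    rw [hpow _ hmβ.le]
    calc _ = A * (ν ^ ((2 * γ + 1) * min β 1)) ^ 2 := by rw [hA]; ring
      _ = A * ν ^ e * ν ^ γ := by
        rw [mul_assoc, ← Real.rpow_add hν, ← Real.rpow_natCast, ← Real.rpow_mul hν.le]
        congr 2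
        rw [he]; push_cast; ring
      _ ≤ 1 * ν ^ γ := by gcongr
      _ = ν ^ γ := one_mul _
  have hE2 : L * (S.r * (D / n)) ^ min γ 1 ≤ L * (S.r * D) ^ min γ 1 * ν ^ γ := by
    have hm : 0 < min γ 1 := lt_min hγ one_pos
    rw [hpow _ hm.le, ← mul_assoc]
    refine mul_le_mul_of_nonneg_left ?_ (by positivity)
    refine Real.rpow_le_rpow_of_exponent_ge hν hν1 ?_
    exact le_mul_min_self hγ
  have hE3 : C₁ * h ^ γ ≤ C₁ * b ^ γ * ν ^ γ := by
    rw [mul_assoc, ← Real.mul_rpow hb.le hν.le]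
    gcongr
  have hsum : ((∑ j ∈ Finset.range (S.r + 1), |S.d j|) *
      (L * (S.r * (D / n)) ^ min β 1)) ^ 2 + L * (S.r * (D / n)) ^ min γ 1 + C₁ * h ^ γ ≤
      B₀ * ν ^ γ := by
    rw [hB₀]; linarith
  have hNw : Cd * n * h * (M * (Λ / (n * h))) = W := by rw [hW]; field_simp
  have hNw2 : Cd * n * h * (M * (Λ / (n * h))) ^ 2 ≤ W * (M * Λ) / a * ν ^ (2 * γ) := by
    calc _ = W * (M * (Λ / (n * h))) := by rw [← hNw]; ring
      _ ≤ W * (M * (Λ / (n * (a * ν)))) := by gcongr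
      _ = W * (M * Λ) / a * (1 / (n * ν)) := by field_simp
      _ = _ := by rw [one_div_mul_rate hγ hn1]
  have hsq : (ν ^ γ) ^ 2 = ν ^ (2 * γ) := by
    rw [← Real.rpow_natCast, ← Real.rpow_mul hν.le]; congr 1; push_cast; ring
  calc _ ≤ (2 * S.r + 1) * (Q * (W * (M * Λ) / a * ν ^ (2 * γ))) + (W * (B₀ * ν ^ γ)) ^ 2 := by
        rw [← mul_assoc (Cd * n * h), hNw]
        gcongr
    _ = ((2 * S.r + 1) * (Q * (W * (M * Λ) / a)) + (W * B₀) ^ 2) * ν ^ (2 * γ) := by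
        rw [← hsq]; ring
    _ ≤ _ := by
        have : 0 ≤ ν ^ (2 * γ) := by positivity
        linarith

lemma risk_le_maxRisk {β : ℝ} {n : ℕ} {xs : ℕ → ℝ} {t h : ℝ} {V g : ℝ → ℝ}
    (hV : V ∈ varianceClass C₁ C₂ γ) (hg : g ∈ holderClass C₁ C₂ β) :
    risk P ε S n xs g V t h ≤ maxRisk P ε S C₁ C₂ γ β n xs t h :=
  le_iSup₂_of_le V hV (le_iSup₂_of_le g hg le_rfl)

/-- The order of nearly optimal bandwidths. -/
lemma exists_bandwidth_bounds (hε : IsErrorSequence P ε) (hd : IsDifferenceSequence S.r S.d)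
    (hK : IsWeightFunction S.K) (hx₀ : x₀ ∈ Ioo (0 : ℝ) 1)
    (hx : ∀ n : ℕ, 1 ≤ n → IsGapDesign n (x n) D) (hCd : 0 < Cd)
    (hxd : ∀ n : ℕ, 1 ≤ n → ∀ t : ℝ, 1 / (n : ℝ) ≤ t →
      ((window n (x n) x₀ t).card : ℝ) ≤ Cd * n * t) (hΛ : 0 < Λ) {B : Set ℝ} (hB : B ⊆ Ioi 0)
    (hB' : Ioc 0 (min x₀ (1 - x₀)) ⊆ B) (hctrl : WindowControl S x x₀ B Λ N)
    (hC₁ : 0 < C₁) (hC₂ : 0 < C₂) (hγ : 0 < γ) {Bu : ℝ} (hBu : 0 < Bu)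
    (hupper : ∀ β : ℝ, γ / (4 * γ + 2) < β → ∀ᶠ n : ℕ in atTop,
      WellDefined S n (x n) x₀ (rate γ n) ∧ maxRisk P ε S C₁ C₂ γ β n (x n) x₀ (rate γ n) ≤
        ENNReal.ofReal (Bu * rate γ n ^ (2 * γ))) {A : ℝ} (hA : 1 ≤ A) :
    ∃ c C : ℝ, 0 < c ∧ 0 < C ∧ ∀ β : ℝ, γ / (4 * γ + 2) < β → ∀ᶠ n : ℕ in atTop, ∀ h : ℝ,
      IsOptimalBandwidth P ε S C₁ C₂ γ β n (x n) x₀ B A h →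
        c * rate γ n ≤ h ∧ h ≤ C * rate γ n := by
  obtain ⟨κ, hκ, hrisk⟩ := exists_risk_ge_of_le_variance hε hd hK
  obtain ⟨M', hM'⟩ := hK.2.1
  obtain ⟨M, hM, hM0⟩ : ∃ M, (∀ u, S.K u ≤ M) ∧ 0 < M :=
    ⟨max M' 1, fun u => (hM' u).trans (le_max_left _ _), by positivity⟩
  obtain ⟨cb, hcb, hbump⟩ := exists_bumps hC₁ hC₂ hγ x₀
  have hx1 : 0 < 1 - x₀ := by linarith [hx₀.2]
  have hA0 : 0 < A := by linarith
  -- Relative width of the bump: weights of size `M * Λ / (n * H)` on at most `Cd * n * τ * H`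
  -- points have total at most one half.
  set τ := min 1 (1 / (2 * (M * Λ * Cd))) with hτ
  have hτ0 : 0 < τ := by positivity
  have hτ1 : τ ≤ 1 := min_le_left _ _
  set T := A * Bu with hT
  have hT0 : 0 < T := by positivity
  set c := κ * C₂ ^ 2 / Cd / T with hc
  have hc0 : 0 < c := by positivity
  set C := (4 * T / cb ^ 2) ^ (1 / (2 * γ)) / τ with hCdef
  have hC0 : 0 < C := by positivity
  refine ⟨c, C, hc0, hC0, fun β hβ => ?_⟩
  have hsmall : ∀ᶠ n : ℕ in atTop, T * rate γ n ^ (2 * γ) < κ * C₂ ^ 2 / Cd := by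
    have h1 : Tendsto (fun n : ℕ => T * rate γ n ^ (2 * γ)) atTop (nhds (T * 0 ^ (2 * γ))) :=
      ((tendsto_rate hγ).rpow_const (Or.inr (by positivity))).const_mul T
    rw [Real.zero_rpow (by positivity), mul_zero] at h1
    exact h1.eventually_lt_const (by positivity)
  filter_upwards [hupper β hβ, hsmall, eventually_rate hγ C 0 (max N (1 / τ)) hc0 one_pos,
    eventually_rate hγ 1 0 0 one_pos (lt_min hx₀.1 hx1),
    tendsto_natCast_atTop_atTop.eventually_ge_atTop (max N (1 / τ))]
    with n hup hsm hn hn2 hnN h hopt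
  obtain ⟨hn1, hCn, hNn⟩ := hn
  have hn' : (0 : ℝ) < n := by exact_mod_cast hn1
  have hν := rate_pos (γ := γ) hn1
  set ν := rate γ n with hνdef
  obtain ⟨hhB, hw, hle⟩ := hopt
  have hh0 : 0 < h := hB hhB
  have hνB : ν ∈ B := hB' ⟨hν, by
    have := hn2.2.1
    simp only [one_mul, zero_div, add_zero] at this
    exact this.le⟩
  have hmax : maxRisk P ε S C₁ C₂ γ β n (x n) x₀ h ≤ ENNReal.ofReal (T * ν ^ (2 * γ)) := by
    refine (hle ν hνB hup.1).trans ?_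
    rw [hT, mul_assoc, ENNReal.ofReal_mul hA0.le]
    gcongr
    exact hup.2
  have hTν : 0 ≤ T * ν ^ (2 * γ) := by positivity
  have hlow : c * ν ≤ h := by
    -- The density bound holds only from radius `1 / n` on. A bandwidth `h ≤ 1 / n` is then excluded
    -- because its risk would stay above the constant `κ * C₂ ^ 2 / Cd`.
    have hcard : ((window n (x n) x₀ h).card : ℝ) ≤ Cd * n * max h (1 / n) := by
      refine le_trans ?_ (hxd n hn1 (max h (1 / n)) (le_max_right _ _))
      refine Nat.cast_le.mpr (Finset.card_le_card fun i hi => ?_)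
      have := Finset.mem_filter.mp hi
      exact Finset.mem_filter.mpr ⟨this.1, this.2.trans (le_max_left _ _)⟩
    have h1 := (hrisk n (x n) x₀ h (Cd * n * max h (1 / n)) C₂ (fun _ => 0) (fun _ => C₂) hh0
      (by positivity) hC₂ hw hcard (fun _ _ _ _ _ => le_rfl)).trans
      ((risk_le_maxRisk (const_mem_varianceClass hC₁ hC₂)
        (zero_mem_holderClass (β := β) hC₁ hC₂)).trans hmax)
    rw [ENNReal.ofReal_le_ofReal_iff hTν, div_le_iff₀ (by positivity)] at h1
    have hlt : 1 / (n : ℝ) < h := by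
      by_contra hcon
      push Not at hcon
      rw [max_eq_right hcon, mul_assoc Cd, mul_one_div_cancel hn'.ne', mul_one] at h1
      rw [lt_div_iff₀ hCd] at hsm
      linarith
    rw [max_eq_left hlt.le, ← one_div_mul_rate hγ hn1] at h1
    calc c * ν = κ * C₂ ^ 2 * (ν / (Cd * T)) := by rw [hc]; field_simp
      _ ≤ T * (1 / (n * ν)) * (Cd * n * h) * (ν / (Cd * T)) := by gcongr
      _ = h := by field_simp
  refine ⟨hlow, ?_⟩
  set H := min h 1 with hH
  have hH0 : 0 < H := lt_min hh0 one_pos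
  have hnH : max N (1 / τ) ≤ n * H := by
    rw [hH]
    rcases min_choice h 1 with h' | h' <;> rw [h']
    · exact hNn.trans (by gcongr)
    · rw [mul_one]; exact hnN
  have hcon := hctrl n hn1 h hhB ((le_max_left _ _).trans hnH)
  rw [← hH] at hcon
  obtain ⟨cc, hcc⟩ := hw.exists_represents
  have hη0 : 0 < τ * H := by positivity
  -- The bump scales with `H`, not `h`, since the class only provides widths up to 1. The resulting
  -- bound on `H` tends to 0, so finally `H = h`.
  obtain ⟨V, hV, hVx, hV0, hVle, hVη⟩ := hbump (τ * H) hη0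
    (by have := min_le_right h 1; nlinarith)
  have hcard := hxd n hn1 (τ * H) (by
    have := (le_max_right _ _).trans hnH
    rw [div_le_iff₀ hτ0] at this
    rw [div_le_iff₀ hn']
    linarith)
  have h1 := (risk_ge_of_bump hε hd hw hcc hV0 (by rw [hVx]; exact hVle) hVη
    (w := M * (Λ / (n * H)))
    (by
      intro i hi
      by_cases hi1 : |x n i - x₀| ≤ 1
      · exact abs_lpWeight_le hK hM hcon hH0.le (by positivity) hh0 hcc
          (fun h' => le_min h' hi1)
      · exfalso
        rw [indices, Finset.mem_Icc] at hi
        have := (hx n hn1).mem_Icc (i := i) (by omega)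
        refine hi1 (abs_le.mpr ⟨?_, ?_⟩) <;> linarith [this.1, this.2, hx₀.1, hx₀.2])
    hcard
    (by
      calc M * (Λ / (n * H)) * (Cd * n * (τ * H)) = M * Λ * Cd * τ := by field_simp
        _ ≤ M * Λ * Cd * (1 / (2 * (M * Λ * Cd))) := by gcongr; exact min_le_right _ _
        _ = 1 / 2 := by field_simp)
    (by positivity)).trans
    ((risk_le_maxRisk hV (zero_mem_holderClass (β := β) hC₁ hC₂)).trans hmax)
  rw [ENNReal.ofReal_le_ofReal_iff hTν, hVx] at h1
  have hsq : ∀ u : ℝ, 0 ≤ u → (u ^ γ) ^ 2 = u ^ (2 * γ) := by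
    intro u hu
    rw [← Real.rpow_natCast, ← Real.rpow_mul hu]; congr 1; push_cast; ring
  rw [mul_pow, hsq _ hη0.le] at h1
  have h2 : (τ * H) ^ (2 * γ) ≤ (4 * T / cb ^ 2) * ν ^ (2 * γ) := by
    rw [div_mul_eq_mul_div, le_div_iff₀ (by positivity)]
    linarith
  have h3 : τ * H ≤ (4 * T / cb ^ 2) ^ (1 / (2 * γ)) * ν := by
    refine (Real.rpow_le_rpow_iff hη0.le (by positivity) (by positivity : 0 < 2 * γ)).mp ?_
    rwa [Real.mul_rpow (by positivity) hν.le, ← Real.rpow_mul (by positivity),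
      one_div_mul_cancel (by positivity), Real.rpow_one]
  have h4 : H ≤ C * ν := by
    rw [hCdef, div_mul_eq_mul_div, le_div_iff₀ hτ0]
    linarith
  have h5 : H < 1 := by
    simp only [zero_div, add_zero] at hCn
    linarith
  have h6 : H = h := by
    rcases min_choice h 1 with h' | h'
    · exact h'
    · rw [hH, h'] at h5; exact absurd h5 (lt_irrefl _)
  rw [← h6]; exact h4

end Main

end DiffVar
end

/-! ### Assembly of the four statements. -/

theorem theorem2p8 {Ω : Type*} [MeasurableSpace Ω] (P : Measure Ω) [IsProbabilityMeasure P]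
    (ε : ℕ → Ω → ℝ) (hε : DiffVar.IsErrorSequence P ε)
    (S : DiffVar.Spec) (hd : DiffVar.IsDifferenceSequence S.r S.d)
    (hK : DiffVar.IsWeightFunction S.K) (hKc : ∀ᵐ u : ℝ, ContinuousAt S.K u)
    (x₀ : ℝ) (hx₀ : x₀ ∈ Ioo (0 : ℝ) 1)
    (x : ℕ → ℕ → ℝ) (hx : DiffVar.IsDesign x) (hxd : DiffVar.HasBoundedDensityAt x x₀)
    (C₁ C₂ γ : ℝ) (hC₁ : 0 < C₁) (hC₂ : 0 < C₂) (hγ : 0 < γ)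
    (hp : DiffVar.strictFloor γ < S.p) :
    -- two-sided bound on the maximal risk, and hence the uniform upper bound
    (∀ a b : ℝ, 0 < a → a ≤ b →
      ∃ Bl Bu : ℝ, 0 < Bl ∧ 0 < Bu ∧ ∀ β : ℝ, γ / (4 * γ + 2) < β →
        ∀ᶠ n : ℕ in atTop, ∀ h : ℝ,
          a ≤ (n : ℝ) ^ (1 / (2 * γ + 1)) * h → (n : ℝ) ^ (1 / (2 * γ + 1)) * h ≤ b →
          DiffVar.WellDefined S n (x n) x₀ h ∧
          ENNReal.ofReal (Bl * (n : ℝ) ^ (-(2 * γ / (2 * γ + 1))))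
            ≤ DiffVar.maxRisk P ε S C₁ C₂ γ β n (x n) x₀ h ∧
          DiffVar.maxRisk P ε S C₁ C₂ γ β n (x n) x₀ h
            ≤ ENNReal.ofReal (Bu * (n : ℝ) ^ (-(2 * γ / (2 * γ + 1))))) ∧
    -- lower bound for each variance function bounded away from zero at the point
    (∀ a b δ : ℝ, 0 < a → a ≤ b → 0 < δ →
      ∃ Bl : ℝ, 0 < Bl ∧ ∀ β : ℝ, γ / (4 * γ + 2) < β →
        ∀ᶠ n : ℕ in atTop, ∀ h : ℝ,
          a ≤ (n : ℝ) ^ (1 / (2 * γ + 1)) * h → (n : ℝ) ^ (1 / (2 * γ + 1)) * h ≤ b →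
          ∀ V ∈ DiffVar.varianceClass C₁ C₂ γ, δ ≤ V x₀ →
          ∀ g ∈ DiffVar.holderClass C₁ C₂ β,
            ENNReal.ofReal (Bl * (n : ℝ) ^ (-(2 * γ / (2 * γ + 1))))
              ≤ DiffVar.risk P ε S n (x n) g V x₀ h) ∧
    -- order of the optimal bandwidth, among windows contained in the unit interval
    (∀ A : ℝ, 1 ≤ A →
      ∃ c C : ℝ, 0 < c ∧ 0 < C ∧ ∀ β : ℝ, γ / (4 * γ + 2) < β →
        ∀ᶠ n : ℕ in atTop, ∀ h : ℝ,
          DiffVar.IsOptimalBandwidth P ε S C₁ C₂ γ β n (x n) x₀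
            (Ioc 0 (min x₀ (1 - x₀))) A h →
          c * (n : ℝ) ^ (-(1 / (2 * γ + 1))) ≤ h ∧ h ≤ C * (n : ℝ) ^ (-(1 / (2 * γ + 1)))) ∧
    -- order of the optimal bandwidth, among all bandwidths
    ((∃ κ ρ : ℝ, 0 < κ ∧ 0 < ρ ∧ ∀ u : ℝ, |u| ≤ ρ → κ ≤ S.K u) →
      ∀ A : ℝ, 1 ≤ A →
      ∃ c C : ℝ, 0 < c ∧ 0 < C ∧ ∀ β : ℝ, γ / (4 * γ + 2) < β →
        ∀ᶠ n : ℕ in atTop, ∀ h : ℝ,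
          DiffVar.IsOptimalBandwidth P ε S C₁ C₂ γ β n (x n) x₀ (Ioi 0) A h →
          c * (n : ℝ) ^ (-(1 / (2 * γ + 1))) ≤ h ∧ h ≤ C * (n : ℝ) ^ (-(1 / (2 * γ + 1)))) := by
  obtain ⟨D, hD, hxD⟩ := hx.exists_gap
  obtain ⟨Cd, hCd, hxd'⟩ := hxd.exists_card_window_le
  obtain ⟨Λ, N, hΛ, -, hctrl⟩ := DiffVar.exists_windowControl_inside hK hKc (x₀ := x₀) hD hxD
  have hupper : ∀ a b : ℝ, 0 < a → a ≤ b → _ := fun a b ha hab =>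
    DiffVar.exists_risk_le hε hd hK hx₀ hD hxD hCd hxd' hΛ hctrl hC₁ hC₂ hγ hp.le
      (a := a) (b := b) ha hab
  have hlower : ∀ a b δ : ℝ, 0 < a → a ≤ b → 0 < δ → _ := fun a b δ ha hab hδ =>
    DiffVar.exists_risk_ge hε hd hK hx₀ hD hxD hCd hxd' hctrl hC₁ hC₂ hγ
      (a := a) (b := b) (δ := δ) ha hab hδ
  -- The bandwidth `rate γ n` itself serves as the reference competitor for optimal bandwidths.
  obtain ⟨Bo, hBo, hone⟩ := hupper 1 1 one_pos le_rfl
  have hone' : ∀ β : ℝ, γ / (4 * γ + 2) < β → ∀ᶠ n : ℕ in atTop,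
      DiffVar.WellDefined S n (x n) x₀ (DiffVar.rate γ n) ∧
        DiffVar.maxRisk P ε S C₁ C₂ γ β n (x n) x₀ (DiffVar.rate γ n) ≤
          ENNReal.ofReal (Bo * DiffVar.rate γ n ^ (2 * γ)) := by
    intro β hβ
    filter_upwards [hone β hβ] with n hn
    obtain ⟨h1, h2⟩ := hn _ (one_mul _).le (one_mul _).ge
    exact ⟨h1, iSup₂_le fun V hV => iSup₂_le fun g hg => h2 V hV g hg⟩
  have hscale : ∀ {a b : ℝ} {n : ℕ} {h : ℝ}, 1 ≤ n →
      a ≤ (n : ℝ) ^ (1 / (2 * γ + 1)) * h → (n : ℝ) ^ (1 / (2 * γ + 1)) * h ≤ b →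
      a * DiffVar.rate γ n ≤ h ∧ h ≤ b * DiffVar.rate γ n := by
    intro a b n h hn h1 h2
    have hν := DiffVar.rate_pos (γ := γ) hn
    rw [DiffVar.rpow_mul_eq_div_rate] at h1 h2
    exact ⟨(le_div_iff₀ hν).mp h1, (div_le_iff₀ hν).mp h2⟩
  refine ⟨fun a b ha hab => ?_, fun a b δ ha hab hδ => ?_, fun A hA => ?_, ?_⟩
  · obtain ⟨Bu, hBu, hu⟩ := hupper a b ha hab
    -- The constant variance function `C₂` with `g = 0` witnesses the lower bound for the supremum,
    -- hence `δ = C₂`.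
    obtain ⟨Bl, hBl, hl⟩ := hlower a b C₂ ha hab hC₂
    refine ⟨Bl, Bu, hBl, hBu, fun β hβ => ?_⟩
    filter_upwards [hu β hβ, hl, eventually_ge_atTop 1] with n hn hn' hn1 h h1 h2
    obtain ⟨h3, h4⟩ := hscale hn1 h1 h2
    obtain ⟨hw, hle⟩ := hn h h3 h4
    rw [DiffVar.rpow_eq_rate_rpow]
    refine ⟨hw, ?_, iSup₂_le fun V hV => iSup₂_le fun g hg => hle V hV g hg⟩
    exact (hn' h h3 h4 _ (DiffVar.const_mem_varianceClass hC₁ hC₂) le_rfl (fun _ => 0)).trans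
      (DiffVar.risk_le_maxRisk (DiffVar.const_mem_varianceClass hC₁ hC₂)
        (DiffVar.zero_mem_holderClass hC₁ hC₂))
  · obtain ⟨Bl, hBl, hl⟩ := hlower a b δ ha hab hδ
    refine ⟨Bl, hBl, fun β _ => ?_⟩
    filter_upwards [hl, eventually_ge_atTop 1] with n hn hn1 h h1 h2 V hV hVδ g _
    obtain ⟨h3, h4⟩ := hscale hn1 h1 h2
    rw [DiffVar.rpow_eq_rate_rpow]
    exact hn h h3 h4 V hV hVδ g
  · exact DiffVar.exists_bandwidth_bounds hε hd hK hx₀ hxD hCd hxd' hΛ Ioc_subset_Ioi_self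
      Subset.rfl hctrl hC₁ hC₂ hγ hBo hone' hA
  · rintro ⟨κ, ρ, hκ, hρ, hKκ⟩ A hA
    obtain ⟨Λ', N', hΛ', -, hctrl'⟩ :=
      DiffVar.exists_windowControl_of_pos hK hκ hρ hKκ hx₀ hD hxD
    exact DiffVar.exists_bandwidth_bounds hε hd hK hx₀ hxD hCd hxd' hΛ' Subset.rfl
      Ioc_subset_Ioi_self hctrl' hC₁ hC₂ hγ hBo hone' hA
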